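/- **Setting.** Let $\mathcal T$ be a compact 3-manifold triangulation built from $n$ tetrahedra $\Delta_1,\dots,\Delta_n$: some or all of the $4n$ faces are affinely identified in pairs, and the resulting space is a compact 3-manifold, possibly with boundary. Equivalently, no edge is identified with its own reverse, and the link of every vertex is a 2-sphere or a disc; the link is a compact connected surface, so this says that it has Euler characteristic $2$ and empty boundary, or Euler characteristic $1$ and non-empty boundary. Let $V_1,\dots,V_m$ be the vertices of $\mathcal T$. Write vectors of $\mathbb R^{7n}$ as $(t_{i,1},\dots,t_{i,4},q_{i,1},q_{i,2},q_{i,3})_{i\le n}$ (four triangular and three quadrilateral disc types per tetrahedron) and vectors of $\mathbb R^{3n}$ as $(q_{i,1},q_{i,2},q_{i,3})_{i\le n}$. *Standard matching equations:* for each non-boundary face $F$, joining $\Delta_i$ and $\Delta_j$, and each edge $e$ of $F$, $t_{i,a}+q_{i,b}=t_{j,c}+q_{j,d}$, where these are the coordinates of the triangle and quadrilateral types of $\Delta_i$ and of $\Delta_j$ that meet $F$ in an arc parallel to $e$. *Quadrilateral matching equations:* for each non-boundary edge $e$, going round the cycle of tetrahedra that contain $e$, the sum of the coordinates of the quadrilateral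 types that rise along $e$ equals the sum of those of the types that fall. *Quadrilateral constraints:* for each $i$, at most one of $q_{i,1},q_{i,2},q_{i,3}$ is non-zero. The *standard* (resp. *quadrilateral*) *solution set* is the set of those vertices of the polytope of all non-negative vectors in $\mathbb R^{7n}$ (resp. $\mathbb R^{3n}$) with coordinate sum $1$ satisfying the standard (resp. quadrilateral) matching equations, that satisfy the quadrilateral constraints. Two vectors *together* satisfy the quadrilateral constraints if in each tetrahedron at least two of the three quadrilateral coordinates vanish in both. The vertex link $\ell(V)\in\mathbb R^{7n}$ has $1$ at the triangular positions surrounding $V$ and $0$ elsewhere. **Step 1 (direct enumeration: the double description method filtered by the quadrilateral constraints).** Start with the list $L$ of the $3n$ unit vectors of $\mathbb R^{3n}$. For each non-boundary edge, in any order, write its quadrilateral matching equation as $h(\mathbf x)=0$. Replace $L$ by its vectors with $h=0$, together with $(h(\mathbf u)\mathbf w-h(\mathbf w)\mathbf u)/(h(\mathbf u)-h(\mathbf w))$ for all $\mathbf u,\mathbf w\in L$ with $h(\mathbf u)>0>h(\mathbf w)$ that together satisfy the quadrilateral constraints and for which no other $\mathbf z\in L$ vanishes at all positions where both $\mathbf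 u$ and $\mathbf w$ vanish. Let $\mathbf q_1,\dots,\mathbf q_k$ be the final list. **Step 2 (conversion).** 1. Let $L_0$ consist of the canonical extensions of $\mathbf q_1,\dots,\mathbf q_k$. Here the canonical extension of $\mathbf q$ is computed as follows: keep the quadrilateral coordinates; for each vertex $V$ set one arbitrary triangular coordinate around $V$ to $0$ and find the others around $V$ by a depth-first search using the standard matching equations; then subtract $\lambda\,\ell(V)$, where $\lambda$ is the minimum of the triangular coordinates around $V$. 2. Let $C$ be the set of all quadrilateral positions. 3. For $r=1,\dots,m$: - (a) let $L_r$ consist of all $\mathbf x-\lambda\,\ell(V_r)$ with $\mathbf x\in L_{r-1}$, where $\lambda$ is the minimum of the triangular coordinates of $\mathbf x$ around $V_r$; - (b) insert $-\ell(V_r)$; - (c) for each triangular position $p$ around $V_r$, in any order, replace $L_r$ by its vectors with $x_p\ge 0$, together with $(u_p\mathbf w-w_p\mathbf u)/(u_p-w_p)$ for all $\mathbf u,\mathbf w\in L_r$ with $u_p>0>w_p$ that together satisfy the quadrilateral constraints and for which no other $\mathbf z\in L_r$ vanishes at all positions of $C$ where both $\mathbf u$ and $\mathbf w$ vanish; then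 insert $p$ into $C$; - (d) insert $\ell(V_r)$. 4. Output $\mathbf v/\sum_i v_i$ for each $\mathbf v\in L_m$. **Claim.** Carried out in exact rational arithmetic, Step 1 outputs the quadrilateral solution set of $\mathcal T$, each element exactly once, and Step 2 applied to this list outputs the standard solution set of $\mathcal T$, each element exactly once. -/

import Mathlib

namespace NormalSurface

/-! ### Triangulations -/

/-- A generalised triangulation: `n` tetrahedra, each with vertices `0, 1, 2, 3` and with face `f`
opposite vertex `f`, some or all of whose `4 n` faces are affinely identified in pairs.
`glue i f = none` says that face `f` of tetrahedron `i` is a boundary face.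
`glue i f = some (j, σ)` says that it is identified with face `σ f` of tetrahedron `j`, each
vertex `v ≠ f` of the face going to vertex `σ v`; this determines the affine identification. -/
structure Triangulation (n : ℕ) where
  glue : Fin n → Fin 4 → Option (Fin n × Equiv.Perm (Fin 4))
  glue_symm : ∀ i f j σ, glue i f = some (j, σ) → glue j (σ f) = some (i, σ⁻¹)
  glue_ne_self : ∀ i f j σ, glue i f = some (j, σ) → (j, σ f) ≠ (i, f)

/-- `(i, v)` is vertex `v` of tetrahedron `i`.  It also names the triangular disc type in
tetrahedron `i` that surrounds `v`. -/
abbrev Corner (n : ℕ) := Fin n × Fin 4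

/-- `(i, v, w)` with `v ≠ w` is the edge `v w` of tetrahedron `i`, directed from `v` to `w`. It
also names the point where that edge, near its end `v`, meets the link of `v`. -/
abbrev DirEdge (n : ℕ) := Fin n × Fin 4 × Fin 4

/-- `(i, v, f)` with `v ≠ f` is the arc in face `f` of tetrahedron `i` that cuts off the vertex
`v` of that face, equivalently the arc parallel to the edge of the face opposite `v`. -/
abbrev Arc (n : ℕ) := Fin n × Fin 4 × Fin 4

/-- `(i, p)` is tetrahedron `i` seen as one of the tetrahedra around its edge `p 0, p 1`, where
`p 0` is the lower end and `p 1` the upper end, entered through the face with vertices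
`p 0, p 1, p 2` and left through the face with vertices `p 0, p 1, p 3`. -/
abbrev Flag (n : ℕ) := Fin n × Equiv.Perm (Fin 4)

/-- Coordinate positions in the `7 n`-dimensional space of standard coordinates: `(i, inl v)` is
the triangular disc type of tetrahedron `i` around vertex `v`, and `(i, inr k)` is its
quadrilateral type `k`. -/
abbrev StdCoord (n : ℕ) := Fin n × (Fin 4 ⊕ Fin 3)

/-- Coordinate positions in the `3 n`-dimensional space of quadrilateral coordinates. -/
abbrev QuadCoord (n : ℕ) := Fin n × Fin 3

/-- For `a ≠ b`, the quadrilateral type that separates the vertices `a, b` of a tetrahedron from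
the other two vertices.  (The value for `a = b` is never used.) -/
def quadType (a b : Fin 4) : Fin 3 :=
  match a, b with
  | 0, 1 | 1, 0 | 2, 3 | 3, 2 => 0
  | 0, 2 | 2, 0 | 1, 3 | 3, 1 => 1
  | _, _ => 2

namespace Triangulation

variable {n : ℕ} (T : Triangulation n)

/-- Two tetrahedron vertices are identified directly by one face identification. -/
def CornerStep (c d : Corner n) : Prop :=
  ∃ f σ, f ≠ c.2 ∧ T.glue c.1 f = some (d.1, σ) ∧ d.2 = σ c.2

/-- Two tetrahedron vertices are the same vertex of the triangulation. -/
def SameVertex : Corner n → Corner n → Prop := Relation.EqvGen T.CornerStep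

/-- Two directed tetrahedron edges are identified directly by one face identification. -/
def DirEdgeStep (d e : DirEdge n) : Prop :=
  ∃ f σ, f ≠ d.2.1 ∧ f ≠ d.2.2 ∧ T.glue d.1 f = some (e.1, σ) ∧ e.2 = (σ d.2.1, σ d.2.2)

/-- Two directed tetrahedron edges are the same directed edge of the triangulation. -/
def SameDirEdge : DirEdge n → DirEdge n → Prop := Relation.EqvGen T.DirEdgeStep

/-- The arcs `a` and `b` in two identified faces are identified. -/
def ArcStep (a b : Arc n) : Prop :=
  ∃ σ, T.glue a.1 a.2.2 = some (b.1, σ) ∧ b.2 = (σ a.2.1, σ a.2.2)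

/-- The number of equivalence classes, under the equivalence relation generated by `r`, that
meet the set `A`. -/
noncomputable def numClasses {α : Type} (r : α → α → Prop) (A : Set α) : ℕ :=
  Set.ncard {S : Set α | ∃ a ∈ A, S = {b | Relation.EqvGen r a b}}

/-- The Euler characteristic of the link of the vertex containing the corner `c`.  The link is
the surface formed by one triangle for each tetrahedron vertex in the class of `c`, glued along
the arcs in which these triangles meet the identified faces. -/
noncomputable def linkEulerChar (c : Corner n) : ℤ :=
  (numClasses T.DirEdgeStep {d | d.2.1 ≠ d.2.2 ∧ T.SameVertex c (d.1, d.2.1)} : ℤ)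
    - numClasses T.ArcStep {a | a.2.1 ≠ a.2.2 ∧ T.SameVertex c (a.1, a.2.1)}
    + Set.ncard {d | T.SameVertex c d}

/-- The link of the vertex containing the corner `c` has non-empty boundary. -/
def LinkHasBoundary (c : Corner n) : Prop :=
  ∃ d f, T.SameVertex c d ∧ f ≠ d.2 ∧ T.glue d.1 f = none

/-- The space obtained from the tetrahedra is a compact 3-manifold, possibly with boundary.
Away from the vertices and the midpoints of edges this holds automatically.  At the midpoint of
an edge it holds if and only if the edge is not identified with its own reverse, and at a vertex
if and only if the vertex link, which is a compact connected surface, is a sphere (Euler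
characteristic `2`, no boundary) or a disc (Euler characteristic `1`, non-empty boundary). -/
structure IsCompactManifold : Prop where
  edge_not_reversed : ∀ i v w, v ≠ w → ¬ T.SameDirEdge (i, v, w) (i, w, v)
  link_sphere_or_disc : ∀ c : Corner n,
    (¬ T.LinkHasBoundary c ∧ T.linkEulerChar c = 2) ∨
      (T.LinkHasBoundary c ∧ T.linkEulerChar c = 1)

/-! ### Edges and the cycle of tetrahedra around an edge -/

/-- The next tetrahedron in the chosen direction around an edge. -/
def next (p : Flag n) : Option (Flag n) :=
  (T.glue p.1 (p.2 2)).map fun jσ => (jσ.1, jσ.2 * p.2 * Equiv.swap 2 3)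

/-- Walk around an edge from `q` until the flag `p` is reached again (at most `k` steps). -/
def walk (p : Flag n) : ℕ → Flag n → Option (List (Flag n))
  | 0, _ => none
  | k + 1, q =>
    match T.next q with
    | none => none
    | some q' => if q' = p then some [q] else (walk p k q').map (q :: ·)

/-- The cycle of tetrahedra around the edge of `p`, in the direction and with the upper and lower
ends given by `p`; it is `none` if the edge is a boundary edge.  There are `24 n` flags. -/
def edgeCycle (p : Flag n) : Option (List (Flag n)) := T.walk p (24 * n) p

/-- The edge of the flag is a non-boundary edge of the triangulation. -/
def InteriorEdge (p : Flag n) : Prop := (T.edgeCycle p).isSome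

/-- Two flags belong to the same (undirected) edge of the triangulation. -/
def SameEdge (p q : Flag n) : Prop :=
  T.SameDirEdge (p.1, p.2 0, p.2 1) (q.1, q.2 0, q.2 1) ∨
    T.SameDirEdge (p.1, p.2 0, p.2 1) (q.1, q.2 1, q.2 0)

/-- `edges` lists every non-boundary edge of the triangulation exactly once, each with a choice
of a direction around it and of its upper and lower ends. -/
structure IsInteriorEdgeList (edges : List (Flag n)) : Prop where
  interior : ∀ p ∈ edges, T.InteriorEdge p
  once : edges.Pairwise fun p q => ¬ T.SameEdge p q
  complete : ∀ p, T.InteriorEdge p → ∃ q ∈ edges, T.SameEdge p q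

/-- `verts` lists every vertex of the triangulation exactly once, each vertex being given by a
duplicate-free list of the tetrahedron vertices (triangular disc types) in its class. -/
structure IsVertexList (verts : List (List (Corner n))) : Prop where
  nodup : ∀ V ∈ verts, V.Nodup
  isClass : ∀ V ∈ verts, ∃ c, ∀ d, d ∈ V ↔ T.SameVertex c d
  once : verts.Pairwise List.Disjoint
  complete : ∀ c, ∃ V ∈ verts, c ∈ V

/-! ### Matching equations and solution sets -/

/-- The difference of the two sides of the quadrilateral matching equation of the edge of `p`:
for a tetrahedron `(i, q)` in the cycle around the edge, the two quadrilateral types that meet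
the edge are the ones separating `q 0, q 3` from `q 1, q 2` and `q 0, q 2` from `q 1, q 3`; the
first kind rises and the second kind falls as one moves around the cycle. -/
def edgeForm {K : Type} [Field K] (p : Flag n) (x : QuadCoord n → K) : K :=
  (((T.edgeCycle p).getD []).map fun q =>
    x (q.1, quadType (q.2 0) (q.2 3)) - x (q.1, quadType (q.2 0) (q.2 2))).sum

/-- The quadrilateral matching equations, one for each non-boundary edge. -/
def QuadMatching (x : QuadCoord n → ℝ) : Prop := ∀ p, T.InteriorEdge p → T.edgeForm p x = 0

/-- The standard matching equations, one for each non-boundary face and each edge of that face.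
The edge is the one opposite the vertex `v` of the face; in each of the two tetrahedra one
triangle type and one quadrilateral type meet the face in an arc cutting off `v`. -/
def StdMatching (x : StdCoord n → ℝ) : Prop :=
  ∀ i f j σ, T.glue i f = some (j, σ) → ∀ v, v ≠ f →
    x (i, Sum.inl v) + x (i, Sum.inr (quadType v f)) =
      x (j, Sum.inl (σ v)) + x (j, Sum.inr (quadType (σ v) (σ f)))

end Triangulation

/-- The quadrilateral constraints in quadrilateral coordinates: in each tetrahedron at most one
quadrilateral coordinate is non-zero. -/
def QuadConstraints {n : ℕ} (x : QuadCoord n → ℝ) : Prop :=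
  ∀ i k l, k ≠ l → x (i, k) = 0 ∨ x (i, l) = 0

/-- The quadrilateral projection, which drops all triangular coordinates. -/
def quadProj {n : ℕ} {K : Type} (x : StdCoord n → K) : QuadCoord n → K :=
  fun c => x (c.1, Sum.inr c.2)

namespace Triangulation

variable {n : ℕ} (T : Triangulation n)

/-- The standard projective solution space. -/
def stdSolutionSpace : Set (StdCoord n → ℝ) :=
  {x | (∀ c, 0 ≤ x c) ∧ ∑ c, x c = 1 ∧ T.StdMatching x}

/-- The quadrilateral projective solution space. -/
def quadSolutionSpace : Set (QuadCoord n → ℝ) :=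
  {x | (∀ c, 0 ≤ x c) ∧ ∑ c, x c = 1 ∧ T.QuadMatching x}

/-- The standard solution set: the vertices of the standard projective solution space that
satisfy the quadrilateral constraints. -/
def stdSolutionSet : Set (StdCoord n → ℝ) :=
  {x | x ∈ T.stdSolutionSpace.extremePoints ℝ ∧ QuadConstraints (quadProj x)}

/-- The quadrilateral solution set: the vertices of the quadrilateral projective solution space
that satisfy the quadrilateral constraints. -/
def quadSolutionSet : Set (QuadCoord n → ℝ) :=
  {x | x ∈ T.quadSolutionSpace.extremePoints ℝ ∧ QuadConstraints x}

end Triangulation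

/-! ### The algorithms

They are written over an arbitrary linearly ordered field `K` and are executable for `K = ℚ`. -/

section Algorithms

variable {K : Type} [Field K] [LinearOrder K]

/-- Two vectors together satisfy the quadrilateral constraints: in each tetrahedron at least two
of the three quadrilateral coordinates are zero in both vectors simultaneously. -/
def TogetherQuad {n : ℕ} (u w : QuadCoord n → K) : Prop :=
  ∀ i k l, k ≠ l → (u (i, k) = 0 ∧ w (i, k) = 0) ∨ (u (i, l) = 0 ∧ w (i, l) = 0)

instance {n : ℕ} (u w : QuadCoord n → K) : Decidable (TogetherQuad u w) := by
  unfold TogetherQuad; infer_instance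

/-- No vector of `L` other than `u` and `w` vanishes at all those positions of `C` at which both
`u` and `w` vanish. -/
def PassesAdjacencyTest {ι : Type} (C : Finset ι) (L : List (ι → K)) (u w : ι → K) : Prop :=
  ∀ z ∈ L, z ≠ u → z ≠ w → ¬ ∀ i ∈ C, u i = 0 → w i = 0 → z i = 0

instance {ι : Type} [Fintype ι] (C : Finset ι) (L : List (ι → K)) (u w : ι → K) :
    Decidable (PassesAdjacencyTest C L u w) := by
  unfold PassesAdjacencyTest; infer_instance

/-- The new vectors of one double description step for the linear form `h`: for every pair `u, w`
in `L` with `h u > 0 > h w` that satisfies `compat` and passes the adjacency test, the point where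
the line joining `u` and `w` meets the hyperplane `h = 0`. -/
def newVectors {ι : Type} [Fintype ι] (compat : (ι → K) → (ι → K) → Prop)
    [∀ u w, Decidable (compat u w)] (C : Finset ι) (h : (ι → K) → K) (L : List (ι → K)) :
    List (ι → K) :=
  (L.filter fun u => 0 < h u).flatMap fun u =>
    (L.filter fun w => h w < 0 ∧ compat u w ∧ PassesAdjacencyTest C L u w).map fun w =>
      (h u - h w)⁻¹ • (h u • w - h w • u)

/-- The projective image of a vector; the projective image of `0` is `0`. -/
def projImage {ι : Type} [Fintype ι] (x : ι → K) : ι → K := (∑ i, x i)⁻¹ • x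

/-- The standard vector of the link of the vertex whose triangular disc types are listed in
`V`. -/
def vertexLink {n : ℕ} (V : List (Corner n)) : StdCoord n → K
  | (i, Sum.inl v) => if (i, v) ∈ V then 1 else 0
  | (_, Sum.inr _) => 0

/-- The minimum of the triangular coordinates of `x` surrounding the vertex `V`. -/
def minAround {n : ℕ} (V : List (Corner n)) (x : StdCoord n → K) : K :=
  ((V.map fun c => x (c.1, Sum.inl c.2)).min?).getD 0

/-- The partial canonical part of `x` at the vertex `V`. -/
def partialCanonical {n : ℕ} (V : List (Corner n)) (x : StdCoord n → K) : StdCoord n → K :=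
  x - minAround V x • vertexLink V

namespace Triangulation

variable {n : ℕ} (T : Triangulation n)

/-- Direct enumeration in quadrilateral coordinates: the double description method, filtered by
the quadrilateral constraints.  It starts from the unit vectors, which span the non-negative
orthant, and intersects with the hyperplanes of the matching equations one after the other. -/
def directEnumeration (edges : List (Flag n)) : List (QuadCoord n → K) :=
  edges.foldl
    (fun L p => (L.filter fun x => T.edgeForm p x = 0) ++
      newVectors TogetherQuad Finset.univ (T.edgeForm p) L)
    (((List.finRange n).product (List.finRange 3)).map fun c => Pi.single c 1)

/-- Depth-first search through the triangular disc types around a vertex.  Visiting the disc type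
`c` sets its coordinate to `a`; then each adjacent disc type that has not been visited yet is
visited recursively, its coordinate being found from the standard matching equation.
`fuel` bounds the depth of the recursion. -/
def dfs (q : QuadCoord n → K) :
    ℕ → Corner n → K → (Corner n → Option K) → (Corner n → Option K)
  | 0, _, _, s => s
  | fuel + 1, c, a, s =>
    (List.finRange 4).foldl
      (fun s f =>
        if f = c.2 then s else
        match T.glue c.1 f with
        | none => s
        | some (j, σ) =>
          match s (j, σ c.2) with
          | some _ => s
          | none => dfs q fuel (j, σ c.2)
              (a + q (c.1, quadType c.2 f) - q (j, quadType (σ c.2) (σ f))) s)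
      (Function.update s c (some a))

/-- The canonical extension, computed as follows: for each vertex, set the coordinate of one
triangular disc type to zero, fill in the coordinates of the other disc types by a depth-first
search, and finally subtract the multiple of the vertex link that makes the minimum zero. -/
def canonicalExtension (verts : List (List (Corner n))) (q : QuadCoord n → K) :
    StdCoord n → K :=
  let s : Corner n → Option K := verts.foldl
    (fun s V => match V with
      | [] => s
      | c :: _ => T.dfs q (4 * n) c 0 s)
    fun _ => none
  let x : StdCoord n → K := fun c => match c with
    | (i, Sum.inl v) => (s (i, v)).getD 0
    | (i, Sum.inr k) => q (i, k)
  verts.foldl (fun x V => partialCanonical V x) x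

end Triangulation

/-- Process one triangular coordinate position `p`, given the current set of positions `C` and
the current list `L`. -/
def processPosition {n : ℕ} (CL : Finset (StdCoord n) × List (StdCoord n → K))
    (p : StdCoord n) : Finset (StdCoord n) × List (StdCoord n → K) :=
  (insert p CL.1,
    (CL.2.filter fun x => x p = 0) ++ (CL.2.filter fun x => 0 < x p) ++
      newVectors (fun u w => TogetherQuad (quadProj u) (quadProj w)) CL.1 (fun x => x p) CL.2)

/-- Process one vertex `V`: replace all vectors by their partial canonical parts, insert the
negative vertex link, process all triangular positions around `V`, insert the vertex link. -/
def processVertex {n : ℕ} (CL : Finset (StdCoord n) × List (StdCoord n → K))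
    (V : List (Corner n)) : Finset (StdCoord n) × List (StdCoord n → K) :=
  let CL' := (V.map fun c => ((c.1, Sum.inl c.2) : StdCoord n)).foldl processPosition
    (CL.1, CL.2.map (partialCanonical V) ++ [-vertexLink V])
  (CL'.1, CL'.2 ++ [vertexLink V])

namespace Triangulation

variable {n : ℕ} (T : Triangulation n)

/-- The conversion of the quadrilateral solution set `Q` into the standard solution set. -/
def quadToStd (verts : List (List (Corner n))) (Q : List (QuadCoord n → K)) :
    List (StdCoord n → K) :=
  ((verts.foldl processVertex
    (Finset.univ.filter fun c : StdCoord n => c.2.isRight,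
      Q.map (T.canonicalExtension verts))).2).map projImage

/-- Enumeration of the standard solution set: direct enumeration in quadrilateral coordinates,
followed by the conversion to standard coordinates. -/
def enumStd (verts : List (List (Corner n))) (edges : List (Flag n)) :
    List (StdCoord n → K) :=
  T.quadToStd verts (T.directEnumeration edges)

end Triangulation

end Algorithms

/-- The real vectors whose rational coordinates are listed in `L`. -/
def realVectors {ι : Type} (L : List (ι → ℚ)) : Set (ι → ℝ) :=
  {x | ∃ y ∈ L, x = fun i => (y i : ℝ)}

end NormalSurface

/-! Both steps rest on one analysis of the cone of vectors of a subspace `M` that are non-negative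
on a set `C` of positions. Extreme rays are described by supports: `x` spans one if every vector of
`M` whose support in `C` is contained in that of `x` is a multiple of `x` on `C` (`IsExtremal`). A
list is correct (`Represents`) if it has exactly one vector on each extreme ray that satisfies the
quadrilateral constraints. These constraints depend on supports only and pass to smaller supports,
so all extreme rays of the face of an admissible vector are admissible. Hence the filtered list,
though it omits many extreme rays of the cone, contains all that the adjacency test has to see: a
compatible pair `u`, `w` that passes it spans a two-dimensional face, and a hyperplane separating
`u` from `w` meets this face in a single new ray. Conversely each new ray arises so
(`exists_split`). This proves Step 1 (`Represents.hyperplane`).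

For Step 2, the quadrilateral projection identifies standard solutions modulo vertex links with
quadrilateral solutions, so the canonical extensions represent the extreme rays for `C` = all
quadrilateral positions (`isExtremal_quadProj_iff`). Vertices are then added one by one. Let `C₀` be
the positions processed before a vertex, `V` the positions around it, and `ℓ` its link. A ray for
`C₀` is a whole line of translates by `ℓ`. When the positions `P ⊆ V` are done, the list represents
two kinds of vectors: cut rays, which are extremal for `C₀ ∪ P` and are not multiples of `ℓ`, and
canonical rays, which are extremal for `C₀` and translated to have minimum 0 over `V`. So the list
is not the list of extreme rays for `C₀ ∪ P`: it lacks `ℓ` and has extra vectors, while the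
adjacency test sees only `C₀ ∪ P`. The test still works: a canonical ray that is not a cut ray
crosses only its own cut translate (`isCutRay_crossing_of_isCanonicalRay`), and two cut rays that
pass the test have a common zero in `P`, which keeps `ℓ` out of their face
(`isCutRay_crossing_of_isCutRay`). When `P = V`, canonical rays are cut rays and only `ℓ` is
missing.

Topology enters in showing that every quadrilateral solution has triangular coordinates. On a vertex
link these must have prescribed jumps across the arcs, and the quadrilateral matching equations say
that the jumps are closed around interior points. On a sphere or a disc closed implies exact. This
is proved by linear algebra (`FlagMap.exists_coboundary`): coboundaries of functions of triangles
and boundaries of functions of interior points are orthogonal, a dimension count with the Euler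
characteristic shows that together they fill the functions of interior arcs, and closedness removes
the second part. Depth-first search then recovers this solution up to a constant on each link.

Finally, extreme rays normalised to coordinate sum 1 are the vertices of the polytope, and the
rational computation agrees with the real one. -/

namespace NormalSurface

/-! ### Extreme rays and two-dimensional faces of polyhedral cones -/

section DoubleDescription

variable {ι : Type}

/-- The vectors agree on `C` up to a positive factor. -/
def PosProp (C : Finset ι) (x y : ι → ℝ) : Prop := ∃ a > 0, ∀ i ∈ C, x i = a * y i

/-- Modulo vectors that vanish on `C`, the vector `x` spans an extreme ray of the cone of all
vectors of `M` that are non-negative on `C`. -/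
structure IsExtremal (M : Submodule ℝ (ι → ℝ)) (C : Finset ι) (x : ι → ℝ) : Prop where
  mem : x ∈ M
  nonneg : ∀ i ∈ C, 0 ≤ x i
  ne_zero : ∃ i ∈ C, x i ≠ 0
  minimal : ∀ y ∈ M, (∀ i ∈ C, x i = 0 → y i = 0) → ∃ a : ℝ, ∀ i ∈ C, y i = a * x i

theorem PosProp.refl (C : Finset ι) (x : ι → ℝ) : PosProp C x x :=
  ⟨1, one_pos, fun i _ => by ring⟩

theorem PosProp.symm {C : Finset ι} {x y : ι → ℝ} (h : PosProp C x y) : PosProp C y x := by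
  obtain ⟨a, ha, h⟩ := h
  refine ⟨a⁻¹, inv_pos.2 ha, fun i hi => ?_⟩
  rw [h i hi, inv_mul_cancel_left₀ ha.ne']

theorem PosProp.trans {C : Finset ι} {x y z : ι → ℝ} (h : PosProp C x y) (h' : PosProp C y z) :
    PosProp C x z := by
  obtain ⟨a, ha, h⟩ := h
  obtain ⟨b, hb, h'⟩ := h'
  refine ⟨a * b, mul_pos ha hb, fun i hi => ?_⟩
  rw [h i hi, h' i hi, mul_assoc]

theorem PosProp.mono {C D : Finset ι} (hCD : C ⊆ D) {x y : ι → ℝ} (h : PosProp D x y) :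
    PosProp C x y := by
  obtain ⟨a, ha, h⟩ := h
  exact ⟨a, ha, fun i hi => h i (hCD hi)⟩

theorem PosProp.eq_zero {C : Finset ι} {x y : ι → ℝ} (h : PosProp C x y) {i : ι} (hi : i ∈ C)
    (hx : x i = 0) : y i = 0 := by
  obtain ⟨a, ha, h⟩ := h
  have := h i hi
  rw [hx] at this
  exact (mul_eq_zero.1 this.symm).resolve_left ha.ne'

theorem PosProp.nonneg {C : Finset ι} {x y : ι → ℝ} (h : PosProp C x y) {i : ι} (hi : i ∈ C)
    (hx : 0 ≤ x i) : 0 ≤ y i := by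
  obtain ⟨a, ha, h⟩ := h
  have := h i hi
  rw [this] at hx
  exact nonneg_of_mul_nonneg_right hx ha

theorem PosProp.pos {C : Finset ι} {x y : ι → ℝ} (h : PosProp C x y) {i : ι} (hi : i ∈ C)
    (hx : 0 < x i) : 0 < y i :=
  lt_of_le_of_ne (h.nonneg hi hx.le) fun h0 => hx.ne' (h.symm.eq_zero hi h0.symm)

theorem IsExtremal.of_posProp {M : Submodule ℝ (ι → ℝ)} {C : Finset ι} {x y : ι → ℝ}
    (hx : IsExtremal M C x) (h : PosProp C x y) (hy : y ∈ M) : IsExtremal M C y := by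
  refine ⟨hy, fun i hi => h.nonneg hi (hx.nonneg i hi), ?_, fun z hz hzy => ?_⟩
  · obtain ⟨i, hi, hxi⟩ := hx.ne_zero
    exact ⟨i, hi, fun h0 => hxi (h.symm.eq_zero hi h0)⟩
  · obtain ⟨a, ha⟩ := hx.minimal z hz fun i hi h0 => hzy i hi (h.eq_zero hi h0)
    obtain ⟨b, _, hb⟩ := h
    exact ⟨a * b, fun i hi => by rw [ha i hi, hb i hi, mul_assoc]⟩

/-- A non-negative vector of `M` supported in an extremal one is a positive multiple of it. -/
theorem IsExtremal.posProp {M : Submodule ℝ (ι → ℝ)} {C : Finset ι} {x y : ι → ℝ}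
    (hx : IsExtremal M C x) (hy : y ∈ M) (hyn : ∀ i ∈ C, 0 ≤ y i) (hy0 : ∃ i ∈ C, y i ≠ 0)
    (hyx : ∀ i ∈ C, x i = 0 → y i = 0) : PosProp C y x := by
  obtain ⟨a, ha⟩ := hx.minimal y hy hyx
  obtain ⟨i, hi, h0⟩ := hy0
  refine ⟨a, ?_, ha⟩
  have h1 := ha i hi
  have h2 := hx.nonneg i hi
  have h3 : 0 < y i := lt_of_le_of_ne (hyn i hi) (Ne.symm h0)
  rw [h1] at h3
  exact pos_of_mul_pos_left h3 h2

/-- If `y` is supported in the support of `x ≥ 0`, then some `y + α x` is non-negative and vanishes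
somewhere in the support of `x`. -/
theorem exists_shift {C : Finset ι} {x y : ι → ℝ} (hx : ∀ i ∈ C, 0 ≤ x i)
    (hx0 : ∃ i ∈ C, x i ≠ 0) (hyx : ∀ i ∈ C, x i = 0 → y i = 0) :
    ∃ α : ℝ, (∀ i ∈ C, 0 ≤ y i + α * x i) ∧ ∃ i ∈ C, x i ≠ 0 ∧ y i + α * x i = 0 := by
  classical
  obtain ⟨j, hj, hxj⟩ := hx0
  -- The least `α` that works is the largest ratio `-y i / x i` over the support of `x`; at the
  -- position where it is attained, `y + α x` vanishes.
  obtain ⟨i, hi, hmax⟩ := Finset.exists_max_image (C.filter fun i => x i ≠ 0)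
    (fun i => -y i / x i) ⟨j, Finset.mem_filter.2 ⟨hj, hxj⟩⟩
  obtain ⟨hiC, hxi⟩ := Finset.mem_filter.1 hi
  refine ⟨-y i / x i, fun k hk => ?_, i, hiC, hxi, by field_simp; ring⟩
  by_cases hxk : x k = 0
  · simp [hxk, hyx k hk hxk]
  · have h1 := hmax k (Finset.mem_filter.2 ⟨hk, hxk⟩)
    have h2 : 0 < x k := lt_of_le_of_ne (hx k hk) (Ne.symm hxk)
    rw [div_le_iff₀ h2] at h1
    linarith

/-- A vector of the cone lies in every subspace that contains the extremal vectors in its support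
and the vectors vanishing on `C`. -/
theorem mem_of_extremal {M : Submodule ℝ (ι → ℝ)} {C : Finset ι} (N : Submodule ℝ (ι → ℝ))
    (hN : ∀ y ∈ M, (∀ i ∈ C, y i = 0) → y ∈ N) :
    ∀ x ∈ M, (∀ i ∈ C, 0 ≤ x i) →
      (∀ e, IsExtremal M C e → (∀ i ∈ C, x i = 0 → e i = 0) → e ∈ N) → x ∈ N := by
  classical
  intro x
  induction hk : (C.filter fun i => x i ≠ 0).card using Nat.strong_induction_on generalizing x with
  | _ k ih =>
  intro hxM hx hE
  by_cases hx0 : ∃ i ∈ C, x i ≠ 0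
  swap
  · push Not at hx0
    exact hN x hxM hx0
  by_cases hxe : IsExtremal M C x
  · exact hE x hxe fun i _ h => h
  -- Minimality fails, so the face of `x` contains another direction `y`. Shifting `y` and `-y` by
  -- multiples of `x` gives two vectors of the cone with smaller support, to which induction
  -- applies, and their sum is a multiple of `x`.
  have : ∃ y ∈ M, (∀ i ∈ C, x i = 0 → y i = 0) ∧ ∀ a : ℝ, ∃ i ∈ C, y i ≠ a * x i := by
    by_contra hcon
    push Not at hcon
    exact hxe ⟨hxM, hx, hx0, hcon⟩
  obtain ⟨y, hyM, hyx, hy⟩ := this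
  have key : ∀ z ∈ M, (∀ i ∈ C, x i = 0 → z i = 0) → ∃ α : ℝ, z + α • x ∈ N ∧
      (∀ i ∈ C, 0 ≤ z i + α * x i) := by
    intro z hzM hzx
    obtain ⟨α, hα, i, hi, hxi, h0⟩ := exists_shift hx hx0 hzx
    refine ⟨α, ?_, hα⟩
    have hsupp : ∀ j ∈ C, x j = 0 → (z + α • x) j = 0 := fun j hj h => by
      simp [h, hzx j hj h]
    refine ih _ ?_ (z + α • x) rfl (M.add_mem hzM (M.smul_mem _ hxM)) (by simpa using hα)
      fun e he hez => hE e he fun j hj h => hez j hj (hsupp j hj h)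
    rw [← hk]
    refine Finset.card_lt_card ((Finset.ssubset_iff_of_subset ?_).2 ⟨i, ?_, ?_⟩)
    · intro j hj
      rw [Finset.mem_filter] at hj ⊢
      exact ⟨hj.1, fun h => hj.2 (hsupp j hj.1 h)⟩
    · exact Finset.mem_filter.2 ⟨hi, hxi⟩
    · simp [h0]
  obtain ⟨α, hα, hαn⟩ := key y hyM hyx
  obtain ⟨β, hβ, hβn⟩ := key (-y) (M.neg_mem hyM) (by simpa using hyx)
  -- If `α + β = 0`, then `y + α x` and its negative are both non-negative, so `y = -α x` on `C`.
  have hab : α + β ≠ 0 := by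
    intro h
    obtain ⟨i, hi, hne⟩ := hy (-α)
    apply hne
    have h1 := hαn i hi
    have h2 := hβn i hi
    have h3 : β = -α := by linarith
    simp only [h3, Pi.neg_apply] at h2
    linarith
  have : x = (α + β)⁻¹ • ((y + α • x) + (-y + β • x)) := by
    have : (y + α • x) + (-y + β • x) = (α + β) • x := by
      rw [add_smul]; abel
    rw [this, inv_smul_smul₀ hab]
  rw [this]
  exact N.smul_mem _ (N.add_mem hα hβ)

/-- The vectors that agree on `C` with a combination of `u` and `w`. -/
def spanOn (C : Finset ι) (u w : ι → ℝ) : Submodule ℝ (ι → ℝ) where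
  carrier := {y | ∃ a b : ℝ, ∀ i ∈ C, y i = a * u i + b * w i}
  zero_mem' := ⟨0, 0, fun i _ => by simp⟩
  add_mem' := by
    rintro y z ⟨a, b, h⟩ ⟨a', b', h'⟩
    exact ⟨a + a', b + b', fun i hi => by rw [Pi.add_apply, h i hi, h' i hi]; ring⟩
  smul_mem' := by
    rintro c y ⟨a, b, h⟩
    exact ⟨c * a, c * b, fun i hi => by rw [Pi.smul_apply, h i hi, smul_eq_mul]; ring⟩

/-- If all extremal vectors supported in `supp u ∪ supp w` lie in a subspace, then so do all
vectors with this property. -/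
theorem mem_of_extremal_pair {M : Submodule ℝ (ι → ℝ)} {C : Finset ι} (N : Submodule ℝ (ι → ℝ))
    (hN : ∀ y ∈ M, (∀ i ∈ C, y i = 0) → y ∈ N) {u w : ι → ℝ} (hu : u ∈ M) (hw : w ∈ M)
    (hun : ∀ i ∈ C, 0 ≤ u i) (hwn : ∀ i ∈ C, 0 ≤ w i)
    (hE : ∀ e, IsExtremal M C e → (∀ i ∈ C, u i = 0 → w i = 0 → e i = 0) → e ∈ N)
    {y : ι → ℝ} (hy : y ∈ M) (hyS : ∀ i ∈ C, u i = 0 → w i = 0 → y i = 0) : y ∈ N := by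
  have hz : ∀ i ∈ C, (u + w) i = 0 → u i = 0 ∧ w i = 0 := fun i hi h => by
    have h1 := hun i hi
    have h2 := hwn i hi
    rw [Pi.add_apply] at h
    constructor <;> linarith
  have huw : u + w ∈ N := mem_of_extremal N hN _ (M.add_mem hu hw)
    (fun i hi => add_nonneg (hun i hi) (hwn i hi)) fun e he hes =>
      hE e he fun i hi h1 h2 => hes i hi (by simp [h1, h2])
  -- There is no cancellation in `u + w`, so it is positive on the whole of `supp u ∪ supp w`, and a
  -- multiple of it moves `y` into the cone.
  by_cases h0 : ∃ i ∈ C, (u + w) i ≠ 0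
  · obtain ⟨α, hα, -⟩ := exists_shift (x := u + w) (y := y)
      (fun i hi => add_nonneg (hun i hi) (hwn i hi)) h0
      (fun i hi h => hyS i hi (hz i hi h).1 (hz i hi h).2)
    have : y + α • (u + w) ∈ N := by
      refine mem_of_extremal N hN _ (M.add_mem hy (M.smul_mem _ (M.add_mem hu hw))) hα
        fun e he hes => hE e he fun i hi h1 h2 => hes i hi ?_
      simp [h1, h2, hyS i hi h1 h2]
    simpa using N.sub_mem this (N.smul_mem α huw)
  · push Not at h0
    exact hN y hy fun i hi => hyS i hi (hz i hi (h0 i hi)).1 (hz i hi (h0 i hi)).2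

/-- A vector that becomes extremal by intersection with the hyperplane `φ = 0` lies on a
two-dimensional face, whose extreme rays are on opposite sides of the hyperplane. -/
theorem exists_split {M : Submodule ℝ (ι → ℝ)} {C : Finset ι} (φ : (ι → ℝ) →ₗ[ℝ] ℝ)
    (hφ : ∀ y ∈ M, (∀ i ∈ C, y i = 0) → φ y = 0) {x : ι → ℝ} (hx : x ∈ M)
    (hxn : ∀ i ∈ C, 0 ≤ x i) (hx0 : ∃ i ∈ C, x i ≠ 0) (hφx : φ x = 0)
    (hmin : ∀ y ∈ M, (∀ i ∈ C, x i = 0 → y i = 0) → φ y = 0 → ∃ a : ℝ, ∀ i ∈ C, y i = a * x i)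
    (hxe : ¬ IsExtremal M C x) :
    ∃ u w, IsExtremal M C u ∧ IsExtremal M C w ∧ 0 < φ u ∧ φ w < 0 ∧
      (∀ i ∈ C, x i = 0 → u i = 0) ∧ (∀ i ∈ C, x i = 0 → w i = 0) ∧
      (∃ i ∈ C, u i = 0 ∧ w i ≠ 0) ∧ (∃ i ∈ C, w i = 0 ∧ u i ≠ 0) ∧
      (∃ κ > 0, ∀ i ∈ C, x i = κ * (u i + w i)) ∧
      ∀ y ∈ M, (∀ i ∈ C, x i = 0 → y i = 0) → y ∈ spanOn C u w := by
  -- As `x` is extremal only within `φ = 0`, its face has a direction `y` transverse to the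
  -- hyperplane. Modulo vectors vanishing on `C`, the face is then spanned by `x` and `y` (`hspan`).
  obtain ⟨y, hyM, hyx, hy⟩ :
      ∃ y ∈ M, (∀ i ∈ C, x i = 0 → y i = 0) ∧ 0 < φ y := by
    by_contra hcon
    push Not at hcon
    refine hxe ⟨hx, hxn, hx0, fun y hy hyx => hmin y hy hyx (le_antisymm (hcon y hy hyx) ?_)⟩
    have := hcon (-y) (M.neg_mem hy) (by simpa using hyx)
    rw [map_neg] at this
    linarith
  have hspan : ∀ z ∈ M, (∀ i ∈ C, x i = 0 → z i = 0) →
      ∃ a : ℝ, ∀ i ∈ C, z i = a * x i + φ z / φ y * y i := by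
    intro z hz hzx
    obtain ⟨a, ha⟩ := hmin (z - (φ z / φ y) • y) (M.sub_mem hz (M.smul_mem _ hyM))
      (fun i hi h => by simp [hzx i hi h, hyx i hi h])
      (by rw [map_sub, map_smul, smul_eq_mul, div_mul_cancel₀ _ hy.ne', sub_self])
    refine ⟨a, fun i hi => ?_⟩
    have := ha i hi
    simp only [Pi.sub_apply, Pi.smul_apply, smul_eq_mul] at this
    linarith
  -- Sliding `z` along `x` until one more coordinate `i` vanishes yields an extreme ray: in a
  -- two-dimensional span, vanishing at `i` leaves one dimension. Applied to `y` and `-y`, this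
  -- gives the two sides of the face.
  have key : ∀ z ∈ M, (∀ i ∈ C, x i = 0 → z i = 0) → φ z ≠ 0 → ∃ α : ℝ,
      IsExtremal M C (z + α • x) ∧ (∃ i ∈ C, x i ≠ 0 ∧ (z + α • x) i = 0) ∧
      (∀ i ∈ C, x i = 0 → (z + α • x) i = 0) := by
    intro z hz hzx hφz
    obtain ⟨α, hα, i, hi, hxi, h0⟩ := exists_shift hxn hx0 hzx
    have hsupp : ∀ j ∈ C, x j = 0 → (z + α • x) j = 0 := fun j hj h => by
      simp [h, hzx j hj h]
    have hM : z + α • x ∈ M := M.add_mem hz (M.smul_mem _ hx)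
    have hφ' : φ (z + α • x) = φ z := by rw [map_add, map_smul, hφx]; simp
    refine ⟨α, ⟨hM, by simpa using hα, ?_, fun y' hy' hs => ?_⟩, ⟨i, hi, hxi, by simpa using h0⟩,
      hsupp⟩
    · by_contra hcon
      push Not at hcon
      exact hφz (hφ' ▸ hφ _ hM hcon)
    · obtain ⟨a, ha⟩ := hspan y' hy' fun j hj h => hs j hj (hsupp j hj h)
      obtain ⟨b, hb⟩ := hspan z hz hzx
      have hc : φ z / φ y ≠ 0 := div_ne_zero hφz hy.ne'
      have hyi : ∀ j ∈ C,
          y' j = (a - φ y' / φ z * (b + α)) * x j + φ y' / φ z * (z j + α * x j) := by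
        intro j hj
        rw [ha j hj, hb j hj]
        field_simp
        ring
      have h1 := hs i hi (by simpa using h0)
      rw [hyi i hi, h0] at h1
      have h2 : a - φ y' / φ z * (b + α) = 0 := by
        have h3 : (a - φ y' / φ z * (b + α)) * x i = 0 := by linarith
        exact (mul_eq_zero.1 h3).resolve_right hxi
      refine ⟨φ y' / φ z, fun j hj => ?_⟩
      rw [hyi j hj, h2]
      simp
  obtain ⟨α, hu, ⟨i, hi, hxi, hui⟩, hus⟩ := key y hyM hyx hy.ne'
  obtain ⟨β, hw, ⟨j, hj, hxj, hwj⟩, hws⟩ := key (-y) (M.neg_mem hyM) (by simpa using hyx)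
    (by simpa using hy.ne')
  have hφu : φ (y + α • x) = φ y := by rw [map_add, map_smul, hφx]; simp
  have hφw : φ (-y + β • x) = -φ y := by rw [map_add, map_smul, hφx]; simp
  have hadd : ∀ k, (y + α • x) k + (-y + β • x) k = (α + β) * x k := fun k => by
    simp only [Pi.add_apply, Pi.neg_apply, Pi.smul_apply, smul_eq_mul]; ring
  -- The sum of the two rays is `(α + β) x`. At `i`, where the first ray vanishes, this is
  -- non-negative; and if it were zero, both rays would vanish on `C`.
  have hab : 0 < α + β := by
    have h1 := hadd i
    have h2 := hw.nonneg i hi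
    have h3 : 0 < x i := lt_of_le_of_ne (hxn i hi) (Ne.symm hxi)
    rw [hui, zero_add] at h1
    have h4 : 0 ≤ α + β := nonneg_of_mul_nonneg_left (h1 ▸ h2) h3
    refine lt_of_le_of_ne h4 fun h5 => ?_
    obtain ⟨k, hk, hne⟩ := hu.ne_zero
    have h6 := hadd k
    rw [← h5, zero_mul] at h6
    have h7 := hu.nonneg k hk
    have h8 := hw.nonneg k hk
    exact hne (by linarith)
  refine ⟨_, _, hu, hw, by rw [hφu]; exact hy, by rw [hφw]; linarith, hus, hws,
    ⟨i, hi, hui, fun h => ?_⟩, ⟨j, hj, hwj, fun h => ?_⟩, ⟨(α + β)⁻¹, inv_pos.2 hab, fun k _ => ?_⟩,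
    fun z hz hzx => ?_⟩
  · have := hadd i
    rw [hui, h, zero_add] at this
    exact (mul_ne_zero hab.ne' hxi) this.symm
  · have := hadd j
    rw [hwj, h, zero_add] at this
    exact (mul_ne_zero hab.ne' hxj) this.symm
  · rw [hadd, inv_mul_cancel_left₀ hab.ne']
  · obtain ⟨a, ha⟩ := hspan z hz hzx
    have h1 : x ∈ spanOn C (y + α • x) (-y + β • x) :=
      ⟨(α + β)⁻¹, (α + β)⁻¹, fun k _ => by rw [← mul_add, hadd, inv_mul_cancel_left₀ hab.ne']⟩
    have h2 : y ∈ spanOn C (y + α • x) (-y + β • x) := by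
      have : y + α • x ∈ spanOn C (y + α • x) (-y + β • x) := ⟨1, 0, fun k _ => by ring⟩
      simpa using Submodule.sub_mem _ this (Submodule.smul_mem _ α h1)
    obtain ⟨c, d, hcd⟩ := Submodule.add_mem _ (Submodule.smul_mem _ a h1)
      (Submodule.smul_mem _ (φ z / φ y) h2)
    exact ⟨c, d, fun k hk => by rw [← hcd k hk, ha k hk]; simp⟩

end DoubleDescription

end NormalSurface

namespace NormalSurface

/-! ### The double description step with a hereditary filter -/

section NewVectors

variable {ι : Type}

/-- The point in which the segment from `u` to `w` meets the hyperplane `h = 0`. -/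
def crossing {K : Type} [Field K] (h : (ι → K) → K) (u w : ι → K) : ι → K :=
  (h u - h w)⁻¹ • (h u • w - h w • u)

/-- The pairs of vectors of `L` from which the double description step makes a new vector. -/
structure CrossingPair {K : Type} [Field K] [LinearOrder K] (compat : (ι → K) → (ι → K) → Prop)
    (C : Finset ι) (h : (ι → K) → K) (L : List (ι → K)) (u w : ι → K) : Prop where
  left_mem : u ∈ L
  right_mem : w ∈ L
  pos : 0 < h u
  neg : h w < 0
  compat : compat u w
  test : PassesAdjacencyTest C L u w

/-- Distinct members of the list are not proportional on `D`. -/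
def Irredundant (D : Finset ι) (L : List (ι → ℝ)) : Prop :=
  L.Nodup ∧ ∀ x ∈ L, ∀ y ∈ L, PosProp D x y → x = y

theorem crossing_apply (h : (ι → ℝ) → ℝ) (u w : ι → ℝ) (i : ι) :
    crossing h u w i = (h u - h w)⁻¹ * (h u * w i - h w * u i) := by
  simp [crossing]

theorem map_crossing (φ ψ : (ι → ℝ) →ₗ[ℝ] ℝ) (u w : ι → ℝ) :
    ψ (crossing φ u w) = (φ u - φ w)⁻¹ * (φ u * ψ w - φ w * ψ u) := by
  simp [crossing]

theorem map_crossing_self (φ : (ι → ℝ) →ₗ[ℝ] ℝ) (u w : ι → ℝ) : φ (crossing φ u w) = 0 := by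
  rw [map_crossing]; ring

theorem crossing_mem {M : Submodule ℝ (ι → ℝ)} (h : (ι → ℝ) → ℝ) {u w : ι → ℝ} (hu : u ∈ M)
    (hw : w ∈ M) : crossing h u w ∈ M :=
  M.smul_mem _ (M.sub_mem (M.smul_mem _ hw) (M.smul_mem _ hu))

theorem crossing_nonneg {h : (ι → ℝ) → ℝ} {u w : ι → ℝ} (hu : 0 < h u) (hw : h w < 0) {i : ι}
    (hui : 0 ≤ u i) (hwi : 0 ≤ w i) : 0 ≤ crossing h u w i := by
  rw [crossing_apply]
  have h1 := mul_nonneg hu.le hwi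
  have h2 := mul_nonneg (neg_nonneg.2 hw.le) hui
  exact mul_nonneg (inv_nonneg.2 (by linarith)) (by linarith)

/-- Both `h u` and `-h w` are positive, so nothing cancels and the support of the crossing is the
union of the two supports. The adjacency test thereby becomes a statement about the support of the
new vector. -/
theorem crossing_eq_zero {h : (ι → ℝ) → ℝ} {u w : ι → ℝ} (hu : 0 < h u) (hw : h w < 0) {i : ι}
    (hui : 0 ≤ u i) (hwi : 0 ≤ w i) : crossing h u w i = 0 ↔ u i = 0 ∧ w i = 0 := by
  rw [crossing_apply]
  constructor
  · intro h0
    have h3 := (mul_eq_zero.1 h0).resolve_left (inv_ne_zero (by linarith))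
    have h1 := mul_nonneg hu.le hwi
    have h2 := mul_nonneg (neg_nonneg.2 hw.le) hui
    constructor
    · have : h w * u i = 0 := by linarith
      exact (mul_eq_zero.1 this).resolve_left hw.ne
    · have : h u * w i = 0 := by linarith
      exact (mul_eq_zero.1 this).resolve_left hu.ne'
  · rintro ⟨h1, h2⟩
    simp [h1, h2]

/-- `compat u w` says that the union of the supports of `u` and `w` in `C` is admissible, for a
hereditary notion of admissibility. -/
structure IsSupportCompat (C : Finset ι) (compat : (ι → ℝ) → (ι → ℝ) → Prop) : Prop where
  of_supp : ∀ {u w u' w'}, compat u w → (∀ i ∈ C, u i = 0 → w i = 0 → u' i = 0) →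
    (∀ i ∈ C, u i = 0 → w i = 0 → w' i = 0) → compat u' w'

/-- This makes every vector in the face of a compatible pair admissible, so that completeness of the
list applies to it. -/
theorem IsSupportCompat.self {C : Finset ι} {compat : (ι → ℝ) → (ι → ℝ) → Prop}
    (hc : IsSupportCompat C compat) {u w z : ι → ℝ} (h : compat u w)
    (hz : ∀ i ∈ C, u i = 0 → w i = 0 → z i = 0) : compat z z := hc.of_supp h hz hz

theorem IsSupportCompat.mono {C D : Finset ι} (hCD : C ⊆ D)
    {compat : (ι → ℝ) → (ι → ℝ) → Prop} (hc : IsSupportCompat C compat) :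
    IsSupportCompat D compat :=
  ⟨fun h h1 h2 => hc.of_supp h (fun i hi => h1 i (hCD hi)) fun i hi => h2 i (hCD hi)⟩

/-- `L` contains exactly one vector on each ray that is given by an admissible vector with
property `E`, where `D` is the set of positions that matter. -/
structure Represents (compat : (ι → ℝ) → (ι → ℝ) → Prop) (D : Finset ι) (E : (ι → ℝ) → Prop)
    (L : List (ι → ℝ)) : Prop where
  irredundant : Irredundant D L
  sound : ∀ x ∈ L, E x ∧ compat x x
  complete : ∀ x, E x → compat x x → ∃ z ∈ L, PosProp D z x

variable [Fintype ι]

theorem mem_newVectors {K : Type} [Field K] [LinearOrder K] {compat : (ι → K) → (ι → K) → Prop}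
    [∀ u w, Decidable (compat u w)] {C : Finset ι} {h : (ι → K) → K} {L : List (ι → K)}
    {x : ι → K} : x ∈ newVectors compat C h L ↔
      ∃ u w, CrossingPair compat C h L u w ∧ crossing h u w = x := by
  simp only [newVectors, List.mem_flatMap, List.mem_map, List.mem_filter, decide_eq_true_eq,
    crossing]
  constructor
  · rintro ⟨u, ⟨hu, hu'⟩, w, ⟨hw, h1, h2, h3⟩, rfl⟩
    exact ⟨u, w, ⟨hu, hw, hu', h1, h2, h3⟩, rfl⟩
  · rintro ⟨u, w, ⟨hu, hw, hu', h1, h2, h3⟩, rfl⟩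
    exact ⟨u, ⟨hu, hu'⟩, w, ⟨hw, h1, h2, h3⟩, rfl⟩

theorem nodup_newVectors {K : Type} [Field K] [LinearOrder K]
    {compat : (ι → K) → (ι → K) → Prop}
    [∀ u w, Decidable (compat u w)] {C : Finset ι} {h : (ι → K) → K} {L : List (ι → K)}
    (hL : L.Nodup) (hinj : ∀ u w u' w', CrossingPair compat C h L u w →
      CrossingPair compat C h L u' w' → crossing h u w = crossing h u' w' → u = u' ∧ w = w') :
    (newVectors compat C h L).Nodup := by
  have hp : ∀ u ∈ L.filter (fun u => 0 < h u), ∀ w ∈ L.filter (fun w => h w < 0 ∧ compat u w ∧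
      PassesAdjacencyTest C L u w), CrossingPair compat C h L u w := by
    intro u hu w hw
    simp only [List.mem_filter, decide_eq_true_eq] at hu hw
    exact ⟨hu.1, hw.1, hu.2, hw.2.1, hw.2.2.1, hw.2.2.2⟩
  refine List.nodup_flatMap.2 ⟨fun u hu => ?_, ?_⟩
  · refine (List.nodup_map_iff_inj_on (hL.filter _)).2 fun w hw w' hw' he => ?_
    exact (hinj u w u w' (hp u hu w hw) (hp u hu w' hw') he).2
  · refine List.Pairwise.imp_of_mem ?_ (hL.filter _)
    intro u u' hu hu' hne
    rw [Function.onFun, List.disjoint_left]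
    intro x hx hx'
    obtain ⟨w, hw, rfl⟩ := List.mem_map.1 hx
    obtain ⟨w', hw', he⟩ := List.mem_map.1 hx'
    exact hne (hinj u w u' w' (hp u hu w hw) (hp u' hu' w' hw') he.symm).1

/-- A double description step preserves irredundancy. -/
theorem Irredundant.append_newVectors {C D : Finset ι} (hCD : C ⊆ D) {L L' : List (ι → ℝ)}
    (hL : Irredundant D L) (hLn : ∀ x ∈ L, ∀ i ∈ C, 0 ≤ x i)
    {compat : (ι → ℝ) → (ι → ℝ) → Prop} [∀ u w, Decidable (compat u w)]
    (φ : (ι → ℝ) →ₗ[ℝ] ℝ) (hφ : ∀ x y, PosProp D x y → φ x = 0 → φ y = 0)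
    (hL' : L'.Nodup) (hsub : ∀ x ∈ L', x ∈ L ∧ 0 ≤ φ x) :
    Irredundant D (L' ++ newVectors compat C φ L) := by
  -- The adjacency test, read on the support of the crossing.
  have key : ∀ u w, CrossingPair compat C φ L u w → ∀ z ∈ L,
      (∀ i ∈ C, crossing φ u w i = 0 → z i = 0) → z = u ∨ z = w := by
    intro u w hp z hz hs
    by_contra hcon
    push Not at hcon
    refine hp.test z hz hcon.1 hcon.2 fun i hi h1 h2 => hs i hi ?_
    rw [crossing_eq_zero hp.pos hp.neg (hLn u hp.left_mem i hi) (hLn w hp.right_mem i hi)]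
    exact ⟨h1, h2⟩
  -- Both `u'` and `w'` are supported in the first crossing, hence lie in `{u, w}`; the sign of `φ`
  -- decides which is which.
  have hpairs : ∀ u w u' w', CrossingPair compat C φ L u w → CrossingPair compat C φ L u' w' →
      PosProp D (crossing φ u w) (crossing φ u' w') → u = u' ∧ w = w' := by
    intro u w u' w' hp hp' h
    have h0 : ∀ i ∈ C, crossing φ u w i = 0 → u' i = 0 ∧ w' i = 0 := fun i hi hi0 => by
      rw [← crossing_eq_zero hp'.pos hp'.neg (hLn u' hp'.left_mem i hi)
        (hLn w' hp'.right_mem i hi)]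
      exact (h.mono hCD).eq_zero hi hi0
    constructor
    · rcases key u w hp u' hp'.left_mem fun i hi hi0 => (h0 i hi hi0).1 with h1 | h1
      · exact h1.symm
      · exact absurd hp.neg (h1 ▸ hp'.pos).not_gt
    · rcases key u w hp w' hp'.right_mem fun i hi hi0 => (h0 i hi hi0).2 with h1 | h1
      · exact absurd hp.pos (h1 ▸ hp'.neg).not_gt
      · exact h1.symm
  have hmix : ∀ x ∈ L', ∀ u w, CrossingPair compat C φ L u w → ¬ PosProp D x (crossing φ u w) := by
    intro x hx u w hp h
    have hx0 : φ x = 0 := hφ _ _ h.symm (map_crossing_self φ u w)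
    rcases key u w hp x (hsub x hx).1 fun i hi => (h.symm.mono hCD).eq_zero hi with h1 | h1
    · exact hp.pos.ne' (h1 ▸ hx0)
    · exact hp.neg.ne (h1 ▸ hx0)
  constructor
  · refine List.Nodup.append hL' (nodup_newVectors hL.1 fun u w u' w' hp hp' h =>
      hpairs u w u' w' hp hp' (h ▸ PosProp.refl D _)) ?_
    rw [List.disjoint_left]
    intro x hx hx'
    obtain ⟨u, w, hp, rfl⟩ := mem_newVectors.1 hx'
    exact hmix _ hx u w hp (PosProp.refl D _)
  · intro x hx y hy h
    rcases List.mem_append.1 hx with hx | hx <;> rcases List.mem_append.1 hy with hy | hy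
    · exact hL.2 x (hsub x hx).1 y (hsub y hy).1 h
    · obtain ⟨u, w, hp, rfl⟩ := mem_newVectors.1 hy
      exact absurd h (hmix _ hx u w hp)
    · obtain ⟨u, w, hp, rfl⟩ := mem_newVectors.1 hx
      exact absurd h.symm (hmix _ hy u w hp)
    · obtain ⟨u, w, hp, rfl⟩ := mem_newVectors.1 hx
      obtain ⟨u', w', hp', rfl⟩ := mem_newVectors.1 hy
      obtain ⟨rfl, rfl⟩ := hpairs u w u' w' hp hp' h
      rfl

/-- One step of the direct enumeration: intersection with the hyperplane `φ = 0`. -/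
theorem Represents.hyperplane {compat : (ι → ℝ) → (ι → ℝ) → Prop}
    [∀ u w, Decidable (compat u w)] (hc : IsSupportCompat Finset.univ compat)
    {M : Submodule ℝ (ι → ℝ)} {L : List (ι → ℝ)}
    (hL : Represents compat Finset.univ (IsExtremal M Finset.univ) L) (φ : (ι → ℝ) →ₗ[ℝ] ℝ) :
    Represents compat Finset.univ (IsExtremal (M ⊓ LinearMap.ker φ) Finset.univ)
      ((L.filter fun x => φ x = 0) ++ newVectors compat Finset.univ φ L) := by
  have hφ0 : ∀ y : ι → ℝ, (∀ i ∈ Finset.univ, y i = 0) → φ y = 0 := fun y hy => by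
    have : y = 0 := funext fun i => hy i (Finset.mem_univ i)
    rw [this, map_zero]
  have hnn : ∀ x ∈ L, ∀ i ∈ Finset.univ, 0 ≤ x i := fun x hx => (hL.sound x hx).1.nonneg
  refine ⟨hL.irredundant.append_newVectors (Finset.Subset.refl _) hnn φ ?_
    (hL.irredundant.1.filter _) ?_, ?_, ?_⟩
  · rintro x y h hx
    obtain ⟨a, _, h⟩ := h.symm
    have : y = a • x := funext fun i => h i (Finset.mem_univ i)
    rw [this, map_smul, hx, smul_zero]
  · intro x hx
    obtain ⟨h1, h2⟩ := List.mem_filter.1 hx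
    exact ⟨h1, (of_decide_eq_true h2).ge⟩
  · intro x hx
    rcases List.mem_append.1 hx with hx | hx
    · obtain ⟨h1, h2⟩ := List.mem_filter.1 hx
      obtain ⟨he, hcx⟩ := hL.sound x h1
      exact ⟨⟨⟨he.mem, LinearMap.mem_ker.2 (of_decide_eq_true h2)⟩, he.nonneg, he.ne_zero,
        fun y hy => he.minimal y hy.1⟩, hcx⟩
    · obtain ⟨u, w, hp, rfl⟩ := mem_newVectors.1 hx
      obtain ⟨hu, -⟩ := hL.sound u hp.left_mem
      obtain ⟨hw, -⟩ := hL.sound w hp.right_mem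
      have hzero : ∀ i ∈ Finset.univ, crossing φ u w i = 0 ↔ u i = 0 ∧ w i = 0 := fun i hi =>
        crossing_eq_zero hp.pos hp.neg (hu.nonneg i hi) (hw.nonneg i hi)
      -- Extremal vectors supported in `supp u ∪ supp w` are admissible, hence proportional to
      -- listed ones, and the test leaves only `u` and `w` among those. So `u` and `w` span the
      -- face.
      have hspan : ∀ y ∈ M, (∀ i ∈ Finset.univ, u i = 0 → w i = 0 → y i = 0) →
          y ∈ spanOn Finset.univ u w := by
        intro y hy hys
        refine mem_of_extremal_pair (spanOn Finset.univ u w)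
          (fun z _ hz => ⟨0, 0, fun i hi => by simp [hz i hi]⟩)
          hu.mem hw.mem hu.nonneg hw.nonneg (fun e he hes => ?_) hy hys
        obtain ⟨z, hz, hze⟩ := hL.complete e he (hc.self hp.compat hes)
        have : z = u ∨ z = w := by
          by_contra hcon
          push Not at hcon
          exact hp.test z hz hcon.1 hcon.2 fun i hi h1 h2 => hze.symm.eq_zero hi (hes i hi h1 h2)
        obtain ⟨a, _, ha⟩ := hze.symm
        rcases this with rfl | rfl
        · exact ⟨a, 0, fun i hi => by rw [ha i hi]; ring⟩
        · exact ⟨0, a, fun i hi => by rw [ha i hi]; ring⟩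
      refine ⟨⟨⟨crossing_mem _ hu.mem hw.mem, map_crossing_self φ u w⟩, fun i hi =>
        crossing_nonneg hp.pos hp.neg (hu.nonneg i hi) (hw.nonneg i hi), ?_, ?_⟩, ?_⟩
      · obtain ⟨i, hi, h⟩ := hu.ne_zero
        exact ⟨i, hi, fun h0 => h ((hzero i hi).1 h0).1⟩
      · intro y hy hys
        obtain ⟨a, b, hab⟩ := hspan y hy.1 fun i hi h1 h2 => hys i hi ((hzero i hi).2 ⟨h1, h2⟩)
        have hy' : y = a • u + b • w := funext fun i => hab i (Finset.mem_univ i)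
        have h0 : φ y = 0 := hy.2
        rw [hy', map_add, map_smul, map_smul, smul_eq_mul, smul_eq_mul] at h0
        have hd : φ u - φ w ≠ 0 := by linarith [hp.pos, hp.neg]
        have hu0 := hp.pos.ne'
        -- The relation `a φ u + b φ w = 0` makes `a u + b w` a multiple of the crossing; the factor
        -- is read off from the coefficient of `w`.
        refine ⟨b * (φ u - φ w) / φ u, fun i hi => ?_⟩
        rw [hab i hi, crossing_apply]
        have : a = -(b * φ w) / φ u := by field_simp; linarith
        rw [this]
        field_simp
        ring
      · exact hc.self hp.compat fun i hi h1 h2 => (hzero i hi).2 ⟨h1, h2⟩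
  · intro x hx hcx
    by_cases hxM : IsExtremal M Finset.univ x
    · obtain ⟨z, hz, hzx⟩ := hL.complete x hxM hcx
      refine ⟨z, List.mem_append_left _ (List.mem_filter.2 ⟨hz, decide_eq_true ?_⟩), hzx⟩
      obtain ⟨a, _, h⟩ := hzx
      have : z = a • x := funext fun i => h i (Finset.mem_univ i)
      have h0 : φ x = 0 := hx.mem.2
      rw [this, map_smul, h0, smul_zero]
    · obtain ⟨u, w, hu, hw, hφu, hφw, hus, hws, ⟨i, hi, hui, hwi⟩, ⟨j, hj, hwj, huj⟩,
        ⟨κ, hκ, hx'⟩, hspan⟩ := exists_split φ (fun y _ => hφ0 y) hx.mem.1 hx.nonneg hx.ne_zero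
          hx.mem.2 (fun y hy hys h0 => hx.minimal y ⟨hy, h0⟩ hys) hxM
      obtain ⟨u', hu', a, ha, hau⟩ := hL.complete u hu (hc.self hcx fun i hi h _ => hus i hi h)
      obtain ⟨w', hw', b, hb, hbw⟩ := hL.complete w hw (hc.self hcx fun i hi h _ => hws i hi h)
      have hu1 : u' = a • u := funext fun i => hau i (Finset.mem_univ i)
      have hw1 : w' = b • w := funext fun i => hbw i (Finset.mem_univ i)
      have hφu' : φ u' = a * φ u := by rw [hu1, map_smul, smul_eq_mul]
      have hφw' : φ w' = b * φ w := by rw [hw1, map_smul, smul_eq_mul]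
      have hpu : 0 < φ u' := hφu' ▸ mul_pos ha hφu
      have hpw : φ w' < 0 := hφw' ▸ mul_neg_of_pos_of_neg hb hφw
      have hp : CrossingPair compat Finset.univ φ L u' w' := by
        refine ⟨hu', hw', hpu, hpw, hc.of_supp hcx (fun i hi h _ => ?_)
          (fun i hi h _ => ?_), ?_⟩
        · rw [hau i hi, hus i hi h, mul_zero]
        · rw [hbw i hi, hws i hi h, mul_zero]
        -- A third listed vector in this face would be `c u + d w`. If `c` or `d` is zero, it is
        -- `w'` or `u'`. Otherwise its support contains that of `u`, and its extremality would make
        -- `u` a multiple of it, contrary to the positions `i` and `j`.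
        · intro z hz hzu hzw hs
          obtain ⟨hze, -⟩ := hL.sound z hz
          obtain ⟨c, d, hcd⟩ := hspan z hze.mem fun k hk h => hs k hk
            (by rw [hau k hk, hus k hk h, mul_zero]) (by rw [hbw k hk, hws k hk h, mul_zero])
          by_cases hd0 : d = 0
          · apply hzu
            refine hL.irredundant.2 z hz u' hu' ((hu.posProp hze.mem hze.nonneg hze.ne_zero
              fun k hk h => ?_).trans ⟨a⁻¹, inv_pos.2 ha, fun k hk => ?_⟩)
            · rw [hcd k hk, h, hd0]; ring
            · rw [hau k hk, inv_mul_cancel_left₀ ha.ne']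
          by_cases hc0 : c = 0
          · apply hzw
            refine hL.irredundant.2 z hz w' hw' ((hw.posProp hze.mem hze.nonneg hze.ne_zero
              fun k hk h => ?_).trans ⟨b⁻¹, inv_pos.2 hb, fun k hk => ?_⟩)
            · rw [hcd k hk, h, hc0]; ring
            · rw [hbw k hk, inv_mul_cancel_left₀ hb.ne']
          have hc1 : 0 < c := by
            have h1 := hze.nonneg j hj
            rw [hcd j hj, hwj, mul_zero, add_zero] at h1
            exact lt_of_le_of_ne (nonneg_of_mul_nonneg_left h1
              (lt_of_le_of_ne (hu.nonneg j hj) (Ne.symm huj))) (Ne.symm hc0)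
          have hd1 : 0 < d := by
            have h1 := hze.nonneg i hi
            rw [hcd i hi, hui, mul_zero, zero_add] at h1
            exact lt_of_le_of_ne (nonneg_of_mul_nonneg_left h1
              (lt_of_le_of_ne (hw.nonneg i hi) (Ne.symm hwi))) (Ne.symm hd0)
          have hzs : ∀ k ∈ Finset.univ, z k = 0 → w k = 0 ∧ u k = 0 := fun k hk h => by
            rw [hcd k hk] at h
            have h1 := mul_nonneg hc1.le (hu.nonneg k hk)
            have h2 := mul_nonneg hd1.le (hw.nonneg k hk)
            constructor
            · exact (mul_eq_zero.1 (by linarith : d * w k = 0)).resolve_left hd0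
            · exact (mul_eq_zero.1 (by linarith : c * u k = 0)).resolve_left hc0
          obtain ⟨e, he⟩ := hze.minimal u hu.mem fun k hk h => (hzs k hk h).2
          have h1 := he i hi
          have h2 := he j hj
          rw [hui, hcd i hi, hui, mul_zero, zero_add] at h1
          rcases mul_eq_zero.1 h1.symm with h3 | h3
          · rw [h3, zero_mul] at h2
            exact huj h2
          · exact (mul_ne_zero hd0 hwi) h3
      refine ⟨_, List.mem_append_right _ (mem_newVectors.2 ⟨u', w', hp, rfl⟩), ?_⟩
      have h1 : φ w = -φ u := by
        have h2 : x = κ • (u + w) := funext fun i => by simpa using hx' i (Finset.mem_univ i)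
        have h3 : φ x = 0 := hx.mem.2
        rw [h2, map_smul, map_add, smul_eq_mul] at h3
        linarith [(mul_eq_zero.1 h3).resolve_left hκ.ne']
      -- Since `φ w = -φ u`, the crossing of `a u` and `b w` is `a b φ u / (a φ u + b φ u)` times `u
      -- + w`, and `u + w = κ⁻¹ x`.
      refine ⟨(a * φ u + b * φ u)⁻¹ * (a * b * φ u) * κ⁻¹, ?_, fun k hk => ?_⟩
      · have h2 := mul_pos ha hφu
        have h3 := mul_pos hb hφu
        have h4 := mul_pos (mul_pos ha hb) hφu
        exact mul_pos (mul_pos (inv_pos.2 (by linarith)) h4) (inv_pos.2 hκ)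
      · rw [crossing_apply, hφu', hφw', h1, hx' k hk, hau k hk, hbw k hk]
        have : a * φ u - b * -φ u = a * φ u + b * φ u := by ring
        rw [this]
        field_simp
        ring

end NewVectors

end NormalSurface

namespace NormalSurface

/-! ### Rays around a vertex: translates by the link, and which crossings are extremal -/

section Conversion

variable {ι : Type}

/-- `ℓ` is a vector of `M` that vanishes on `C₀` and is `1` on `V`, and on `V` it spans the vectors
of `M` that vanish on `C₀`. -/
structure IsLinkVector (M : Submodule ℝ (ι → ℝ)) (C₀ V : Finset ι) (ℓ : ι → ℝ) : Prop where
  mem : ℓ ∈ M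
  zero : ∀ i ∈ C₀, ℓ i = 0
  one : ∀ i ∈ V, ℓ i = 1
  const : ∀ x ∈ M, (∀ i ∈ C₀, x i = 0) → ∃ a : ℝ, ∀ i ∈ V, x i = a

/-- `x` is extremal with respect to the positions `C₀ ∪ P`, and is not a multiple of the link. -/
def IsCutRay [DecidableEq ι] (M : Submodule ℝ (ι → ℝ)) (C₀ P : Finset ι) (x : ι → ℝ) : Prop :=
  IsExtremal M (C₀ ∪ P) x ∧ ∃ i ∈ C₀, x i ≠ 0

/-- `x` is extremal with respect to the positions `C₀`, and its minimum over `V` is `0`. -/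
def IsCanonicalRay (M : Submodule ℝ (ι → ℝ)) (C₀ V : Finset ι) (x : ι → ℝ) : Prop :=
  IsExtremal M C₀ x ∧ (∀ i ∈ V, 0 ≤ x i) ∧ ∃ i ∈ V, x i = 0

namespace IsLinkVector

variable {M : Submodule ℝ (ι → ℝ)} {C₀ V P : Finset ι} {ℓ : ι → ℝ}

/-- The link vanishes on `C₀`, so extremality for `C₀` is shared by the whole line of translates of
`x`. -/
theorem isExtremal_sub (S : IsLinkVector M C₀ V ℓ) {x : ι → ℝ} (hx : IsExtremal M C₀ x) (μ : ℝ) :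
    IsExtremal M C₀ (x - μ • ℓ) :=
  hx.of_posProp ⟨1, one_pos, fun i hi => by simp [S.zero i hi]⟩
    (M.sub_mem hx.mem (M.smul_mem _ S.mem))

theorem exists_sub (S : IsLinkVector M C₀ V ℓ) (hPV : P ⊆ V) (hP : P.Nonempty) (x : ι → ℝ) :
    ∃ μ : ℝ, (∀ i ∈ P, μ ≤ x i) ∧ (∀ i ∈ P, 0 ≤ (x - μ • ℓ) i) ∧ ∃ i ∈ P, (x - μ • ℓ) i = 0 := by
  obtain ⟨i, hi, hmin⟩ := Finset.exists_min_image P x hP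
  refine ⟨x i, hmin, fun j hj => ?_, i, hi, by simp [S.one i (hPV hi)]⟩
  have := hmin j hj
  simpa [S.one j (hPV hj)] using this

theorem sub_apply_zero (S : IsLinkVector M C₀ V ℓ) (x : ι → ℝ) (μ : ℝ) {i : ι} (hi : i ∈ C₀) :
    (x - μ • ℓ) i = x i := by simp [S.zero i hi]

theorem sub_apply_one (S : IsLinkVector M C₀ V ℓ) (x : ι → ℝ) (μ : ℝ) {i : ι} (hi : i ∈ V) :
    (x - μ • ℓ) i = x i - μ := by simp [S.one i hi]

variable [DecidableEq ι]

/-- Vanishing on `C₀` makes `x` constant on `V`, and a single position of `P` fixes the constant.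
Thus, once `P` is non-empty, equalities on `C₀ ∪ P` extend to `C₀ ∪ V`. -/
theorem eq_zero (S : IsLinkVector M C₀ V ℓ) (hPV : P ⊆ V) (hP : P.Nonempty) {x : ι → ℝ}
    (hx : x ∈ M) (h : ∀ i ∈ C₀ ∪ P, x i = 0) : ∀ i ∈ C₀ ∪ V, x i = 0 := by
  obtain ⟨a, ha⟩ := S.const x hx fun i hi => h i (Finset.mem_union_left _ hi)
  obtain ⟨j, hj⟩ := hP
  have : a = 0 := by rw [← ha j (hPV hj)]; exact h j (Finset.mem_union_right _ hj)
  intro i hi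
  rcases Finset.mem_union.1 hi with hi | hi
  · exact h i (Finset.mem_union_left _ hi)
  · rw [ha i hi, this]

theorem eq_mul (S : IsLinkVector M C₀ V ℓ) (hPV : P ⊆ V) (hP : P.Nonempty) {x y : ι → ℝ}
    (hx : x ∈ M) (hy : y ∈ M) {a : ℝ} (h : ∀ i ∈ C₀ ∪ P, x i = a * y i) :
    ∀ i ∈ C₀ ∪ V, x i = a * y i := by
  intro i hi
  have := S.eq_zero hPV hP (M.sub_mem hx (M.smul_mem a hy))
    (fun i hi => by simp [h i hi]) i hi
  simp only [Pi.sub_apply, Pi.smul_apply, smul_eq_mul] at this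
  linarith

theorem eq_mul_of_zero (S : IsLinkVector M C₀ V ℓ) {x y : ι → ℝ}
    (hx : x ∈ M) (hy : y ∈ M) {a : ℝ} (h : ∀ i ∈ C₀, x i = a * y i) {p : ι} (hp : p ∈ V)
    (hxp : x p = 0) (hyp : y p = 0) : ∀ i ∈ C₀ ∪ V, x i = a * y i := by
  refine S.eq_mul (P := {p}) (Finset.singleton_subset_iff.2 hp) ⟨p, Finset.mem_singleton_self p⟩
    hx hy fun i hi => ?_
  rcases Finset.mem_union.1 hi with hi | hi
  · exact h i hi
  · rw [Finset.mem_singleton.1 hi, hxp, hyp, mul_zero]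

/-- Vectors that are proportional on `C₀` and have minimum `0` over `P` are proportional. -/
theorem posProp_of_min (S : IsLinkVector M C₀ V ℓ) (hPV : P ⊆ V) {x y : ι → ℝ}
    (hx : x ∈ M) (hy : y ∈ M) (h : PosProp C₀ x y) (hxn : ∀ i ∈ P, 0 ≤ x i)
    (hyn : ∀ i ∈ P, 0 ≤ y i) (hx0 : ∃ i ∈ P, x i = 0) (hy0 : ∃ i ∈ P, y i = 0) :
    PosProp (C₀ ∪ V) x y := by
  obtain ⟨a, ha, h⟩ := h
  obtain ⟨i, hi, hxi⟩ := hx0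
  obtain ⟨j, hj, hyj⟩ := hy0
  obtain ⟨b, hb⟩ := S.const (x - a • y) (M.sub_mem hx (M.smul_mem a hy))
    (fun i hi => by simp [h i hi])
  have h1 := hb i (hPV hi)
  have h2 := hb j (hPV hj)
  simp only [Pi.sub_apply, Pi.smul_apply, smul_eq_mul, hxi, hyj] at h1 h2
  have h3 := mul_nonneg ha.le (hyn i hi)
  have h4 := hxn j hj
  have hb0 : b = 0 := by linarith
  refine ⟨a, ha, fun k hk => ?_⟩
  rcases Finset.mem_union.1 hk with hk | hk
  · exact h k hk
  · have := hb k hk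
    simp only [Pi.sub_apply, Pi.smul_apply, smul_eq_mul] at this
    linarith

/-- Otherwise minimality makes `ℓ` a multiple of `x` on `C₀ ∪ P`. The factor must be 0, because `x`
does not vanish on `C₀` while `ℓ` does; but `ℓ` is 1 on `P`. -/
theorem exists_eq_zero (S : IsLinkVector M C₀ V ℓ) (hPV : P ⊆ V) (hP : P.Nonempty) {x : ι → ℝ}
    (hx : IsCutRay M C₀ P x) : ∃ i ∈ P, x i = 0 := by
  by_contra hcon
  push Not at hcon
  obtain ⟨a, ha⟩ := hx.1.minimal ℓ S.mem fun i hi h => by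
    rcases Finset.mem_union.1 hi with hi | hi
    · exact S.zero i hi
    · exact absurd h (hcon i hi)
  obtain ⟨j, hj⟩ := hP
  obtain ⟨i, hi, hxi⟩ := hx.2
  have h1 := ha i (Finset.mem_union_left _ hi)
  have h2 := ha j (Finset.mem_union_right _ hj)
  rw [S.zero i hi] at h1
  rw [S.one j (hPV hj), (mul_eq_zero.1 h1.symm).resolve_right hxi, zero_mul] at h2
  exact one_ne_zero h2

/-- The zero of `x` in `P` is also a zero of every `y` supported in `x`. It pins down the translate,
so proportionality on `C₀` extends to `V`. -/
theorem isCutRay (S : IsLinkVector M C₀ V ℓ) (hPV : P ⊆ V) {x : ι → ℝ} (hx : IsExtremal M C₀ x)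
    (hn : ∀ i ∈ P, 0 ≤ x i) (h0 : ∃ i ∈ P, x i = 0) : IsCutRay M C₀ P x := by
  obtain ⟨i, hi, hxi⟩ := hx.ne_zero
  refine ⟨⟨hx.mem, fun j hj => ?_, ⟨i, Finset.mem_union_left _ hi, hxi⟩, fun y hy hys => ?_⟩,
    i, hi, hxi⟩
  · rcases Finset.mem_union.1 hj with hj | hj
    exacts [hx.nonneg j hj, hn j hj]
  · obtain ⟨a, ha⟩ := hx.minimal y hy fun j hj => hys j (Finset.mem_union_left _ hj)
    obtain ⟨k, hk, hxk⟩ := h0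
    have := S.eq_mul_of_zero hy hx.mem ha (hPV hk) (hys k (Finset.mem_union_right _ hk) hxk) hxk
    exact ⟨a, fun j hj => this j (Finset.union_subset_union_right hPV hj)⟩

theorem _root_.NormalSurface.IsCutRay.of_posProp {x y : ι → ℝ} (hx : IsCutRay M C₀ P x)
    (h : PosProp (C₀ ∪ P) x y) (hy : y ∈ M) : IsCutRay M C₀ P y := by
  refine ⟨hx.1.of_posProp h hy, ?_⟩
  obtain ⟨i, hi, hxi⟩ := hx.2
  exact ⟨i, hi, fun h0 => hxi (h.symm.eq_zero (Finset.mem_union_left _ hi) h0)⟩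

end IsLinkVector

variable [DecidableEq ι] [Fintype ι] {M : Submodule ℝ (ι → ℝ)} {C₀ V P : Finset ι} {ℓ : ι → ℝ}
  {compat : (ι → ℝ) → (ι → ℝ) → Prop} {L : List (ι → ℝ)}

/-- A new vector made from two extremal ones is extremal. -/
theorem isCutRay_crossing_of_isCutRay (S : IsLinkVector M C₀ V ℓ)
    (hc : IsSupportCompat C₀ compat) (hPV : P ⊆ V) (hP : P.Nonempty) {p : ι} (hp : p ∈ V)
    (hL : Represents compat (C₀ ∪ V) (fun x => IsCutRay M C₀ P x ∨ IsCanonicalRay M C₀ V x) L)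
    {u w : ι → ℝ} (hpair : CrossingPair compat (C₀ ∪ P) (fun x => x p) L u w)
    (hu : IsCutRay M C₀ P u) (hw : IsCutRay M C₀ P w) :
    IsCutRay M C₀ (insert p P) (crossing (fun x => x p) u w) := by
  have hCD : C₀ ∪ P ⊆ C₀ ∪ V := Finset.union_subset_union_right hPV
  have hC : C₀ ⊆ C₀ ∪ P := Finset.subset_union_left
  have hup : 0 < u p := hpair.pos
  have hwp : w p < 0 := hpair.neg
  have hun := hu.1.nonneg
  have hwn := hw.1.nonneg
  have hPn : ∀ x : ι → ℝ, (∀ i ∈ C₀ ∪ P, 0 ≤ x i) → ∀ i ∈ P, 0 ≤ x i := fun x h i hi =>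
    h i (Finset.mem_union_right _ hi)
  have htest : ∀ z ∈ L, (∀ i ∈ C₀ ∪ P, u i = 0 → w i = 0 → z i = 0) → z = u ∨ z = w := by
    intro z hz hs
    by_contra hcon
    push Not at hcon
    exact hpair.test z hz hcon.1 hcon.2 hs
  have hself : ∀ z : ι → ℝ, (∀ i ∈ C₀ ∪ P, u i = 0 → w i = 0 → z i = 0) → compat z z :=
    fun z hz => hc.self hpair.compat fun i hi => hz i (hC hi)
  have hnot : ¬ PosProp (C₀ ∪ V) u w := fun h =>
    absurd (h.pos (Finset.mem_union_right _ hp) hup) hwp.not_gt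
  have hu0 := S.exists_eq_zero hPV hP hu
  have hw0 := S.exists_eq_zero hPV hP hw
  -- Both vectors have minimum 0 over `P`, so proportionality on `C₀` would extend to `V`, against
  -- the signs at `p`.
  have hnot0 : ¬ PosProp C₀ u w := fun h =>
    hnot (S.posProp_of_min hPV hu.1.mem hw.1.mem h (hPn u hun) (hPn w hwn) hu0 hw0)
  -- The link is an extreme ray for `C₀ ∪ P` that is not represented, so the test does not exclude
  -- it from the face of `u` and `w`; a common zero in `P` does. If there were none, then `P` would
  -- lie in the union of the supports, and the support condition would be insensitive to translation
  -- by `ℓ`.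
  have hPuw : ∃ i ∈ P, u i = 0 ∧ w i = 0 := by
    by_contra hcon
    push Not at hcon
    -- Otherwise the canonical translate of `w` would be represented by `u` or `w`. But `u` is not
    -- proportional to `w` on `C₀`, and `w` is negative at `p`, where the canonical translate is
    -- not.
    have hw1 : ¬ IsExtremal M C₀ w := by
      intro h
      obtain ⟨μ, -, hn, h0⟩ := S.exists_sub (Finset.Subset.refl V) (hP.mono hPV) w
      have hs : ∀ i ∈ C₀ ∪ P, u i = 0 → w i = 0 → (w - μ • ℓ) i = 0 := by
        intro i hi h1 h2
        rcases Finset.mem_union.1 hi with hi | hi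
        · rw [S.sub_apply_zero w μ hi, h2]
        · exact absurd h2 (hcon i hi h1)
      obtain ⟨z, hz, hzv⟩ := hL.complete _ (Or.inr ⟨S.isExtremal_sub h μ, hn, h0⟩) (hself _ hs)
      have hzw : PosProp C₀ z w := by
        obtain ⟨a, ha, h⟩ := hzv
        exact ⟨a, ha, fun i hi => by
          rw [h i (Finset.mem_union_left _ hi), S.sub_apply_zero w μ hi]⟩
      rcases htest z hz fun i hi h1 h2 => hzv.symm.eq_zero (hCD hi) (hs i hi h1 h2) with rfl | rfl
      · exact hnot0 hzw
      · exact absurd (hzv.symm.nonneg (Finset.mem_union_right _ hp) (hn p hp)) hwp.not_ge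
    -- A vector extremal for `C₀` and supported there in `w` has a cut translate, represented by `u`
    -- or `w`; by `hw1` it is `u`. So `u` and `ℓ` span the face of `w`, and `w` is proportional to
    -- `u` on `C₀`, which is impossible.
    have hw2 : w ∈ spanOn (C₀ ∪ V) u ℓ := by
      refine mem_of_extremal (M := M) (C := C₀) _ (fun y hy h => ?_) w hw.1.mem
        (fun i hi => hwn i (hC hi)) fun e he hes => ?_
      · obtain ⟨b, hb⟩ := S.const y hy h
        refine ⟨0, b, fun i hi => ?_⟩
        rcases Finset.mem_union.1 hi with hi | hi
        · rw [h i hi, S.zero i hi]; ring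
        · rw [hb i hi, S.one i hi]; ring
      · obtain ⟨μ, -, hn, h0⟩ := S.exists_sub hPV hP e
        have hs : ∀ i ∈ C₀ ∪ P, u i = 0 → w i = 0 → (e - μ • ℓ) i = 0 := by
          intro i hi h1 h2
          rcases Finset.mem_union.1 hi with hi | hi
          · rw [S.sub_apply_zero e μ hi, hes i hi h2]
          · exact absurd h2 (hcon i hi h1)
        have he' := S.isExtremal_sub he μ
        obtain ⟨z, hz, hze⟩ := hL.complete _ (Or.inl (S.isCutRay hPV he' hn h0)) (hself _ hs)
        rcases htest z hz fun i hi h1 h2 => hze.symm.eq_zero (hCD hi) (hs i hi h1 h2) with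
          rfl | rfl
        · obtain ⟨a, ha, h⟩ := hze.symm
          refine ⟨a, μ, fun i hi => ?_⟩
          have := h i hi
          simp only [Pi.sub_apply, Pi.smul_apply, smul_eq_mul] at this
          linarith
        · exact absurd (he'.of_posProp (hze.symm.mono Finset.subset_union_left) hw.1.mem) hw1
    obtain ⟨a, b, hab⟩ := hw2
    obtain ⟨i, hi, hwi⟩ := hw.2
    have h0 : ∀ i ∈ C₀, w i = a * u i := fun i hi => by
      rw [hab i (Finset.mem_union_left _ hi), S.zero i hi]; ring
    refine hnot0 (PosProp.symm ⟨a, ?_, h0⟩)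
    have h1 := h0 i hi
    have h2 : 0 < w i := lt_of_le_of_ne (hwn i (hC hi)) (Ne.symm hwi)
    rw [h1] at h2
    exact pos_of_mul_pos_left h2 (hun i (hC hi))
  have hspan : ∀ y ∈ M, (∀ i ∈ C₀ ∪ P, u i = 0 → w i = 0 → y i = 0) →
      y ∈ spanOn (C₀ ∪ V) u w := by
    intro y hy hys
    refine mem_of_extremal_pair (spanOn (C₀ ∪ V) u w) (fun z hzM hz => ⟨0, 0, fun i hi => by
      simp [S.eq_zero hPV hP hzM hz i hi]⟩)
      hu.1.mem hw.1.mem hun hwn (fun e he hes => ?_) hy hys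
    by_cases he0 : ∃ i ∈ C₀, e i ≠ 0
    · obtain ⟨z, hz, hze⟩ := hL.complete e (Or.inl ⟨he, he0⟩) (hself _ hes)
      obtain ⟨a, _, ha⟩ := hze.symm
      rcases htest z hz fun i hi h1 h2 => hze.symm.eq_zero (hCD hi) (hes i hi h1 h2) with rfl | rfl
      · exact ⟨a, 0, fun i hi => by rw [ha i hi]; ring⟩
      · exact ⟨0, a, fun i hi => by rw [ha i hi]; ring⟩
    -- An extremal vector that vanishes on `C₀` is constant on `V`; the common zero of `u` and `w`
    -- in `P` makes the constant 0.
    · exfalso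
      push Not at he0
      obtain ⟨j, hj, h1, h2⟩ := hPuw
      have hz := S.eq_mul_of_zero (x := e) (y := e) (a := 0) he.mem he.mem
        (fun i hi => by rw [he0 i hi, zero_mul])
        (hPV hj) (hes j (Finset.mem_union_right _ hj) h1 h2)
        (hes j (Finset.mem_union_right _ hj) h1 h2)
      obtain ⟨i, hi, hei⟩ := he.ne_zero
      exact hei (by rw [hz i (hCD hi), zero_mul])
  have hzero : ∀ i ∈ C₀ ∪ P, crossing (fun x => x p) u w i = 0 ↔ u i = 0 ∧ w i = 0 := fun i hi =>
    crossing_eq_zero (h := fun x => x p) hup hwp (hun i hi) (hwn i hi)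
  have hxp : crossing (fun x => x p) u w p = 0 := by rw [crossing_apply]; ring
  have hmem : ∀ {i}, i ∈ C₀ ∪ insert p P → i = p ∨ i ∈ C₀ ∪ P := fun {i} hi => by
    simpa [or_left_comm] using hi
  have hsub : C₀ ∪ P ⊆ C₀ ∪ insert p P :=
    Finset.union_subset_union_right (Finset.subset_insert p P)
  obtain ⟨k, hk, huk⟩ := hu.2
  have hk0 : crossing (fun x => x p) u w k ≠ 0 := fun h => huk ((hzero k (hC hk)).1 h).1
  refine ⟨⟨crossing_mem _ hu.1.mem hw.1.mem, fun i hi => ?_, ⟨k, Finset.mem_union_left _ hk, hk0⟩,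
    fun y hy hys => ?_⟩, k, hk, hk0⟩
  · rcases hmem hi with rfl | hi
    · exact hxp.ge
    · exact crossing_nonneg hup hwp (hun i hi) (hwn i hi)
  · obtain ⟨a, b, hab⟩ := hspan y hy fun i hi h1 h2 => hys i (hsub hi) ((hzero i hi).2 ⟨h1, h2⟩)
    have h0 : y p = 0 := hys p (Finset.mem_union_right _ (Finset.mem_insert_self p P)) hxp
    rw [hab p (Finset.mem_union_right _ hp)] at h0
    have hd : u p - w p ≠ 0 := by linarith
    have hu0 := hup.ne'
    refine ⟨b * (u p - w p) / u p, fun i hi => ?_⟩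
    have hiD : i ∈ C₀ ∪ V := by
      rcases hmem hi with rfl | hi
      exacts [Finset.mem_union_right _ hp, hCD hi]
    rw [hab i hiD, crossing_apply]
    have : a = -(b * w p) / u p := by field_simp; linarith
    rw [this]
    field_simp
    ring

/-- The partial canonical ray of an extremal vector at a vertex combines with nothing but the
cut ray that is a translate of it. -/
theorem isCutRay_crossing_of_isCanonicalRay (S : IsLinkVector M C₀ V ℓ)
    (hc : IsSupportCompat C₀ compat) (hPV : P ⊆ V) (hP : P.Nonempty) {p : ι} (hp : p ∈ V)
    (hL : Represents compat (C₀ ∪ V) (fun x => IsCutRay M C₀ P x ∨ IsCanonicalRay M C₀ V x) L)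
    {u w : ι → ℝ} (hpair : CrossingPair compat (C₀ ∪ P) (fun x => x p) L u w)
    (hu : IsCanonicalRay M C₀ V u) (hu' : ¬ IsCutRay M C₀ P u) (hw : IsCutRay M C₀ P w) :
    IsCutRay M C₀ (insert p P) (crossing (fun x => x p) u w) := by
  have hCD : C₀ ∪ P ⊆ C₀ ∪ V := Finset.union_subset_union_right hPV
  obtain ⟨μ, hμ, hn, h0⟩ := S.exists_sub hPV hP u
  have he := S.isExtremal_sub hu.1 μ
  -- The minimum `μ` of `u` over `P` is non-negative, and it is 0 as soon as `u` has a zero in `P`.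
  -- So the translation does not enlarge the support.
  have hs : ∀ i ∈ C₀ ∪ P, u i = 0 → (u - μ • ℓ) i = 0 := by
    intro i hi h1
    rcases Finset.mem_union.1 hi with hi | hi
    · rw [S.sub_apply_zero u μ hi, h1]
    · rw [S.sub_apply_one u μ (hPV hi), h1]
      obtain ⟨j, hj, hj0⟩ := h0
      rw [S.sub_apply_one u μ (hPV hj)] at hj0
      have h2 := hu.2.1 j (hPV hj)
      have h3 := hμ i hi
      linarith
  obtain ⟨z, hz, hze⟩ := hL.complete _ (Or.inl (S.isCutRay hPV he hn h0))
    (hc.self hpair.compat fun i hi h _ => hs i (Finset.mem_union_left _ hi) h)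
  -- The representative `z` of the cut translate is supported in `u` and differs from `u`, which is
  -- not a cut ray; the test leaves only `w`.
  have hzw : z = w := by
    by_contra hne
    refine hpair.test z hz ?_ hne fun i hi h _ => hze.symm.eq_zero (hCD hi) (hs i hi h)
    rintro rfl
    exact hu' ((S.isCutRay hPV he hn h0).of_posProp (hze.symm.mono hCD) hu.1.mem)
  subst hzw
  obtain ⟨a, ha, hza⟩ := hze
  have hup : 0 < u p := hpair.pos
  have hwp : z p < 0 := hpair.neg
  have hza0 : ∀ i ∈ C₀, z i = a * u i := fun i hi => by
    rw [hza i (Finset.mem_union_left _ hi), S.sub_apply_zero u μ hi]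
  refine S.isCutRay (Finset.insert_subset hp hPV) (hu.1.of_posProp (PosProp.symm
    ⟨(u p - z p)⁻¹ * (u p * a - z p), mul_pos (inv_pos.2 (by linarith)) ?_, fun i hi => ?_⟩)
    (crossing_mem _ hu.1.mem hw.1.mem)) (fun i hi => ?_)
    ⟨p, Finset.mem_insert_self p P, by rw [crossing_apply]; ring⟩
  · have := mul_pos hup ha
    linarith
  · rw [crossing_apply, hza0 i hi]; ring
  · rcases Finset.mem_insert.1 hi with rfl | hi
    · rw [crossing_apply]
      exact le_of_eq (by ring)
    · exact crossing_nonneg hup hwp (hu.2.1 i (hPV hi))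
        (hw.1.nonneg i (Finset.mem_union_right _ hi))

end Conversion

end NormalSurface

namespace NormalSurface

/-! ### Processing one triangular position -/

section ConversionStep

variable {ι : Type} {M : Submodule ℝ (ι → ℝ)} {C₀ V P : Finset ι}
  {ℓ : ι → ℝ} {compat : (ι → ℝ) → (ι → ℝ) → Prop} {L : List (ι → ℝ)}

/-- The list after processing the position `p`, when the positions `C` have been processed. -/
def positionStep {K : Type} [Field K] [LinearOrder K] [Fintype ι]
    (compat : (ι → K) → (ι → K) → Prop) [∀ u w, Decidable (compat u w)]
    (C : Finset ι) (p : ι) (L : List (ι → K)) : List (ι → K) :=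
  (L.filter fun x => x p = 0) ++ (L.filter fun x => 0 < x p) ++
    newVectors compat C (fun x => x p) L

theorem mem_positionStep [Fintype ι] [∀ u w, Decidable (compat u w)] {C : Finset ι} {p : ι}
    {x : ι → ℝ} : x ∈ positionStep compat C p L ↔ (x ∈ L ∧ 0 ≤ x p) ∨
      ∃ u w, CrossingPair compat C (fun x => x p) L u w ∧ crossing (fun x => x p) u w = x := by
  simp only [positionStep, List.mem_append, mem_newVectors, List.mem_filter, decide_eq_true_eq,
    le_iff_eq_or_lt, ← and_or_left, eq_comm (a := (0 : ℝ))]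

theorem Irredundant.step [Fintype ι] [∀ u w, Decidable (compat u w)] {C D : Finset ι} (hCD : C ⊆ D)
    {p : ι} (hp : p ∈ D) (hL : Irredundant D L) (hLn : ∀ x ∈ L, ∀ i ∈ C, 0 ≤ x i) :
    Irredundant D (positionStep compat C p L) := by
  refine hL.append_newVectors hCD hLn (LinearMap.proj p : (ι → ℝ) →ₗ[ℝ] ℝ)
    (fun x y h hx => h.eq_zero hp hx) ?_ ?_
  · refine List.Nodup.append (hL.1.filter _) (hL.1.filter _) ?_
    rw [List.disjoint_left]
    intro x hx hx'
    simp only [List.mem_filter, decide_eq_true_eq] at hx hx'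
    exact hx'.2.ne' hx.2
  · intro x hx
    simp only [List.mem_append, List.mem_filter, decide_eq_true_eq] at hx
    rcases hx with hx | hx
    exacts [⟨hx.1, hx.2.ge⟩, ⟨hx.1, hx.2.le⟩]

variable [DecidableEq ι]

/-- A cut ray on `x p = 0` that is extremal with respect to `C₀` is found from its two
translates by multiples of the link. -/
theorem exists_crossing_of_isExtremal (S : IsLinkVector M C₀ V ℓ)
    (hc : IsSupportCompat C₀ compat) (hPV : P ⊆ V) (hP : P.Nonempty) {p : ι} (hp : p ∈ V)
    (hL : Represents compat (C₀ ∪ V) (fun x => IsCutRay M C₀ P x ∨ IsCanonicalRay M C₀ V x) L)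
    {x : ι → ℝ} (hx : IsExtremal M C₀ x) (hcx : compat x x) (hxn : ∀ i ∈ P, 0 ≤ x i)
    (hxp : x p = 0) (hxV : ¬ IsCanonicalRay M C₀ V x) (hxP : ¬ IsCutRay M C₀ P x) :
    ∃ u w, CrossingPair compat (C₀ ∪ P) (fun x => x p) L u w ∧
      PosProp (C₀ ∪ V) (crossing (fun x => x p) u w) x := by
  obtain ⟨μ, hμ, hμn, hμ0⟩ := S.exists_sub (Finset.Subset.refl V) (hP.mono hPV) x
  obtain ⟨ν, hν, hνn, hν0⟩ := S.exists_sub hPV hP x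
  have hC : C₀ ⊆ C₀ ∪ V := Finset.subset_union_left
  -- The minimum over `V` is at most `x p = 0`, and it is not 0 because `x` is not canonical.
  -- Likewise the minimum `ν` over `P` is positive because `x` is not a cut ray for `P`. So the two
  -- translates lie on opposite sides of `x p = 0`.
  have hμneg : μ < 0 := by
    refine lt_of_le_of_ne (hxp ▸ hμ p hp) ?_
    rintro rfl
    rw [zero_smul, sub_zero] at hμn hμ0
    exact hxV ⟨hx, hμn, hμ0⟩
  have hνpos : 0 < ν := by
    obtain ⟨j, hj, hj0⟩ := hν0
    rw [S.sub_apply_one x ν (hPV hj)] at hj0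
    have h1 := hxn j hj
    refine lt_of_le_of_ne (by linarith) fun h => hxP (S.isCutRay hPV hx hxn ⟨j, hj, by linarith⟩)
  have hcs : ∀ ξ : ℝ, compat (x - ξ • ℓ) (x - ξ • ℓ) := fun ξ =>
    hc.self hcx fun i hi h _ => by rw [S.sub_apply_zero x ξ hi, h]
  obtain ⟨u, hu, a, ha, hua⟩ := hL.complete _ (Or.inr ⟨S.isExtremal_sub hx μ, hμn, hμ0⟩) (hcs μ)
  obtain ⟨w, hw, b, hb, hwb⟩ := hL.complete _
    (Or.inl (S.isCutRay hPV (S.isExtremal_sub hx ν) hνn hν0)) (hcs ν)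
  have hpD : p ∈ C₀ ∪ V := Finset.mem_union_right _ hp
  have hup : u p = a * (-μ) := by rw [hua p hpD, S.sub_apply_one x μ hp, hxp, zero_sub]
  have hwp : w p = b * (-ν) := by rw [hwb p hpD, S.sub_apply_one x ν hp, hxp, zero_sub]
  have hup' : 0 < u p := hup ▸ mul_pos ha (by linarith)
  have hwp' : w p < 0 := hwp ▸ mul_neg_of_pos_of_neg hb (by linarith)
  have hu0 : ∀ i ∈ C₀, u i = a * x i := fun i hi => by
    rw [hua i (hC hi), S.sub_apply_zero x μ hi]
  have hw0 : ∀ i ∈ C₀, w i = b * x i := fun i hi => by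
    rw [hwb i (hC hi), S.sub_apply_zero x ν hi]
  have hMmem : ∀ z ∈ L, z ∈ M := fun z hz =>
    (hL.sound z hz).1.elim (fun h => h.1.mem) fun h => h.1.mem
  refine ⟨u, w, ⟨hu, hw, hup', hwp', hc.of_supp hcx (fun i hi h _ => by rw [hu0 i hi, h, mul_zero])
    fun i hi h _ => by rw [hw0 i hi, h, mul_zero], fun z hz hzu hzw hs => ?_⟩, ?_⟩
  -- A listed vector in this support is proportional to `x` on `C₀`. Its normalisation, minimum 0
  -- over `P` or over `V`, identifies it with `w` or with `u`.
  · have hzM := hMmem z hz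
    have hzs : ∀ i ∈ C₀, x i = 0 → z i = 0 := fun i hi h => hs i (Finset.mem_union_left _ hi)
      (by rw [hu0 i hi, h, mul_zero]) (by rw [hw0 i hi, h, mul_zero])
    rcases (hL.sound z hz).1 with hz' | hz'
    · have hzx := hx.posProp hzM (fun i hi => hz'.1.nonneg i (Finset.mem_union_left _ hi)) hz'.2 hzs
      refine hzw (hL.irredundant.2 z hz w hw ((S.posProp_of_min hPV hzM
        (S.isExtremal_sub hx ν).mem ?_ (fun i hi => hz'.1.nonneg i (Finset.mem_union_right _ hi))
        hνn (S.exists_eq_zero hPV hP hz') hν0).trans (PosProp.symm ⟨b, hb, hwb⟩)))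
      exact hzx.trans ⟨1, one_pos, fun i hi => by rw [S.sub_apply_zero x ν hi, one_mul]⟩
    · have hzx := hx.posProp hzM hz'.1.nonneg hz'.1.ne_zero hzs
      refine hzu (hL.irredundant.2 z hz u hu ((S.posProp_of_min (Finset.Subset.refl V) hzM
        (S.isExtremal_sub hx μ).mem ?_ hz'.2.1 hμn hz'.2.2 hμ0).trans
        (PosProp.symm ⟨a, ha, hua⟩)))
      exact hzx.trans ⟨1, one_pos, fun i hi => by rw [S.sub_apply_zero x μ hi, one_mul]⟩
  · refine ⟨(u p - w p)⁻¹ * (u p * b - w p * a), mul_pos (inv_pos.2 (by linarith)) ?_,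
      S.eq_mul_of_zero (crossing_mem _ (hMmem u hu) (hMmem w hw)) hx.mem (fun i hi => ?_) hp
        (by rw [crossing_apply]; ring) hxp⟩
    · have h1 := mul_pos hup' hb
      have h2 := mul_pos (neg_pos.2 hwp') ha
      linarith
    · rw [crossing_apply, hu0 i hi, hw0 i hi]; ring

/-- A cut ray on `x p = 0` that is not extremal with respect to `C₀` is found from two cut rays. -/
theorem exists_crossing_of_not_isExtremal (S : IsLinkVector M C₀ V ℓ)
    (hc : IsSupportCompat C₀ compat) (hPV : P ⊆ V) (hP : P.Nonempty) {p : ι} (hp : p ∈ V)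
    (hL : Represents compat (C₀ ∪ V) (fun x => IsCutRay M C₀ P x ∨ IsCanonicalRay M C₀ V x) L)
    {x : ι → ℝ} (hx : IsCutRay M C₀ (insert p P) x) (hcx : compat x x)
    (hxp : x p = 0) (hx0 : ¬ IsExtremal M C₀ x) (hxP : ¬ IsCutRay M C₀ P x) :
    ∃ u w, CrossingPair compat (C₀ ∪ P) (fun x => x p) L u w ∧
      PosProp (C₀ ∪ V) (crossing (fun x => x p) u w) x := by
  have hC : C₀ ⊆ C₀ ∪ V := Finset.subset_union_left
  have hCP : C₀ ⊆ C₀ ∪ P := Finset.subset_union_left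
  have hCD : C₀ ∪ P ⊆ C₀ ∪ V := Finset.union_subset_union_right hPV
  have hsub : C₀ ∪ P ⊆ C₀ ∪ insert p P :=
    Finset.union_subset_union_right (Finset.subset_insert p P)
  have hpD : p ∈ C₀ ∪ V := Finset.mem_union_right _ hp
  have hmem : ∀ {i}, i ∈ C₀ ∪ insert p P → i = p ∨ i ∈ C₀ ∪ P := fun {i} hi => by
    simpa [or_left_comm] using hi
  obtain ⟨k, hk, hxk⟩ := hx.2
  have hxn : ∀ i ∈ C₀ ∪ P, 0 ≤ x i := fun i hi => hx.1.nonneg i (hsub hi)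
  have hmin : ∀ y ∈ M, (∀ i ∈ C₀ ∪ P, x i = 0 → y i = 0) → y p = 0 →
      ∃ a : ℝ, ∀ i ∈ C₀ ∪ P, y i = a * x i := by
    intro y hy hys hyp
    obtain ⟨a, ha⟩ := hx.1.minimal y hy fun i hi h => by
      rcases hmem hi with rfl | hi
      exacts [hyp, hys i hi h]
    exact ⟨a, fun i hi => ha i (hsub hi)⟩
  obtain ⟨u₁, w₁, hu₁, hw₁, hup₁, hwp₁, hus, hws, ⟨i, hi, hui, hwi⟩, ⟨j, hj, hwj, huj⟩,
    ⟨κ, hκ, hxκ⟩, hspan⟩ := exists_split (LinearMap.proj p : (ι → ℝ) →ₗ[ℝ] ℝ)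
      (fun y hy h => S.eq_zero hPV hP hy h p hpD) hx.1.mem hxn
      ⟨k, Finset.mem_union_left _ hk, hxk⟩ hxp hmin fun h => hxP ⟨h, k, hk, hxk⟩
  rw [LinearMap.proj_apply] at hup₁ hwp₁
  have hlink : ∀ z : ι → ℝ, z ∈ M → (∀ i ∈ C₀, z i = 0) → ∀ i ∈ C₀ ∪ V, z i = z p * ℓ i := by
    intro z hz h
    obtain ⟨b, hb⟩ := S.const z hz h
    intro i hi
    rcases Finset.mem_union.1 hi with hi | hi
    · rw [h i hi, S.zero i hi, mul_zero]
    · rw [hb i hi, hb p hp, S.one i hi, mul_one]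
  -- As a multiple of the link, `w₁` would have on `P` the negative value that it has at `p`.
  have hw0 : ∃ i ∈ C₀, w₁ i ≠ 0 := by
    by_contra hcon
    push Not at hcon
    obtain ⟨q, hq⟩ := hP
    have h1 := hlink w₁ hw₁.mem hcon q (hCD (Finset.mem_union_right _ hq))
    rw [S.one q (hPV hq), mul_one] at h1
    have h2 := hw₁.nonneg q (Finset.mem_union_right _ hq)
    linarith
  -- If `u₁` were a multiple of the link, then `x` would be proportional to `w₁` on `C₀`, and the
  -- face would be one-dimensional there, making `x` extremal for `C₀`.
  have hu0 : ∃ i ∈ C₀, u₁ i ≠ 0 := by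
    by_contra hcon
    push Not at hcon
    have h1 := hlink u₁ hu₁.mem hcon
    have h2 : ∀ i ∈ C₀, x i = κ * w₁ i := fun i hi => by
      rw [hxκ i (hCP hi), hcon i hi, zero_add]
    refine hx0 ⟨hx.1.mem, fun i hi => hxn i (hCP hi), ⟨k, hk, hxk⟩, fun y hy hys => ?_⟩
    obtain ⟨a, b, hab⟩ := hspan y hy fun i hi h => by
      rcases Finset.mem_union.1 hi with hi' | hi'
      · exact hys i hi' h
      · exfalso
        rw [hxκ i hi] at h
        have h3 := (mul_eq_zero.1 h).resolve_left hκ.ne'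
        have h4 := h1 i (hCD hi)
        rw [S.one i (hPV hi'), mul_one] at h4
        have h5 := hw₁.nonneg i hi
        linarith
    exact ⟨b / κ, fun i hi => by
      rw [hab i (hCP hi), hcon i hi, h2 i hi]
      field_simp
      ring⟩
  obtain ⟨u, hu, a, ha, hua⟩ := hL.complete u₁ (Or.inl ⟨hu₁, hu0⟩)
    (hc.self hcx fun i hi h _ => hus i (hCP hi) h)
  obtain ⟨w, hw, b, hb, hwb⟩ := hL.complete w₁ (Or.inl ⟨hw₁, hw0⟩)
    (hc.self hcx fun i hi h _ => hws i (hCP hi) h)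
  have hup : u p = a * u₁ p := hua p hpD
  have hwp : w p = b * w₁ p := hwb p hpD
  have hup' : 0 < u p := hup ▸ mul_pos ha hup₁
  have hwp' : w p < 0 := hwp ▸ mul_neg_of_pos_of_neg hb hwp₁
  have hMmem : ∀ z ∈ L, z ∈ M := fun z hz =>
    (hL.sound z hz).1.elim (fun h => h.1.mem) fun h => h.1.mem
  have hu₁i : 0 < u₁ j := lt_of_le_of_ne (hu₁.nonneg j hj) (Ne.symm huj)
  have hw₁i : 0 < w₁ i := lt_of_le_of_ne (hw₁.nonneg i hi) (Ne.symm hwi)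
  have hcoef : ∀ z : ι → ℝ, (∀ i ∈ C₀ ∪ P, 0 ≤ z i) → ∀ c d : ℝ,
      (∀ i ∈ C₀ ∪ P, z i = c * u₁ i + d * w₁ i) → 0 ≤ c ∧ 0 ≤ d := by
    intro z hz c d hcd
    constructor
    · have h1 := hz j hj
      rw [hcd j hj, hwj, mul_zero, add_zero] at h1
      exact nonneg_of_mul_nonneg_left h1 hu₁i
    · have h1 := hz i hi
      rw [hcd i hi, hui, mul_zero, zero_add] at h1
      exact nonneg_of_mul_nonneg_left h1 hw₁i
  -- A canonical ray in this face without a zero in `P` would put `ℓ` into the span of `u₁` and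
  -- `w₁`, with non-negative coefficients. As `ℓ` vanishes on `C₀`, where neither of them does, both
  -- coefficients would be 0.
  have hzcut : ∀ z ∈ L, (∀ k ∈ C₀ ∪ P, x k = 0 → z k = 0) → IsCutRay M C₀ P z := by
    intro z hz hs
    rcases (hL.sound z hz).1 with h | h
    · exact h
    · by_cases hz0 : ∃ q ∈ P, z q = 0
      · exact S.isCutRay hPV h.1 (fun q hq => h.2.1 q (hPV hq)) hz0
      · exfalso
        push Not at hz0
        obtain ⟨c, d, hcd⟩ := hspan ℓ S.mem fun q hq h0 => by
          rcases Finset.mem_union.1 hq with hq' | hq'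
          · exact S.zero q hq'
          · exact absurd (hs q hq h0) (hz0 q hq')
        obtain ⟨hc0, hd0⟩ := hcoef ℓ (fun q hq => by
          rcases Finset.mem_union.1 hq with hq | hq
          · exact (S.zero q hq).ge
          · rw [S.one q (hPV hq)]; exact zero_le_one) c d hcd
        have hcz : ∀ q ∈ C₀, c * u₁ q = 0 ∧ d * w₁ q = 0 := fun q hq => by
          have h1 := hcd q (hCP hq)
          rw [S.zero q hq] at h1
          have h2 := mul_nonneg hc0 (hu₁.nonneg q (hCP hq))
          have h3 := mul_nonneg hd0 (hw₁.nonneg q (hCP hq))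
          constructor <;> linarith
        obtain ⟨q, hq, hq0⟩ := hu0
        obtain ⟨r, hr, hr0⟩ := hw0
        have hc1 := (mul_eq_zero.1 (hcz q hq).1).resolve_right hq0
        have hd1 := (mul_eq_zero.1 (hcz r hr).2).resolve_right hr0
        obtain ⟨s, hs⟩ := hP
        have h1 := hcd s (Finset.mem_union_right _ hs)
        rw [S.one s (hPV hs), hc1, hd1] at h1
        norm_num at h1
  refine ⟨u, w, ⟨hu, hw, hup', hwp', hc.of_supp hcx
    (fun i hi h _ => by rw [hua i (hC hi), hus i (hCP hi) h, mul_zero])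
    fun i hi h _ => by rw [hwb i (hC hi), hws i (hCP hi) h, mul_zero],
    fun z hz hzu hzw hs => ?_⟩, ?_⟩
  · have hzx : ∀ k ∈ C₀ ∪ P, x k = 0 → z k = 0 := fun k hk h => hs k hk
      (by rw [hua k (hCD hk), hus k hk h, mul_zero]) (by rw [hwb k (hCD hk), hws k hk h, mul_zero])
    have hze := hzcut z hz hzx
    obtain ⟨c, d, hcd⟩ := hspan z hze.1.mem hzx
    obtain ⟨hc0, hd0⟩ := hcoef z hze.1.nonneg c d hcd
    rcases hc0.eq_or_lt with hc0 | hc0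
    · obtain ⟨e, he, hze'⟩ := hw₁.posProp hze.1.mem hze.1.nonneg hze.1.ne_zero fun k hk h => by
        rw [hcd k hk, h, ← hc0]; ring
      exact hzw (hL.irredundant.2 z hz w hw (PosProp.trans
        ⟨e, he, S.eq_mul hPV hP hze.1.mem hw₁.mem hze'⟩ (PosProp.symm ⟨b, hb, hwb⟩)))
    rcases hd0.eq_or_lt with hd0 | hd0
    · obtain ⟨e, he, hze'⟩ := hu₁.posProp hze.1.mem hze.1.nonneg hze.1.ne_zero fun k hk h => by
        rw [hcd k hk, h, ← hd0]; ring
      exact hzu (hL.irredundant.2 z hz u hu (PosProp.trans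
        ⟨e, he, S.eq_mul hPV hP hze.1.mem hu₁.mem hze'⟩ (PosProp.symm ⟨a, ha, hua⟩)))
    obtain ⟨e, he⟩ := hze.1.minimal u₁ hu₁.mem fun k hk h => by
      rw [hcd k hk] at h
      have h1 := mul_nonneg hc0.le (hu₁.nonneg k hk)
      have h2 := mul_nonneg hd0.le (hw₁.nonneg k hk)
      exact (mul_eq_zero.1 (by linarith : c * u₁ k = 0)).resolve_left hc0.ne'
    have h1 := he i hi
    have h2 := he j hj
    rw [hui, hcd i hi, hui, mul_zero, zero_add] at h1
    rcases mul_eq_zero.1 h1.symm with h3 | h3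
    · rw [h3, zero_mul] at h2
      exact huj h2
    · exact (mul_ne_zero hd0.ne' hwi) h3
  · have hxD : ∀ q ∈ C₀ ∪ V, x q = κ * (u₁ q + w₁ q) := fun q hq => by
      have := S.eq_mul hPV hP hx.1.mem (M.add_mem hu₁.mem hw₁.mem) (a := κ)
        (fun i hi => by rw [hxκ i hi, Pi.add_apply]) q hq
      simpa using this
    have hpp : w₁ p = -u₁ p := by
      have := hxD p hpD
      rw [hxp] at this
      linarith [(mul_eq_zero.1 this.symm).resolve_left hκ.ne']
    refine ⟨(a * u₁ p + b * u₁ p)⁻¹ * (a * b * u₁ p) * κ⁻¹, ?_, fun q hq => ?_⟩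
    · have h2 := mul_pos ha hup₁
      have h3 := mul_pos hb hup₁
      exact mul_pos (mul_pos (inv_pos.2 (by linarith)) (mul_pos (mul_pos ha hb) hup₁))
        (inv_pos.2 hκ)
    · rw [crossing_apply, hup, hwp, hpp, hxD q hq, hua q hq, hwb q hq]
      have : a * u₁ p - b * -u₁ p = a * u₁ p + b * u₁ p := by ring
      rw [this]
      field_simp
      ring

variable [Fintype ι]

/-- Canonical rays are non-negative on `V`, so they are never discarded, and the negative partner in
a crossing is always a cut ray. They must be kept because they are the positive partners of their
own cut translates. -/
theorem Represents.step [∀ u w, Decidable (compat u w)] (S : IsLinkVector M C₀ V ℓ)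
    (hc : IsSupportCompat C₀ compat) (hPV : P ⊆ V) (hP : P.Nonempty) {p : ι} (hp : p ∈ V)
    (hL : Represents compat (C₀ ∪ V) (fun x => IsCutRay M C₀ P x ∨ IsCanonicalRay M C₀ V x) L) :
    Represents compat (C₀ ∪ V)
      (fun x => IsCutRay M C₀ (insert p P) x ∨ IsCanonicalRay M C₀ V x)
      (positionStep compat (C₀ ∪ P) p L) := by
  have hCD : C₀ ∪ P ⊆ C₀ ∪ V := Finset.union_subset_union_right hPV
  have hpD : p ∈ C₀ ∪ V := Finset.mem_union_right _ hp
  have hsub : C₀ ∪ P ⊆ C₀ ∪ insert p P :=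
    Finset.union_subset_union_right (Finset.subset_insert p P)
  have hmem : ∀ {i}, i ∈ C₀ ∪ insert p P → i = p ∨ i ∈ C₀ ∪ P := fun {i} hi => by
    simpa [or_left_comm] using hi
  have hnn : ∀ x ∈ L, ∀ i ∈ C₀ ∪ P, 0 ≤ x i := by
    intro x hx i hi
    rcases (hL.sound x hx).1 with h | h
    · exact h.1.nonneg i hi
    · rcases Finset.mem_union.1 hi with hi | hi
      exacts [h.1.nonneg i hi, h.2.1 i (hPV hi)]
  refine ⟨hL.irredundant.step hCD hpD hnn, ?_, ?_⟩
  · intro x hx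
    rcases mem_positionStep.1 hx with ⟨hx, hxp⟩ | ⟨u, w, hpair, rfl⟩
    · obtain ⟨h, hcx⟩ := hL.sound x hx
      refine ⟨h.imp_left fun h => ⟨⟨h.1.mem, fun i hi => ?_, ?_, fun y hy hys => ?_⟩, h.2⟩, hcx⟩
      · rcases hmem hi with rfl | hi
        exacts [hxp, h.1.nonneg i hi]
      · obtain ⟨i, hi, h0⟩ := h.2
        exact ⟨i, Finset.mem_union_left _ hi, h0⟩
      · obtain ⟨a, ha⟩ := h.1.minimal y hy fun i hi => hys i (hsub hi)
        have := S.eq_mul hPV hP hy h.1.mem ha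
        refine ⟨a, fun i hi => ?_⟩
        rcases hmem hi with rfl | hi
        exacts [this _ hpD, ha i hi]
    · have hw : IsCutRay M C₀ P w := by
        refine (hL.sound w hpair.right_mem).1.resolve_right fun h => ?_
        exact absurd (h.2.1 p hp) (not_le.2 hpair.neg)
      refine ⟨Or.inl ?_, hc.self hpair.compat fun i hi h1 h2 => ?_⟩
      · by_cases hu : IsCutRay M C₀ P u
        · exact isCutRay_crossing_of_isCutRay S hc hPV hP hp hL hpair hu hw
        · exact isCutRay_crossing_of_isCanonicalRay S hc hPV hP hp hL hpair
            ((hL.sound u hpair.left_mem).1.resolve_left hu) hu hw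
      · rw [crossing_apply, h1, h2]; ring
  · intro x hx hcx
    have keep : (IsCutRay M C₀ P x ∨ IsCanonicalRay M C₀ V x) → 0 ≤ x p →
        ∃ z ∈ positionStep compat (C₀ ∪ P) p L, PosProp (C₀ ∪ V) z x := by
      intro h hxp
      obtain ⟨z, hz, hzx⟩ := hL.complete x h hcx
      exact ⟨z, mem_positionStep.2 (Or.inl ⟨hz, hzx.symm.nonneg hpD hxp⟩), hzx⟩
    by_cases hxF : IsCanonicalRay M C₀ V x
    · exact keep (Or.inr hxF) (hxF.2.1 p hp)
    have hxE := hx.resolve_right hxF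
    have hxp : 0 ≤ x p :=
      hxE.1.nonneg p (Finset.mem_union_right _ (Finset.mem_insert_self p P))
    by_cases hxP : IsCutRay M C₀ P x
    · exact keep (Or.inl hxP) hxp
    rcases hxp.eq_or_lt with h0 | h0
    · have : ∃ u w, CrossingPair compat (C₀ ∪ P) (fun x => x p) L u w ∧
          PosProp (C₀ ∪ V) (crossing (fun x => x p) u w) x := by
        by_cases hx0 : IsExtremal M C₀ x
        · exact exists_crossing_of_isExtremal S hc hPV hP hp hL hx0 hcx (fun i hi =>
            hxE.1.nonneg i (hsub (Finset.mem_union_right _ hi))) h0.symm hxF hxP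
        · exact exists_crossing_of_not_isExtremal S hc hPV hP hp hL hxE hcx h0.symm hx0 hxP
      obtain ⟨u, w, hpair, h⟩ := this
      exact ⟨_, mem_positionStep.2 (Or.inr ⟨u, w, hpair, rfl⟩), h⟩
    -- If `x p > 0`, the position `p` imposes nothing on supports contained in that of `x`, so `x`
    -- is already a cut ray for `P`.
    · refine absurd ⟨⟨hxE.1.mem, fun i hi => hxE.1.nonneg i (hsub hi), ?_, fun y hy hys => ?_⟩,
        hxE.2⟩ hxP
      · obtain ⟨i, hi, h0⟩ := hxE.2
        exact ⟨i, Finset.mem_union_left _ hi, h0⟩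
      · obtain ⟨a, ha⟩ := hxE.1.minimal y hy fun i hi h => by
          rcases hmem hi with rfl | hi
          exacts [absurd h h0.ne', hys i hi h]
        exact ⟨a, fun i hi => ha i (hsub hi)⟩

/-- Processing the first position at a vertex. -/
theorem Represents.first_step [∀ u w, Decidable (compat u w)] (S : IsLinkVector M C₀ V ℓ)
    (hc : IsSupportCompat C₀ compat) {p : ι} (hp : p ∈ V)
    (hL : Represents compat (C₀ ∪ V) (IsCanonicalRay M C₀ V) L) :
    Represents compat (C₀ ∪ V)
      (fun x => IsCutRay M C₀ {p} x ∨ IsCanonicalRay M C₀ V x)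
      (positionStep compat C₀ p (L ++ [-ℓ])) := by
  have hC : C₀ ⊆ C₀ ∪ V := Finset.subset_union_left
  have hpD : p ∈ C₀ ∪ V := Finset.mem_union_right _ hp
  have hpV : {p} ⊆ V := Finset.singleton_subset_iff.2 hp
  have hne : ∀ x ∈ L, ¬ PosProp (C₀ ∪ V) x (-ℓ) := by
    intro x hx h
    obtain ⟨i, hi, hxi⟩ := (hL.sound x hx).1.1.ne_zero
    exact hxi (h.symm.eq_zero (hC hi) (by simp [S.zero i hi]))
  have hirr : Irredundant (C₀ ∪ V) (L ++ [-ℓ]) := by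
    constructor
    · refine List.Nodup.append hL.irredundant.1 (List.nodup_singleton _) ?_
      rw [List.disjoint_left]
      intro x hx hx'
      rw [List.mem_singleton.1 hx'] at hx
      exact hne _ hx (PosProp.refl _ _)
    · intro x hx y hy h
      simp only [List.mem_append, List.mem_singleton] at hx hy
      rcases hx with hx | rfl <;> rcases hy with hy | rfl
      · exact hL.irredundant.2 x hx y hy h
      · exact absurd h (hne x hx)
      · exact absurd h.symm (hne y hy)
      · rfl
  have hnn : ∀ x ∈ L ++ [-ℓ], ∀ i ∈ C₀, 0 ≤ x i := by
    intro x hx i hi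
    simp only [List.mem_append, List.mem_singleton] at hx
    rcases hx with hx | rfl
    · exact (hL.sound x hx).1.1.nonneg i hi
    · simp [S.zero i hi]
  refine ⟨hirr.step hC hpD hnn, ?_, ?_⟩
  · intro x hx
    rcases mem_positionStep.1 hx with ⟨hx, hxp⟩ | ⟨u, w, hpair, rfl⟩
    · simp only [List.mem_append, List.mem_singleton] at hx
      rcases hx with hx | rfl
      · exact ⟨Or.inr (hL.sound x hx).1, (hL.sound x hx).2⟩
      · have : (0 : ℝ) ≤ -1 := by simpa [S.one p hp] using hxp
        linarith
    · have hwL := hpair.right_mem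
      have huL := hpair.left_mem
      simp only [List.mem_append, List.mem_singleton] at hwL huL
      -- Canonical rays are non-negative at `p`, so the first position only crosses canonical rays
      -- with `-ℓ`, which translates them to vanish at `p`.
      have hw : w = -ℓ := hwL.resolve_left fun h =>
        absurd ((hL.sound w h).1.2.1 p hp) (not_le.2 hpair.neg)
      have hu : u ∈ L := huL.resolve_right fun h => by
        have h1 : 0 < u p := hpair.pos
        rw [h, Pi.neg_apply, S.one p hp] at h1
        linarith
      obtain ⟨hu', hcu⟩ := hL.sound u hu
      have hw0 : ∀ i ∈ C₀, w i = 0 := fun i hi => by simp [hw, S.zero i hi]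
      have hup : 0 < u p := hpair.pos
      have hwp : w p = -1 := by simp [hw, S.one p hp]
      have hxp : crossing (fun x => x p) u w p = 0 := by rw [crossing_apply]; ring
      have hwM : w ∈ M := hw ▸ M.neg_mem S.mem
      refine ⟨Or.inl (S.isCutRay hpV (hu'.1.of_posProp (PosProp.symm
        ⟨(u p - w p)⁻¹ * -w p, ?_, fun i hi => ?_⟩) (crossing_mem _ hu'.1.mem hwM)) ?_ ?_),
        hc.self hcu fun i hi h _ => ?_⟩
      · rw [hwp]
        exact mul_pos (inv_pos.2 (by linarith)) (by norm_num)
      · rw [crossing_apply, hw0 i hi]; ring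
      · intro i hi
        rw [Finset.mem_singleton.1 hi, hxp]
      · exact ⟨p, Finset.mem_singleton_self p, hxp⟩
      · rw [crossing_apply, h, hw0 i hi]; ring
  · intro x hx hcx
    have keep : IsCanonicalRay M C₀ V x →
        ∃ z ∈ positionStep compat C₀ p (L ++ [-ℓ]), PosProp (C₀ ∪ V) z x := by
      intro h
      obtain ⟨z, hz, hzx⟩ := hL.complete x h hcx
      exact ⟨z, mem_positionStep.2 (Or.inl ⟨List.mem_append_left _ hz,
        (hL.sound z hz).1.2.1 p hp⟩), hzx⟩
    by_cases hxF : IsCanonicalRay M C₀ V x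
    · exact keep hxF
    have hxE := hx.resolve_right hxF
    obtain ⟨q, hq, hxp⟩ := S.exists_eq_zero hpV ⟨p, Finset.mem_singleton_self p⟩ hxE
    rw [Finset.mem_singleton.1 hq] at hxp
    -- Every `y` has a translate that vanishes at `p`, so a single position adds no condition to
    -- those on `C₀`.
    have hx0 : IsExtremal M C₀ x := by
      refine ⟨hxE.1.mem, fun i hi => hxE.1.nonneg i (Finset.mem_union_left _ hi), hxE.2,
        fun y hy hys => ?_⟩
      obtain ⟨a, ha⟩ := hxE.1.minimal (y - y p • ℓ) (M.sub_mem hy (M.smul_mem _ S.mem))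
        fun i hi h => by
          rcases Finset.mem_union.1 hi with hi | hi
          · rw [S.sub_apply_zero _ _ hi, hys i hi h]
          · rw [Finset.mem_singleton.1 hi, S.sub_apply_one _ _ hp, sub_self]
      exact ⟨a, fun i hi => by
        rw [← ha i (Finset.mem_union_left _ hi), S.sub_apply_zero _ _ hi]⟩
    obtain ⟨μ, hμ, hμn, hμ0⟩ := S.exists_sub (Finset.Subset.refl V) ⟨p, hp⟩ x
    have hμneg : μ < 0 := by
      refine lt_of_le_of_ne (hxp ▸ hμ p hp) ?_
      rintro rfl
      rw [zero_smul, sub_zero] at hμn hμ0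
      exact hxF ⟨hx0, hμn, hμ0⟩
    obtain ⟨u, hu, a, ha, hua⟩ := hL.complete _ ⟨S.isExtremal_sub hx0 μ, hμn, hμ0⟩
      (hc.self hcx fun i hi h _ => by rw [S.sub_apply_zero x μ hi, h])
    obtain ⟨hu', hcu⟩ := hL.sound u hu
    have hup : u p = a * (-μ) := by rw [hua p hpD, S.sub_apply_one x μ hp, hxp, zero_sub]
    have hup' : 0 < u p := hup ▸ mul_pos ha (by linarith)
    have hlp : (-ℓ) p = -1 := by simp [S.one p hp]
    have hpair : CrossingPair compat C₀ (fun x => x p) (L ++ [-ℓ]) u (-ℓ) := by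
      refine ⟨List.mem_append_left _ hu, by simp, hup', by simp [S.one p hp],
        hc.of_supp hcu (fun i _ h _ => h) (fun i hi _ _ => by simp [S.zero i hi]),
        fun z hz hzu hzw hs => ?_⟩
      simp only [List.mem_append, List.mem_singleton] at hz
      have hz := hz.resolve_right hzw
      obtain ⟨hz', -⟩ := hL.sound z hz
      refine hzu (hL.irredundant.2 z hz u hu (S.posProp_of_min (Finset.Subset.refl V) hz'.1.mem
        hu'.1.mem (hu'.1.posProp hz'.1.mem hz'.1.nonneg hz'.1.ne_zero fun i hi h =>
          hs i hi h (by simp [S.zero i hi])) hz'.2.1 hu'.2.1 hz'.2.2 hu'.2.2))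
    refine ⟨_, mem_positionStep.2 (Or.inr ⟨u, -ℓ, hpair, rfl⟩),
      (u p - (-ℓ) p)⁻¹ * a, mul_pos (inv_pos.2 (by rw [hlp]; linarith)) ha,
      S.eq_mul_of_zero (x := crossing (fun x => x p) u (-ℓ))
        (crossing_mem _ hu'.1.mem (M.neg_mem S.mem)) hx0.mem (fun i hi => ?_) hp
        (by rw [crossing_apply]; ring) hxp⟩
    rw [crossing_apply, hlp, hua i (hC hi), S.sub_apply_zero x μ hi, Pi.neg_apply, S.zero i hi]
    ring

end ConversionStep

end NormalSurface

namespace NormalSurface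

/-! ### Processing one vertex -/

section VertexStep

variable {ι : Type} [DecidableEq ι] {M : Submodule ℝ (ι → ℝ)}
  {C₀ V P : Finset ι}
  {ℓ : ι → ℝ} {compat : (ι → ℝ) → (ι → ℝ) → Prop} {L : List (ι → ℝ)}

/-- Passing to partial canonical parts. -/
theorem Represents.canonical (S : IsLinkVector M C₀ V ℓ)
    (hc : IsSupportCompat C₀ compat) (hL : Represents compat C₀ (IsExtremal M C₀) L)
    (m : (ι → ℝ) → ℝ) (hm : ∀ x, (∀ i ∈ V, m x ≤ x i) ∧ ∃ i ∈ V, x i = m x) :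
    Represents compat (C₀ ∪ V) (IsCanonicalRay M C₀ V) (L.map fun x => x - m x • ℓ) := by
  have hn : ∀ x, (∀ i ∈ V, 0 ≤ (x - m x • ℓ) i) ∧ ∃ i ∈ V, (x - m x • ℓ) i = 0 := by
    intro x
    obtain ⟨h1, i, hi, h2⟩ := hm x
    refine ⟨fun j hj => ?_, i, hi, ?_⟩
    · rw [S.sub_apply_one _ _ hj]
      linarith [h1 j hj]
    · rw [S.sub_apply_one _ _ hi, h2, sub_self]
  have hprop : ∀ x, PosProp C₀ (x - m x • ℓ) x := fun x =>
    ⟨1, one_pos, fun i hi => by rw [S.sub_apply_zero _ _ hi, one_mul]⟩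
  have hinj : ∀ x ∈ L, ∀ y ∈ L, PosProp C₀ (x - m x • ℓ) (y - m y • ℓ) → x = y :=
    fun x hx y hy h => hL.irredundant.2 x hx y hy (((hprop x).symm.trans h).trans (hprop y))
  refine ⟨⟨(List.nodup_map_iff_inj_on hL.irredundant.1).2 fun x hx y hy h => ?_, ?_⟩, ?_, ?_⟩
  · exact hinj x hx y hy (h ▸ PosProp.refl _ _)
  · intro x hx y hy h
    obtain ⟨x', hx', rfl⟩ := List.mem_map.1 hx
    obtain ⟨y', hy', rfl⟩ := List.mem_map.1 hy
    rw [hinj x' hx' y' hy' (h.mono Finset.subset_union_left)]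
  · intro x hx
    obtain ⟨x', hx', rfl⟩ := List.mem_map.1 hx
    obtain ⟨he, hcx⟩ := hL.sound x' hx'
    exact ⟨⟨S.isExtremal_sub he _, hn x'⟩, hc.self hcx fun i hi h _ => by
      rw [S.sub_apply_zero _ _ hi, h]⟩
  · intro x hx hcx
    obtain ⟨z, hz, hzx⟩ := hL.complete x hx.1 hcx
    exact ⟨_, List.mem_map_of_mem hz, S.posProp_of_min (Finset.Subset.refl V)
      (S.isExtremal_sub (hL.sound z hz).1 _).mem hx.1.mem ((hprop z).trans hzx) (hn z).1 hx.2.1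
      (hn z).2 hx.2.2⟩

/-- After all positions around the vertex have been processed, only the link is missing. -/
theorem Represents.append_link (S : IsLinkVector M C₀ V ℓ) (hV : V.Nonempty) (hℓ : compat ℓ ℓ)
    (hL : Represents compat (C₀ ∪ V) (fun x => IsCutRay M C₀ V x ∨ IsCanonicalRay M C₀ V x) L) :
    Represents compat (C₀ ∪ V) (IsExtremal M (C₀ ∪ V)) (L ++ [ℓ]) := by
  have hC : C₀ ⊆ C₀ ∪ V := Finset.subset_union_left
  -- For `P = V` both normalisations ask for minimum 0 over `V`, so the two kinds of rays merge.
  have hcut : ∀ x, IsCutRay M C₀ V x ∨ IsCanonicalRay M C₀ V x → IsCutRay M C₀ V x := by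
    rintro x (h | h)
    exacts [h, S.isCutRay (Finset.Subset.refl V) h.1 h.2.1 h.2.2]
  have hne : ∀ x ∈ L, ¬ PosProp (C₀ ∪ V) x ℓ := by
    intro x hx h
    obtain ⟨i, hi, hxi⟩ := (hcut x (hL.sound x hx).1).2
    exact hxi (h.symm.eq_zero (hC hi) (S.zero i hi))
  have hlink : ∀ x ∈ M, (∀ i ∈ C₀, x i = 0) → ∃ a : ℝ, ∀ i ∈ C₀ ∪ V, x i = a * ℓ i := by
    intro x hx h
    obtain ⟨b, hb⟩ := S.const x hx h
    refine ⟨b, fun i hi => ?_⟩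
    rcases Finset.mem_union.1 hi with hi | hi
    · rw [h i hi, S.zero i hi, mul_zero]
    · rw [hb i hi, S.one i hi, mul_one]
  have hℓn : ∀ i ∈ C₀ ∪ V, 0 ≤ ℓ i := fun i hi => by
    rcases Finset.mem_union.1 hi with hi | hi
    · exact (S.zero i hi).ge
    · rw [S.one i hi]; exact zero_le_one
  obtain ⟨p, hp⟩ := hV
  have hℓe : IsExtremal M (C₀ ∪ V) ℓ := ⟨S.mem, hℓn, ⟨p, Finset.mem_union_right _ hp, by
    rw [S.one p hp]; exact one_ne_zero⟩, fun y hy hys =>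
      hlink y hy fun i hi => hys i (hC hi) (S.zero i hi)⟩
  refine ⟨⟨?_, ?_⟩, ?_, ?_⟩
  · refine List.Nodup.append hL.irredundant.1 (List.nodup_singleton _) ?_
    rw [List.disjoint_left]
    intro x hx hx'
    rw [List.mem_singleton.1 hx'] at hx
    exact hne _ hx (PosProp.refl _ _)
  · intro x hx y hy h
    simp only [List.mem_append, List.mem_singleton] at hx hy
    rcases hx with hx | rfl <;> rcases hy with hy | rfl
    · exact hL.irredundant.2 x hx y hy h
    · exact absurd h (hne x hx)
    · exact absurd h.symm (hne y hy)
    · rfl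
  · intro x hx
    simp only [List.mem_append, List.mem_singleton] at hx
    rcases hx with hx | rfl
    · exact ⟨(hcut x (hL.sound x hx).1).1, (hL.sound x hx).2⟩
    · exact ⟨hℓe, hℓ⟩
  · intro x hx hcx
    by_cases h0 : ∃ i ∈ C₀, x i ≠ 0
    · obtain ⟨z, hz, hzx⟩ := hL.complete x (Or.inl ⟨hx, h0⟩) hcx
      exact ⟨z, List.mem_append_left _ hz, hzx⟩
    · push Not at h0
      exact ⟨ℓ, by simp, (hℓe.posProp hx.mem hx.nonneg hx.ne_zero fun i hi h => by
        rcases Finset.mem_union.1 hi with hi | hi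
        · exact h0 i hi
        · rw [S.one i hi] at h
          exact absurd h one_ne_zero).symm⟩

variable [Fintype ι]

/-- Processing a list of positions; the processed positions are recorded in the first component. -/
def positionFold {K : Type} [Field K] [LinearOrder K] (compat : (ι → K) → (ι → K) → Prop)
    [∀ u w, Decidable (compat u w)] (ps : List ι) (CL : Finset ι × List (ι → K)) :
    Finset ι × List (ι → K) :=
  ps.foldl (fun CL p => (insert p CL.1, positionStep compat CL.1 p CL.2)) CL

theorem positionFold_fst {K : Type} [Field K] [LinearOrder K]
    (compat : (ι → K) → (ι → K) → Prop)
    [∀ u w, Decidable (compat u w)] (ps : List ι) (CL : Finset ι × List (ι → K)) :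
    (positionFold compat ps CL).1 = CL.1 ∪ ps.toFinset := by
  induction ps generalizing CL with
  | nil => simp [positionFold]
  | cons p ps ih =>
    have := ih (insert p CL.1, positionStep compat CL.1 p CL.2)
    simp only [positionFold, List.foldl_cons] at this ⊢
    rw [this]
    ext i
    simp only [Finset.mem_union, Finset.mem_insert, List.toFinset_cons]
    tauto

theorem Represents.positionFold [∀ u w, Decidable (compat u w)] (S : IsLinkVector M C₀ V ℓ)
    (hc : IsSupportCompat C₀ compat) (ps : List ι) (hps : ∀ p ∈ ps, p ∈ V) (hPV : P ⊆ V)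
    (hP : P.Nonempty)
    (hL : Represents compat (C₀ ∪ V) (fun x => IsCutRay M C₀ P x ∨ IsCanonicalRay M C₀ V x) L) :
    Represents compat (C₀ ∪ V)
      (fun x => IsCutRay M C₀ (P ∪ ps.toFinset) x ∨ IsCanonicalRay M C₀ V x)
      (positionFold compat ps (C₀ ∪ P, L)).2 := by
  induction ps generalizing P L with
  | nil => simpa [NormalSurface.positionFold] using hL
  | cons p ps ih =>
    have hp : p ∈ V := hps p List.mem_cons_self
    have := ih (fun q hq => hps q (List.mem_cons_of_mem _ hq)) (Finset.insert_subset hp hPV)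
      (Finset.insert_nonempty p P) (hL.step S hc hPV hP hp)
    have h1 : insert p P ∪ ps.toFinset = P ∪ (p :: ps).toFinset := by
      ext i
      simp only [Finset.mem_union, Finset.mem_insert, List.toFinset_cons]
      tauto
    rw [h1, Finset.union_insert] at this
    exact this

/-- Processing a vertex. -/
theorem Represents.vertex [∀ u w, Decidable (compat u w)] {ps : List ι}
    (S : IsLinkVector M C₀ ps.toFinset ℓ) (hps : ps ≠ [])
    (hc : IsSupportCompat C₀ compat) (hℓ : compat ℓ ℓ)
    (hL : Represents compat C₀ (IsExtremal M C₀) L)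
    (m : (ι → ℝ) → ℝ)
    (hm : ∀ x, (∀ i ∈ ps.toFinset, m x ≤ x i) ∧ ∃ i ∈ ps.toFinset, x i = m x) :
    Represents compat (C₀ ∪ ps.toFinset) (IsExtremal M (C₀ ∪ ps.toFinset))
      ((NormalSurface.positionFold compat ps
        (C₀, (L.map fun x => x - m x • ℓ) ++ [-ℓ])).2 ++ [ℓ]) := by
  refine Represents.append_link S (by simpa using hps) hℓ ?_
  have h1 := hL.canonical S hc m hm
  cases ps with
  | nil => exact absurd rfl hps
  | cons p ps =>
    have hp : p ∈ (p :: ps).toFinset := by simp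
    have := (h1.first_step S hc hp).positionFold S hc ps (fun q hq => by simp [hq])
      (Finset.singleton_subset_iff.2 hp) (Finset.singleton_nonempty p)
    have h2 : {p} ∪ ps.toFinset = (p :: ps).toFinset := by
      rw [List.toFinset_cons, Finset.insert_eq]
    rw [h2, Finset.union_comm C₀ {p}, ← Finset.insert_eq] at this
    exact this

end VertexStep

end NormalSurface

namespace NormalSurface

/-! ### Closed implies exact on a sphere or a disc -/

section FlagMap

/-- The orbits of the group generated by two involutions. -/
def Orb {X : Type} (a b : Equiv.Perm X) : Type := Quot fun x y => y = a x ∨ y = b x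

/-- The orbit of `x`. -/
def Orb.mk {X : Type} (a b : Equiv.Perm X) (x : X) : Orb a b := Quot.mk _ x

theorem Orb.mk_left {X : Type} (a b : Equiv.Perm X) (x : X) : Orb.mk a b (a x) = Orb.mk a b x :=
  (Quot.sound (r := fun x y => y = a x ∨ y = b x) (Or.inl rfl)).symm

theorem Orb.mk_right {X : Type} (a b : Equiv.Perm X) (x : X) : Orb.mk a b (b x) = Orb.mk a b x :=
  (Quot.sound (r := fun x y => y = a x ∨ y = b x) (Or.inr rfl)).symm

/-- A representative of an orbit. -/
noncomputable def Orb.out {X : Type} {a b : Equiv.Perm X} (q : Orb a b) : X := Quot.out q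

theorem Orb.mk_out {X : Type} {a b : Equiv.Perm X} (q : Orb a b) : Orb.mk a b q.out = q :=
  Quot.out_eq q

/-- For involutions, invariance in one direction is invariance in both, so the predicate descends to
the quotient. -/
theorem Orb.pred {X : Type} {a b : Equiv.Perm X} (ha : ∀ x, a (a x) = x) (hb : ∀ x, b (b x) = x)
    (p : X → Prop) (hpa : ∀ x, p x → p (a x)) (hpb : ∀ x, p x → p (b x)) {x y : X}
    (hxy : Orb.mk a b x = Orb.mk a b y) (hx : p x) : p y := by
  have h : ∀ x y, y = a x ∨ y = b x → p x = p y := by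
    rintro x y (rfl | rfl)
    · exact propext ⟨hpa x, fun h => ha x ▸ hpa _ h⟩
    · exact propext ⟨hpb x, fun h => hb x ▸ hpb _ h⟩
  have := congrArg (Quot.lift p h) hxy
  exact this.mp hx

/-- The flags of a surface that is glued from triangles.  The involutions `s` and `r` move a flag
within its triangle, fixing its corner and its side, respectively; `g` passes to the neighbouring
triangle, and fixes the flags at boundary edges. -/
structure FlagMap (X : Type) where
  s : Equiv.Perm X
  r : Equiv.Perm X
  g : Equiv.Perm X
  s_s : ∀ x, s (s x) = x
  r_r : ∀ x, r (r x) = x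
  g_g : ∀ x, g (g x) = x
  s_ne : ∀ x, s x ≠ x
  r_g : ∀ x, r (g x) = g (r x)

namespace FlagMap

variable {X : Type} (S : FlagMap X)

/-- The surface is connected. -/
def Connected : Prop := ∀ p : X → Prop, (∀ x, p x → p (S.s x)) → (∀ x, p x → p (S.r x)) →
  (∀ x, p x → p (S.g x)) → ∀ x y, p x → p y

/-- A point of the surface that is not on the boundary. -/
def InteriorPoint (q : Orb S.s S.g) : Prop := ∀ x, Orb.mk S.s S.g x = q → S.g x ≠ x

/-- An edge of the surface that is not on the boundary. -/
def InteriorArc (q : Orb S.r S.g) : Prop := ∀ x, Orb.mk S.r S.g x = q → S.g x ≠ x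

/-- The rotation around a point. -/
def rot : Equiv.Perm X := S.s * S.g

theorem rot_apply (x : X) : S.rot x = S.s (S.g x) := rfl

theorem mk_rot_zpow (k : ℤ) (x : X) : Orb.mk S.s S.g ((S.rot ^ k) x) = Orb.mk S.s S.g x := by
  have h1 : ∀ x, Orb.mk S.s S.g (S.rot x) = Orb.mk S.s S.g x := fun x => by
    rw [rot_apply, Orb.mk_left, Orb.mk_right]
  have h2 : ∀ (k : ℕ) x, Orb.mk S.s S.g ((S.rot ^ k) x) = Orb.mk S.s S.g x := by
    intro k
    induction k with
    | zero => intro x; rfl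
    | succ k ih => intro x; rw [pow_succ, Equiv.Perm.mul_apply, ih, h1]
  obtain ⟨k, rfl | rfl⟩ := k.eq_nat_or_neg
  · rw [zpow_natCast, h2]
  · rw [← h2 k ((S.rot ^ (-(k : ℤ))) x), zpow_neg, zpow_natCast, ← Equiv.Perm.mul_apply,
      mul_inv_cancel, Equiv.Perm.one_apply]

/-- The dihedral relation: conjugation by `s` inverts `s * g`. -/
theorem s_rot_zpow (k : ℤ) (x : X) : S.s ((S.rot ^ k) x) = (S.rot ^ (-k)) (S.s x) := by
  have h : SemiconjBy S.s S.rot S.rot⁻¹ := by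
    have hs : S.s⁻¹ = S.s := Equiv.ext fun x => by
      rw [Equiv.Perm.inv_eq_iff_eq, S.s_s]
    have hg : S.g⁻¹ = S.g := Equiv.ext fun x => by
      rw [Equiv.Perm.inv_eq_iff_eq, S.g_g]
    refine Equiv.ext fun x => ?_
    rw [rot, mul_inv_rev, hs, hg]
    simp only [Equiv.Perm.mul_apply, S.s_s]
  have := congrArg (fun f : Equiv.Perm X => f x) (h.zpow_right k).eq
  simpa using this

/-- Around an interior point, a rotation never is a reflection. -/
theorem rot_zpow_ne {x : X} (hx : S.InteriorPoint (Orb.mk S.s S.g x)) (k : ℤ) :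
    (S.rot ^ k) x ≠ S.s x := by
  intro h
  -- Halfway round, at `rot ^ m x`, the flag is fixed by `s` if `k = 2 m` and by `g` if `k = 2 m +
  -- 1`. The first never happens, the second not at an interior point.
  obtain ⟨m, rfl | rfl⟩ := k.even_or_odd'
  · have h1 : (S.rot ^ m) x = S.s ((S.rot ^ m) x) := by
      rw [s_rot_zpow, ← h, ← Equiv.Perm.mul_apply, ← zpow_add]
      congr 2
      ring
    exact S.s_ne _ h1.symm
  · have h1 : S.rot ((S.rot ^ m) x) = S.s ((S.rot ^ m) x) := by
      rw [s_rot_zpow, ← h, ← Equiv.Perm.mul_apply, ← Equiv.Perm.mul_apply, ← zpow_one_add,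
        ← zpow_add]
      congr 2
      ring
    rw [rot_apply] at h1
    exact hx _ (S.mk_rot_zpow m x) (S.s.injective h1)

theorem exists_rot_zpow {x y : X} (h : Orb.mk S.s S.g x = Orb.mk S.s S.g y) :
    (∃ k : ℤ, (S.rot ^ k) x = y) ∨ ∃ k : ℤ, (S.rot ^ k) x = S.s y := by
  refine Orb.pred (x := x) S.s_s S.g_g
    (fun y => (∃ k : ℤ, (S.rot ^ k) x = y) ∨ ∃ k : ℤ, (S.rot ^ k) x = S.s y) ?_ ?_ h
    (Or.inl ⟨0, rfl⟩)
  · rintro y (h | h)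
    · exact Or.inr (by rwa [S.s_s])
    · exact Or.inl h
  · rintro y (⟨k, h⟩ | ⟨k, h⟩)
    · exact Or.inr ⟨1 + k, by rw [zpow_one_add, Equiv.Perm.mul_apply, h, rot_apply]⟩
    · refine Or.inl ⟨-1 + k, ?_⟩
      rw [zpow_add, zpow_neg_one, Equiv.Perm.mul_apply, h, Equiv.Perm.inv_eq_iff_eq, rot_apply,
        S.g_g]

open Classical in
/-- A sign that is constant under rotations and changes under reflections. -/
noncomputable def sgn (x : X) : ℝ :=
  if ∃ k : ℤ, (S.rot ^ k) ((Orb.mk S.s S.g x).out) = x then 1 else -1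

theorem sgn_ne_zero (x : X) : S.sgn x ≠ 0 := by
  unfold sgn
  split_ifs <;> norm_num

theorem sgn_s {x : X} (hx : S.InteriorPoint (Orb.mk S.s S.g x)) : S.sgn (S.s x) = -S.sgn x := by
  unfold sgn
  rw [Orb.mk_left]
  by_cases h : ∃ k : ℤ, (S.rot ^ k) ((Orb.mk S.s S.g x).out) = x
  · rw [if_pos h, if_neg]
    rintro ⟨j, hj⟩
    obtain ⟨k, hk⟩ := h
    refine S.rot_zpow_ne hx (j - k) ?_
    rw [← hj, ← congrArg (S.rot ^ (j - k)) hk, ← Equiv.Perm.mul_apply, ← zpow_add, sub_add_cancel]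
  · rw [if_neg h, if_pos ((S.exists_rot_zpow (Orb.mk_out _)).resolve_left h), neg_neg]

theorem sgn_rot (x : X) : S.sgn (S.rot x) = S.sgn x := by
  unfold sgn
  rw [rot_apply, Orb.mk_left, Orb.mk_right]
  congr 1
  refine propext ⟨fun ⟨k, hk⟩ => ⟨-1 + k, ?_⟩, fun ⟨k, hk⟩ => ⟨1 + k, ?_⟩⟩
  · rw [zpow_add, zpow_neg_one, Equiv.Perm.mul_apply, hk, Equiv.Perm.inv_eq_iff_eq, rot_apply]
  · rw [zpow_one_add, Equiv.Perm.mul_apply, hk, rot_apply]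

theorem sgn_g {x : X} (hx : S.InteriorPoint (Orb.mk S.s S.g x)) : S.sgn (S.g x) = -S.sgn x := by
  rw [← S.sgn_rot x, rot_apply, sgn_s, neg_neg]
  rwa [Orb.mk_right]

/-- Functions of the triangles. -/
def triangleFun : Submodule ℝ (X → ℝ) where
  carrier := {t | ∀ x, t (S.s x) = t x ∧ t (S.r x) = t x}
  zero_mem' := fun x => ⟨rfl, rfl⟩
  add_mem' := fun {t t'} h h' x => by simp [h x, h' x]
  smul_mem' := fun c t h x => by simp [h x]

/-- Functions of the points with a local orientation, antisymmetric in the latter. -/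
def pointFun : Submodule ℝ (X → ℝ) where
  carrier := {t | ∀ x, t (S.s x) = -t x ∧ t (S.g x) = -t x}
  zero_mem' := fun x => by simp
  add_mem' := fun {t t'} h h' x => by simp [h x, h' x, add_comm]
  smul_mem' := fun c t h x => by simp [h x]

/-- Functions of the edges with a side, antisymmetric in the latter. -/
def arcFun : Submodule ℝ (X → ℝ) where
  carrier := {t | ∀ x, t (S.r x) = t x ∧ t (S.g x) = -t x}
  zero_mem' := fun x => by simp
  add_mem' := fun {t t'} h h' x => by simp [h x, h' x, add_comm]
  smul_mem' := fun c t h x => by simp [h x]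

/-- The coboundary of a function of the triangles. -/
noncomputable def coboundary : (X → ℝ) →ₗ[ℝ] (X → ℝ) := LinearMap.funLeft ℝ ℝ S.g - LinearMap.id

/-- The boundary of a function of the points of the dual surface. -/
noncomputable def boundary : (X → ℝ) →ₗ[ℝ] (X → ℝ) := LinearMap.id + LinearMap.funLeft ℝ ℝ S.r

theorem coboundary_apply (t : X → ℝ) (x : X) : S.coboundary t x = t (S.g x) - t x := rfl

theorem boundary_apply (t : X → ℝ) (x : X) : S.boundary t x = t x + t (S.r x) := rfl

theorem coboundary_mem {t : X → ℝ} (ht : t ∈ S.triangleFun) : S.coboundary t ∈ S.arcFun := by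
  intro x
  simp only [coboundary_apply, S.g_g, ← S.r_g, (ht _).2, true_and]
  ring

theorem boundary_mem {t : X → ℝ} (ht : t ∈ S.pointFun) : S.boundary t ∈ S.arcFun := by
  intro x
  simp only [boundary_apply, S.r_r, S.r_g, (ht _).2]
  constructor <;> ring

/-- The flags `x` and `r x` belong to the same arc and side, so `b` agrees on them; hence the factor
2. -/
theorem sum_mul_boundary [Fintype X] {b ψ : X → ℝ} (hb : b ∈ S.arcFun) :
    ∑ x, b x * S.boundary ψ x = 2 * ∑ x, b x * ψ x := by
  simp only [boundary_apply, mul_add, Finset.sum_add_distrib]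
  have : ∑ x, b x * ψ (S.r x) = ∑ x, b x * ψ x := by
    rw [← Equiv.sum_comp S.r fun x => b x * ψ x]
    exact Finset.sum_congr rfl fun x _ => by rw [(hb x).1]
  rw [this]
  ring

/-- Under `s` the function `t` is symmetric and `ψ` antisymmetric, so they are orthogonal;
reindexing by `g` gives the same for the shifted sum. With `sum_mul_boundary`, coboundaries are
orthogonal to boundaries. -/
theorem sum_coboundary_mul [Fintype X] {t ψ : X → ℝ} (ht : t ∈ S.triangleFun)
    (hψ : ψ ∈ S.pointFun) : ∑ x, S.coboundary t x * ψ x = 0 := by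
  have h1 : ∑ x, t x * ψ x = 0 := by
    have : ∑ x, t x * ψ x = ∑ x, -(t x * ψ x) := by
      rw [← Equiv.sum_comp S.s fun x => t x * ψ x]
      exact Finset.sum_congr rfl fun x _ => by rw [(ht x).1, (hψ x).1]; ring
    rw [Finset.sum_neg_distrib] at this
    linarith
  have h2 : ∑ x, t (S.g x) * ψ x = 0 := by
    rw [← neg_eq_zero, ← h1, ← Finset.sum_neg_distrib, ← Equiv.sum_comp S.g fun x => t x * ψ x]
    exact Finset.sum_congr rfl fun x _ => by rw [(hψ x).2]; ring
  simp only [coboundary_apply, sub_mul, Finset.sum_sub_distrib, h1, h2, sub_zero]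

/-- The decomposition of functions of the edges. -/
noncomputable def hodge : (S.triangleFun × S.pointFun) →ₗ[ℝ] (X → ℝ) :=
  (S.coboundary.comp S.triangleFun.subtype).coprod (S.boundary.comp S.pointFun.subtype)

theorem hodge_apply (z : S.triangleFun × S.pointFun) :
    S.hodge z = S.coboundary z.1 + S.boundary z.2 := by
  simp [hodge]

variable [Finite X]

instance {X : Type} [Finite X] (a b : Equiv.Perm X) : Finite (Orb a b) :=
  inferInstanceAs (Finite (Quot _))

theorem card_le_finrank_triangleFun :
    Nat.card (Orb S.s S.r) ≤ Module.finrank ℝ S.triangleFun := by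
  classical
  cases nonempty_fintype X
  have := Fintype.ofFinite (Orb S.s S.r)
  let f : (Orb S.s S.r → ℝ) →ₗ[ℝ] S.triangleFun :=
    { toFun := fun φ => ⟨fun x => φ (Orb.mk _ _ x), fun x => by
        simp only [Orb.mk_left, Orb.mk_right, and_self]⟩
      map_add' := fun _ _ => rfl
      map_smul' := fun _ _ => rfl }
  have hf : Function.Injective f := by
    intro φ φ' h
    ext q
    obtain ⟨x, rfl⟩ := Quot.exists_rep q
    exact congrFun (congrArg Subtype.val h) x
  have := LinearMap.finrank_le_finrank_of_injective hf
  rwa [Module.finrank_fintype_fun_eq_card, ← Nat.card_eq_fintype_card] at this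

/-- Each interior point has a local orientation `sgn`, which provides a basis function on its orbit.
-/
theorem card_le_finrank_pointFun :
    Nat.card {q // S.InteriorPoint q} ≤ Module.finrank ℝ S.pointFun := by
  classical
  cases nonempty_fintype X
  have := Fintype.ofFinite (Orb S.s S.g)
  let f : ({q // S.InteriorPoint q} → ℝ) →ₗ[ℝ] S.pointFun :=
    { toFun := fun φ => ⟨fun x => if h : S.InteriorPoint (Orb.mk _ _ x) then
          S.sgn x * φ ⟨_, h⟩ else 0, fun x => by
        simp only [Orb.mk_left, Orb.mk_right]
        split_ifs with h
        · rw [S.sgn_s h, S.sgn_g h]; constructor <;> ring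
        · simp⟩
      map_add' := fun φ φ' => by
        ext x
        simp only [Submodule.coe_add, Pi.add_apply]
        split_ifs
        · ring
        · simp
      map_smul' := fun c φ => by
        ext x
        simp only [SetLike.val_smul, Pi.smul_apply, smul_eq_mul, RingHom.id_apply]
        split_ifs
        · ring
        · simp }
  have hf : Function.Injective f := by
    intro φ φ' h
    ext ⟨q, hq⟩
    obtain ⟨x, rfl⟩ := Quot.exists_rep q
    have h1 := congrFun (congrArg Subtype.val h) x
    have hq' : S.InteriorPoint (Orb.mk _ _ x) := hq
    simp only [f, LinearMap.coe_mk, AddHom.coe_mk, dif_pos hq'] at h1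
    exact mul_left_cancel₀ (S.sgn_ne_zero x) h1
  have := LinearMap.finrank_le_finrank_of_injective hf
  rwa [Module.finrank_fintype_fun_eq_card, ← Nat.card_eq_fintype_card] at this

/-- Antisymmetry under `g` forces the value 0 on a boundary arc, and one value determines the
function on an interior arc. -/
theorem finrank_arcFun_le :
    Module.finrank ℝ S.arcFun ≤ Nat.card {q // S.InteriorArc q} := by
  classical
  cases nonempty_fintype X
  have := Fintype.ofFinite (Orb S.r S.g)
  let f : S.arcFun →ₗ[ℝ] ({q // S.InteriorArc q} → ℝ) :=
    { toFun := fun b q => b.1 (Orb.out q.1)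
      map_add' := fun _ _ => rfl
      map_smul' := fun _ _ => rfl }
  have hf : Function.Injective f := by
    rw [injective_iff_map_eq_zero]
    intro b hb
    have hzero : ∀ x y, Orb.mk S.r S.g x = Orb.mk S.r S.g y → b.1 x = 0 → b.1 y = 0 :=
      fun x y h => Orb.pred S.r_r S.g_g (fun x => b.1 x = 0) (fun x h => by rw [(b.2 x).1, h])
        (fun x h => by rw [(b.2 x).2, h, neg_zero]) h
    ext x
    by_cases h : S.InteriorArc (Orb.mk S.r S.g x)
    · exact hzero ((Orb.mk S.r S.g x).out) x (Orb.mk_out _) (congrFun hb ⟨_, h⟩)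
    · unfold InteriorArc at h
      push Not at h
      obtain ⟨y, hy, hgy⟩ := h
      refine hzero y x hy ?_
      have := (b.2 y).2
      rw [hgy] at this
      linarith
  have := LinearMap.finrank_le_finrank_of_injective hf
  rwa [Module.finrank_fintype_fun_eq_card, ← Nat.card_eq_fintype_card] at this

/-- There are at most as many boundary points as boundary edges. -/
theorem card_boundary_point_le :
    Nat.card {q // ¬ S.InteriorPoint q} ≤ Nat.card {q // ¬ S.InteriorArc q} := by
  classical
  cases nonempty_fintype X
  have := Fintype.ofFinite (Orb S.s S.g)
  have := Fintype.ofFinite (Orb S.r S.g)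
  rw [Nat.card_eq_fintype_card, Nat.card_eq_fintype_card, Fintype.card_subtype,
    Fintype.card_subtype]
  -- Count the flags fixed by `g`. In the orbit of a boundary point their number is even: `s` pairs
  -- off the whole orbit and `g` pairs off the flags it moves. It is positive, hence at least 2. A
  -- boundary arc has at most the two flags `x` and `r x`.
  have h1 : 2 * (Finset.univ.filter fun q => ¬ S.InteriorPoint q).card ≤
      (Finset.univ.filter fun x => S.g x = x).card := by
    refine Finset.mul_card_image_le_card_of_maps_to (f := Orb.mk S.s S.g) ?_ 2 ?_
    · intro x hx
      simp only [Finset.mem_filter, Finset.mem_univ, true_and] at hx ⊢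
      exact fun h => h x rfl hx
    · intro q hq
      replace hq := (Finset.mem_filter.1 hq).2
      unfold InteriorPoint at hq
      push Not at hq
      obtain ⟨x, hx, hgx⟩ := hq
      have hall : ∑ x ∈ Finset.univ.filter (fun x => Orb.mk S.s S.g x = q), (1 : ZMod 2) = 0 :=
        Finset.sum_involution (fun x _ => S.s x) (fun x _ => rfl) (fun x _ _ => S.s_ne x)
          (fun x hx => by simpa [Orb.mk_left] using hx) fun x _ => S.s_s x
      have hmove : ∑ x ∈ (Finset.univ.filter (fun x => Orb.mk S.s S.g x = q)).filter
          (fun x => ¬ S.g x = x), (1 : ZMod 2) = 0 :=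
        Finset.sum_involution (fun x _ => S.g x) (fun x _ => rfl)
          (fun x hx _ => (Finset.mem_filter.1 hx).2)
          (fun x hx => by
            simp only [Finset.mem_filter, Finset.mem_univ, true_and] at hx ⊢
            rw [Orb.mk_right, S.g_g]
            exact ⟨hx.1, fun h => hx.2 h.symm⟩) fun x _ => S.g_g x
      rw [← Finset.sum_filter_add_sum_filter_not _ (fun x => S.g x = x), hmove, add_zero,
        Finset.sum_const, nsmul_one, ZMod.natCast_eq_zero_iff] at hall
      rw [Finset.filter_filter] at hall ⊢
      simp_rw [and_comm (a := S.g _ = _)]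
      refine Nat.le_of_dvd (Finset.card_pos.2 ⟨x, by simp [hx, hgx]⟩) hall
  have h2 : (Finset.univ.filter fun x => S.g x = x).card ≤
      2 * (Finset.univ.filter fun q => ¬ S.InteriorArc q).card := by
    refine Finset.card_le_mul_card_image_of_maps_to (f := Orb.mk S.r S.g) ?_ 2 ?_
    · intro x hx
      simp only [Finset.mem_filter, Finset.mem_univ, true_and] at hx ⊢
      exact fun h => h x rfl hx
    · intro q hq
      replace hq := (Finset.mem_filter.1 hq).2
      unfold InteriorArc at hq
      push Not at hq
      obtain ⟨x, hx, hgx⟩ := hq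
      refine (Finset.card_le_card (t := {x, S.r x}) fun y hy => ?_).trans Finset.card_le_two
      simp only [Finset.mem_filter, Finset.mem_univ, true_and] at hy
      rw [Finset.mem_insert, Finset.mem_singleton]
      refine Orb.pred S.r_r S.g_g (fun y => y = x ∨ y = S.r x) ?_ ?_ (hx.trans hy.2.symm)
        (Or.inl rfl)
      · rintro y (rfl | rfl)
        exacts [Or.inr rfl, Or.inl (S.r_r _)]
      · rintro y (rfl | rfl)
        · exact Or.inl hgx
        · rw [← S.r_g, hgx]; exact Or.inr rfl
  omega

/-- By orthogonality both parts vanish separately. Then `t` is invariant under `s`, `r`, `g` and `ψ`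
changes sign under each of them, so a single zero spreads over the connected surface. -/
theorem eq_zero_of_hodge (hS : S.Connected) {t ψ : X → ℝ} (ht : t ∈ S.triangleFun)
    (hψ : ψ ∈ S.pointFun) (h : S.coboundary t + S.boundary ψ = 0) {x₀ x₁ : X} (ht0 : t x₀ = 0) (hψ0 : ψ x₁ = 0) :
    t = 0 ∧ ψ = 0 := by
  cases nonempty_fintype X
  have h0 : ∑ x, S.coboundary t x * S.boundary ψ x = 0 := by
    rw [S.sum_mul_boundary (S.coboundary_mem ht), S.sum_coboundary_mul ht hψ, mul_zero]
  have hneg : ∀ x, S.boundary ψ x = -S.coboundary t x := fun x => by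
    have := congrFun h x
    rw [Pi.add_apply, Pi.zero_apply] at this
    linarith
  have h1 : ∀ x, S.coboundary t x = 0 := by
    have h2 : ∑ x, S.coboundary t x * S.coboundary t x = 0 := by
      rw [← neg_eq_zero, ← h0, ← Finset.sum_neg_distrib]
      exact Finset.sum_congr rfl fun x _ => by rw [hneg]; ring
    intro x
    exact mul_self_eq_zero.1
      ((Finset.sum_eq_zero_iff_of_nonneg fun x _ => mul_self_nonneg _).1 h2 x (Finset.mem_univ x))
  constructor
  · ext x
    refine hS (fun x => t x = 0) (fun x h => by rw [(ht x).1, h])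
      (fun x h => by rw [(ht x).2, h]) (fun x h => ?_) x₀ x ht0
    have := h1 x
    rw [coboundary_apply] at this
    linarith
  · ext x
    refine hS (fun x => ψ x = 0) (fun x h => by rw [(hψ x).1, h, neg_zero])
      (fun x h => ?_) (fun x h => by rw [(hψ x).2, h, neg_zero]) x₁ x hψ0
    have := hneg x
    rw [h1, neg_zero, boundary_apply] at this
    linarith

theorem finrank_ker_hodge_le_two (hS : S.Connected) [Nonempty X] :
    Module.finrank ℝ (LinearMap.ker S.hodge) ≤ 2 := by
  cases nonempty_fintype X
  obtain ⟨x₀⟩ := ‹Nonempty X›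
  let f : LinearMap.ker S.hodge →ₗ[ℝ] ℝ × ℝ :=
    { toFun := fun z => (z.1.1.1 x₀, z.1.2.1 x₀)
      map_add' := fun _ _ => rfl
      map_smul' := fun _ _ => rfl }
  have hf : Function.Injective f := by
    rw [injective_iff_map_eq_zero]
    rintro ⟨⟨⟨t, ht⟩, ⟨ψ, hψ⟩⟩, hz⟩ h0
    have hz' : S.coboundary t + S.boundary ψ = 0 := by
      rw [LinearMap.mem_ker, hodge_apply] at hz
      exact hz
    obtain ⟨rfl, rfl⟩ := S.eq_zero_of_hodge hS ht hψ hz' (congrArg Prod.fst h0)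
      (congrArg Prod.snd h0)
    rfl
  have := LinearMap.finrank_le_finrank_of_injective hf
  simpa using this

/-- At a boundary flag antisymmetry already gives `ψ = 0`, so only one value of `t` is free. -/
theorem finrank_ker_hodge_le_one (hS : S.Connected) (hb : ∃ x, S.g x = x) :
    Module.finrank ℝ (LinearMap.ker S.hodge) ≤ 1 := by
  cases nonempty_fintype X
  obtain ⟨x₁, hx₁⟩ := hb
  let f : LinearMap.ker S.hodge →ₗ[ℝ] ℝ :=
    { toFun := fun z => z.1.1.1 x₁
      map_add' := fun _ _ => rfl
      map_smul' := fun _ _ => rfl }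
  have hf : Function.Injective f := by
    rw [injective_iff_map_eq_zero]
    rintro ⟨⟨⟨t, ht⟩, ⟨ψ, hψ⟩⟩, hz⟩ h0
    have hz' : S.coboundary t + S.boundary ψ = 0 := by
      rw [LinearMap.mem_ker, hodge_apply] at hz
      exact hz
    have hψ1 : ψ x₁ = 0 := by
      have := (hψ x₁).2
      rw [hx₁] at this
      linarith
    obtain ⟨rfl, rfl⟩ := S.eq_zero_of_hodge hS ht hψ hz' h0 hψ1
    rfl
  have := LinearMap.finrank_le_finrank_of_injective hf
  simpa using this

/-- On a sphere or a disc, an antisymmetric function of the edges that is closed at each interior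
point is a coboundary. -/
theorem exists_coboundary (hS : S.Connected) [Fintype X] [Nonempty X]
    (hχ : Nat.card (Orb S.r S.g) + 2 ≤ Nat.card (Orb S.s S.g) + Nat.card (Orb S.s S.r) ∨
      (∃ x, S.g x = x) ∧
        Nat.card (Orb S.r S.g) + 1 ≤ Nat.card (Orb S.s S.g) + Nat.card (Orb S.s S.r))
    {b : X → ℝ} (hb : b ∈ S.arcFun) (hcl : ∀ ψ ∈ S.pointFun, ∑ x, b x * ψ x = 0) :
    ∃ t ∈ S.triangleFun, ∀ x, b x = t (S.g x) - t x := by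
  have hle : LinearMap.range S.hodge ≤ S.arcFun := by
    rintro _ ⟨z, rfl⟩
    rw [hodge_apply]
    exact S.arcFun.add_mem (S.coboundary_mem z.1.2) (S.boundary_mem z.2.2)
  have hrange : LinearMap.range S.hodge = S.arcFun := by
    classical
    -- The source has dimension at least the number of triangles plus interior points, the target at
    -- most the number of interior arcs. As boundary points do not outnumber boundary arcs, the
    -- difference is at least the Euler characteristic, which is at least the bound on the kernel.
    refine Submodule.eq_of_le_of_finrank_le hle ?_
    have h1 := S.card_le_finrank_triangleFun
    have h2 := S.card_le_finrank_pointFun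
    have h3 := S.finrank_arcFun_le
    have h4 := S.card_boundary_point_le
    have h6 := LinearMap.finrank_range_add_finrank_ker S.hodge
    rw [Module.finrank_prod] at h6
    have h7 : Nat.card (Orb S.s S.g) =
        Nat.card {q // S.InteriorPoint q} + Nat.card {q // ¬ S.InteriorPoint q} := by
      rw [← Nat.card_sum, Nat.card_congr (Equiv.sumCompl S.InteriorPoint)]
    have h8 : Nat.card (Orb S.r S.g) =
        Nat.card {q // S.InteriorArc q} + Nat.card {q // ¬ S.InteriorArc q} := by
      rw [← Nat.card_sum, Nat.card_congr (Equiv.sumCompl S.InteriorArc)]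
    rcases hχ with hχ | ⟨hb, hχ⟩
    · have h5 := S.finrank_ker_hodge_le_two hS
      omega
    · have h5 := S.finrank_ker_hodge_le_one hS hb
      omega
  obtain ⟨⟨⟨t, ht⟩, ⟨ψ, hψ⟩⟩, hz⟩ := hrange.symm ▸ hb
  rw [hodge_apply] at hz
  have hz' : ∀ x, b x = S.coboundary t x + S.boundary ψ x := fun x => congrFun hz.symm x
  refine ⟨t, ht, fun x => ?_⟩
  -- The boundary part is orthogonal to `b` by closedness and to the coboundary part, hence to
  -- itself.
  have h1 : ∑ x, S.boundary ψ x * S.boundary ψ x = 0 := by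
    have h2 := S.sum_mul_boundary (ψ := ψ) hb
    rw [hcl ψ hψ, mul_zero] at h2
    have h3 := S.sum_mul_boundary (ψ := ψ) (S.coboundary_mem ht)
    rw [S.sum_coboundary_mul ht hψ, mul_zero] at h3
    simp only [hz', add_mul, Finset.sum_add_distrib, h3, zero_add] at h2
    exact h2
  have h2 := (Finset.sum_eq_zero_iff_of_nonneg fun x _ => mul_self_nonneg _).1 h1 x
    (Finset.mem_univ x)
  rw [hz' x, mul_self_eq_zero.1 h2, add_zero, coboundary_apply]

end FlagMap

end FlagMap

end NormalSurface

namespace NormalSurface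

/-! ### Sums around a point -/

namespace FlagMap

variable {X : Type} (S : FlagMap X)

theorem eq_zero_of_not_interiorPoint {ψ : X → ℝ} (hψ : ψ ∈ S.pointFun) {x : X}
    (hx : ¬ S.InteriorPoint (Orb.mk S.s S.g x)) : ψ x = 0 := by
  unfold InteriorPoint at hx
  push Not at hx
  obtain ⟨y, hy, hgy⟩ := hx
  refine Orb.pred S.s_s S.g_g (fun x => ψ x = 0) (fun x h => by rw [(hψ x).1, h, neg_zero])
    (fun x h => by rw [(hψ x).2, h, neg_zero]) hy ?_
  have := (hψ y).2
  rw [hgy] at this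
  linarith

/-- A periodic rotation without fixed flags of `g` goes around an interior point. -/
theorem interiorPoint_of_period {x : X} {m : ℕ} (hm : (S.rot ^ m) x = x) (hm0 : 0 < m)
    (h : ∀ i < m, S.g ((S.rot ^ i) x) ≠ (S.rot ^ i) x) :
    S.InteriorPoint (Orb.mk S.s S.g x) := by
  have hpre : ∀ z, ∀ i < m, S.rot z = (S.rot ^ i) x → ∃ j < m, z = (S.rot ^ j) x := by
    intro z i hi hz
    rcases i with - | i
    · refine ⟨m - 1, by omega, S.rot.injective ?_⟩
      rw [hz, ← Equiv.Perm.mul_apply, ← pow_succ', Nat.sub_add_cancel hm0, hm, pow_zero,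
        Equiv.Perm.one_apply]
    · refine ⟨i, by omega, S.rot.injective ?_⟩
      rw [hz, pow_succ', Equiv.Perm.mul_apply]
  have hsg : ∀ y, ∀ i < m, S.s y = (S.rot ^ i) x → ∃ j < m, S.g y = (S.rot ^ j) x :=
    fun y i hi hy => hpre _ i hi (by rw [rot_apply, S.g_g, hy])
  have hcl : ∀ y, Orb.mk S.s S.g x = Orb.mk S.s S.g y →
      (∃ i < m, y = (S.rot ^ i) x) ∨ ∃ i < m, S.s y = (S.rot ^ i) x := by
    intro y hy
    refine Orb.pred S.s_s S.g_g
      (fun y => (∃ i < m, y = (S.rot ^ i) x) ∨ ∃ i < m, S.s y = (S.rot ^ i) x) ?_ ?_ hy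
      (Or.inl ⟨0, hm0, rfl⟩)
    · rintro y (h | h)
      · exact Or.inr (by rwa [S.s_s])
      · exact Or.inl h
    · rintro y (⟨i, hi, rfl⟩ | ⟨i, hi, hy⟩)
      · right
        rw [← rot_apply, ← Equiv.Perm.mul_apply, ← pow_succ']
        rcases Nat.lt_or_ge (i + 1) m with h1 | h1
        · exact ⟨i + 1, h1, rfl⟩
        · have : i + 1 = m := by omega
          exact ⟨0, hm0, by rw [this, hm, pow_zero, Equiv.Perm.one_apply]⟩
      · exact Or.inl (hsg y i hi hy)
  intro y hy hgy
  rcases hcl y hy.symm with ⟨i, hi, rfl⟩ | ⟨i, hi, hsy⟩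
  · exact h i hi hgy
  · obtain ⟨j, hj, hj'⟩ := hsg y i hi hsy
    rw [hgy] at hj'
    subst hj'
    exact h j hj hgy

variable [Finite X]

open Classical in
noncomputable instance {X : Type} [Finite X] (f : Equiv.Perm X) :
    Fintype (Subgroup.zpowers f) := Fintype.ofFinite _

/-- The sum of `ω` over all rotations of a flag. -/
noncomputable def orbitSum (ω : X → ℝ) (x : X) : ℝ :=
  ∑ h : Subgroup.zpowers S.rot, ω ((h : Equiv.Perm X) x)

/-- Summing over the whole cyclic group makes invariance a change of variable, without reference to
the length of the cycle of `x`. -/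
theorem orbitSum_rot (ω : X → ℝ) (x : X) : S.orbitSum ω (S.rot x) = S.orbitSum ω x :=
  Equiv.sum_comp (Equiv.mulRight (⟨S.rot, Subgroup.mem_zpowers S.rot⟩ : Subgroup.zpowers S.rot))
    fun h => ω ((h : Equiv.Perm X) x)

theorem orbitSum_s {ω : X → ℝ} (hω : ∀ x, ω (S.s x) = -ω x) (x : X) :
    S.orbitSum ω (S.s x) = -S.orbitSum ω x := by
  unfold orbitSum
  rw [← Equiv.sum_comp (Equiv.inv (Subgroup.zpowers S.rot)), ← Finset.sum_neg_distrib]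
  refine Finset.sum_congr rfl fun h _ => ?_
  obtain ⟨h, k, rfl⟩ := h
  rw [← hω]
  show ω ((S.rot ^ k)⁻¹ (S.s x)) = ω (S.s ((S.rot ^ k) x))
  rw [s_rot_zpow, zpow_neg]

theorem orbitSum_g {ω : X → ℝ} (hω : ∀ x, ω (S.s x) = -ω x) (x : X) :
    S.orbitSum ω (S.g x) = -S.orbitSum ω x := by
  rw [← S.orbitSum_rot ω x, rot_apply, S.orbitSum_s hω, neg_neg]

theorem orbitSum_commute {ω : X → ℝ} (f : Equiv.Perm X) (hf : Commute f S.rot)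
    (hω : ∀ x, ω (f x) = -ω x) (x : X) : S.orbitSum ω (f x) = -S.orbitSum ω x := by
  unfold orbitSum
  rw [← Finset.sum_neg_distrib]
  refine Finset.sum_congr rfl fun h _ => ?_
  obtain ⟨h, k, rfl⟩ := h
  rw [← hω]
  exact congrArg ω (congrArg (fun e : Equiv.Perm X => e x) (hf.zpow_right k).eq).symm

/-- A double count over group elements and `i < m`: a sum over a period does not depend on where it
starts. This links the group sum to the sum over the cycle found by walking around an edge. -/
theorem orbitSum_period (ω : X → ℝ) {x : X} {m : ℕ} (hm : (S.rot ^ m) x = x) :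
    m * S.orbitSum ω x =
      Fintype.card (Subgroup.zpowers S.rot) * ∑ i ∈ Finset.range m, ω ((S.rot ^ i) x) := by
  have hshift : ∀ y, (S.rot ^ m) y = y →
      ∑ i ∈ Finset.range m, ω ((S.rot ^ i) (S.rot y)) =
        ∑ i ∈ Finset.range m, ω ((S.rot ^ i) y) := by
    intro y hy
    have h1 := Finset.sum_range_succ (fun i => ω ((S.rot ^ i) y)) m
    rw [Finset.sum_range_succ', hy, pow_zero, Equiv.Perm.one_apply] at h1
    simp only [pow_succ, Equiv.Perm.mul_apply] at h1
    linarith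
  have hpow : ∀ k : ℕ, (S.rot ^ m) ((S.rot ^ k) x) = (S.rot ^ k) x ∧
      ∑ i ∈ Finset.range m, ω ((S.rot ^ i) ((S.rot ^ k) x)) =
        ∑ i ∈ Finset.range m, ω ((S.rot ^ i) x) := by
    intro k
    induction k with
    | zero => exact ⟨hm, rfl⟩
    | succ k ih =>
      rw [pow_succ', Equiv.Perm.mul_apply, hshift _ ih.1, ih.2]
      refine ⟨?_, rfl⟩
      rw [← Equiv.Perm.mul_apply, ← pow_succ, pow_succ', Equiv.Perm.mul_apply, ih.1]
  have h1 : ∑ i ∈ Finset.range m, S.orbitSum ω ((S.rot ^ i) x) = m * S.orbitSum ω x := by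
    have : ∀ i, S.orbitSum ω ((S.rot ^ i) x) = S.orbitSum ω x := by
      intro i
      induction i with
      | zero => rfl
      | succ i ih => rw [pow_succ', Equiv.Perm.mul_apply, orbitSum_rot, ih]
    simp [this]
  rw [← h1]
  unfold orbitSum
  rw [Finset.sum_comm]
  have h2 : ∀ h : Subgroup.zpowers S.rot, ∑ i ∈ Finset.range m, ω ((h : Equiv.Perm X)
      ((S.rot ^ i) x)) = ∑ i ∈ Finset.range m, ω ((S.rot ^ i) x) := by
    rintro ⟨h, hh⟩
    obtain ⟨k, rfl⟩ := mem_powers_iff_mem_zpowers.2 hh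
    rw [← (hpow k).2]
    refine Finset.sum_congr rfl fun i _ => ?_
    show ω ((S.rot ^ k) ((S.rot ^ i) x)) = _
    rw [← Equiv.Perm.mul_apply, ← Equiv.Perm.mul_apply, ← pow_add, ← pow_add, add_comm]
  simp only [h2, Finset.sum_const, Finset.card_univ, nsmul_eq_mul]

/-- Since `ψ` is invariant under rotations, summing `ω` over rotations only multiplies the pairing
by the order of the group. That sum vanishes at interior points, and `ψ` vanishes at all others. -/
theorem sum_mul_eq_zero [Fintype X] {ω ψ : X → ℝ} (hψ : ψ ∈ S.pointFun)
    (hω : ∀ x, S.InteriorPoint (Orb.mk S.s S.g x) → S.orbitSum ω x = 0) :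
    ∑ x, ψ x * ω x = 0 := by
  have hrot : ∀ k : ℤ, ∀ x, ψ ((S.rot ^ k) x) = ψ x := by
    have h1 : ∀ x, ψ (S.rot x) = ψ x := fun x => by
      rw [rot_apply, (hψ _).1, (hψ _).2, neg_neg]
    have h2 : ∀ k : ℕ, ∀ x, ψ ((S.rot ^ k) x) = ψ x := by
      intro k
      induction k with
      | zero => intro x; rfl
      | succ k ih => intro x; rw [pow_succ', Equiv.Perm.mul_apply, h1, ih]
    intro k x
    obtain ⟨k, rfl | rfl⟩ := k.eq_nat_or_neg
    · rw [zpow_natCast, h2]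
    · rw [← h2 k ((S.rot ^ (-(k : ℤ))) x), zpow_neg, zpow_natCast, ← Equiv.Perm.mul_apply,
        mul_inv_cancel, Equiv.Perm.one_apply]
  have h1 : ∑ x, ψ x * S.orbitSum ω x = 0 := Finset.sum_eq_zero fun x _ => by
    by_cases hx : S.InteriorPoint (Orb.mk S.s S.g x)
    · rw [hω x hx, mul_zero]
    · rw [S.eq_zero_of_not_interiorPoint hψ hx, zero_mul]
  have h2 : ∑ x, ψ x * S.orbitSum ω x =
      Fintype.card (Subgroup.zpowers S.rot) * ∑ x, ψ x * ω x := by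
    unfold orbitSum
    simp only [Finset.mul_sum]
    rw [Finset.sum_comm]
    have : ∀ h : Subgroup.zpowers S.rot, ∑ x, ψ x * ω ((h : Equiv.Perm X) x) = ∑ x, ψ x * ω x := by
      rintro ⟨h, k, rfl⟩
      rw [← Equiv.sum_comp (S.rot ^ k) fun x => ψ x * ω x]
      exact Finset.sum_congr rfl fun x _ => by rw [hrot]
    simp only [this, Finset.sum_const, Finset.card_univ, nsmul_eq_mul, Finset.mul_sum]
  rw [h1] at h2
  exact (mul_eq_zero.1 h2.symm).resolve_left (by exact_mod_cast Fintype.card_ne_zero)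

end FlagMap

/-! ### Flags of the tetrahedra and cycles around edges -/

section Flags

variable {n : ℕ} (T : Triangulation n)

/-- The flag on the other side of a face. -/
def Triangulation.glueFlag (x : Flag n) : Flag n :=
  match T.glue x.1 (x.2 2) with
  | none => x
  | some jσ => (jσ.1, jσ.2 * x.2)

theorem Triangulation.glueFlag_of_none {x : Flag n} (h : T.glue x.1 (x.2 2) = none) :
    T.glueFlag x = x := by
  unfold glueFlag
  rw [h]

theorem Triangulation.glueFlag_of_some {x : Flag n} {j : Fin n} {σ : Equiv.Perm (Fin 4)}
    (h : T.glue x.1 (x.2 2) = some (j, σ)) : T.glueFlag x = (j, σ * x.2) := by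
  unfold glueFlag
  rw [h]

theorem Triangulation.glueFlag_glueFlag (x : Flag n) : T.glueFlag (T.glueFlag x) = x := by
  rcases h : T.glue x.1 (x.2 2) with - | ⟨j, σ⟩
  · rw [T.glueFlag_of_none h, T.glueFlag_of_none h]
  · rw [T.glueFlag_of_some h, T.glueFlag_of_some (x := (j, σ * x.2))
      (T.glue_symm x.1 (x.2 2) j σ h), inv_mul_cancel_left]

/-- Only a face glued to itself by the identity could fix a flag, and `glue_ne_self` excludes this.
-/
theorem Triangulation.glueFlag_eq_self_iff (x : Flag n) :
    T.glueFlag x = x ↔ T.glue x.1 (x.2 2) = none := by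
  refine ⟨fun hx => ?_, T.glueFlag_of_none⟩
  rcases h : T.glue x.1 (x.2 2) with - | ⟨j, σ⟩
  · rfl
  · exfalso
    rw [T.glueFlag_of_some h] at hx
    have h1 : j = x.1 := congrArg Prod.fst hx
    have h2 : σ * x.2 = x.2 := congrArg Prod.snd hx
    have h3 : σ = 1 := mul_eq_right.1 h2
    exact T.glue_ne_self _ _ _ _ h (by rw [h1, h3, Equiv.Perm.one_apply])

/-- Multiplication of flags by a permutation. -/
def flagMul (τ : Equiv.Perm (Fin 4)) (hτ : τ * τ = 1) : Equiv.Perm (Flag n) :=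
  Function.Involutive.toPerm (fun x => (x.1, x.2 * τ)) fun x => by
    simp [mul_assoc, hτ]

theorem flagMul_apply (τ : Equiv.Perm (Fin 4)) (hτ : τ * τ = 1) (x : Flag n) :
    flagMul τ hτ x = (x.1, x.2 * τ) := rfl

/-- The flags of the tetrahedra of `T`, which are the flags of all its vertex links. -/
def Triangulation.flagMap : FlagMap (Flag n) where
  s := flagMul (Equiv.swap 2 3) (Equiv.swap_mul_self 2 3)
  r := flagMul (Equiv.swap 1 3) (Equiv.swap_mul_self 1 3)
  g := Function.Involutive.toPerm T.glueFlag T.glueFlag_glueFlag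
  s_s x := by simp [flagMul_apply, mul_assoc]
  r_r x := by simp [flagMul_apply, mul_assoc]
  g_g := T.glueFlag_glueFlag
  s_ne x h := by
    have h1 : x.2 * Equiv.swap 2 3 = x.2 := congrArg Prod.snd h
    have h2 : (Equiv.swap 2 3 : Equiv.Perm (Fin 4)) = 1 := mul_eq_left.1 h1
    exact absurd h2 (by decide)
  r_g x := by
    have h0 : (x.2 * Equiv.swap 1 3 : Equiv.Perm (Fin 4)) 2 = x.2 2 := by
      rw [Equiv.Perm.mul_apply, show (Equiv.swap 1 3 : Equiv.Perm (Fin 4)) 2 = 2 by decide]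
    show flagMul _ _ (T.glueFlag x) = T.glueFlag (x.1, x.2 * Equiv.swap 1 3)
    rcases h : T.glue x.1 (x.2 2) with - | ⟨j, σ⟩
    · rw [T.glueFlag_of_none h, T.glueFlag_of_none (x := (x.1, x.2 * Equiv.swap 1 3)) (by
        rw [h0]; exact h)]
      rfl
    · rw [T.glueFlag_of_some h, T.glueFlag_of_some (x := (x.1, x.2 * Equiv.swap 1 3))
        (by rw [h0]; exact h)]
      rfl

namespace Triangulation

theorem flagMap_s (x : Flag n) : T.flagMap.s x = (x.1, x.2 * Equiv.swap 2 3) := rfl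

theorem flagMap_r (x : Flag n) : T.flagMap.r x = (x.1, x.2 * Equiv.swap 1 3) := rfl

theorem flagMap_g (x : Flag n) : T.flagMap.g x = T.glueFlag x := rfl

/-- Walking around an edge is rotating about a point of the vertex link. -/
theorem next_eq (x : Flag n) :
    T.next x = if T.flagMap.g x = x then none else some (T.flagMap.rot x) := by
  rcases h : T.glue x.1 (x.2 2) with - | ⟨j, σ⟩
  · rw [if_pos (show T.flagMap.g x = x from T.glueFlag_of_none h)]
    simp [next, h]
  · rw [if_neg (show ¬ T.flagMap.g x = x from fun h' => by
        rw [(T.glueFlag_eq_self_iff x).1 h'] at h; simp at h),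
      FlagMap.rot_apply, flagMap_g, T.glueFlag_of_some h, flagMap_s]
    simp [next, h]

theorem walk_eq_some {p : Flag n} : ∀ {k : ℕ} {q : Flag n} {l : List (Flag n)},
    T.walk p k q = some l → ∃ m > 0, l = (List.range m).map (fun i => (T.flagMap.rot ^ i) q) ∧
      (T.flagMap.rot ^ m) q = p ∧
      ∀ i < m, T.flagMap.g ((T.flagMap.rot ^ i) q) ≠ (T.flagMap.rot ^ i) q := by
  intro k
  induction k with
  | zero => intro q l h; simp [walk] at h
  | succ k ih =>
    intro q l h
    rw [walk, next_eq] at h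
    split_ifs at h with hg
    · simp only at h
      split_ifs at h with hp
      · refine ⟨1, one_pos, ?_, by simpa using hp, fun i hi => ?_⟩
        · simpa using (Option.some.inj h).symm
        · have : i = 0 := by omega
          subst this
          exact hg
      · obtain ⟨l', hl', rfl⟩ := Option.map_eq_some_iff.1 h
        obtain ⟨m, hm, rfl, hm', hmg⟩ := ih hl'
        refine ⟨m + 1, by omega, ?_, ?_, fun i hi => ?_⟩
        · rw [List.range_succ_eq_map, List.map_cons, List.map_map]
          simp [Function.comp_def, pow_succ]
        · rw [pow_succ, Equiv.Perm.mul_apply, hm']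
        · rcases i with - | i
          · exact hg
          · rw [pow_succ, Equiv.Perm.mul_apply]
            exact hmg i (by omega)

theorem walk_isSome {p : Flag n} : ∀ {k : ℕ} {q : Flag n} {m : ℕ}, 0 < m → m ≤ k →
    (T.flagMap.rot ^ m) q = p →
    (∀ i : ℕ, T.flagMap.g ((T.flagMap.rot ^ i) q) ≠ (T.flagMap.rot ^ i) q) →
    (T.walk p k q).isSome := by
  intro k
  induction k with
  | zero => intro q m h1 h2; omega
  | succ k ih =>
    intro q m h1 h2 hm hg
    rw [walk, next_eq, if_neg (show T.flagMap.g q ≠ q from hg 0)]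
    simp only
    split_ifs with hp
    · rfl
    · rw [Option.isSome_map]
      rcases m with - | - | m
      · omega
      · rw [zero_add, pow_one] at hm
        exact absurd hm hp
      · refine ih (m := m + 1) (by omega) (by omega) ?_ fun i => ?_
        · rw [← hm, pow_succ _ (m + 1), Equiv.Perm.mul_apply]
        · have := hg (i + 1)
          rwa [pow_succ, Equiv.Perm.mul_apply] at this

theorem card_flag : Fintype.card (Flag n) = 24 * n := by
  rw [Fintype.card_prod, Fintype.card_fin, Fintype.card_perm, Fintype.card_fin, mul_comm]
  rfl

theorem interiorEdge_iff (p : Flag n) :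
    T.InteriorEdge p ↔ T.flagMap.InteriorPoint (Orb.mk _ _ p) := by
  constructor
  · intro h
    obtain ⟨l, hl⟩ := Option.isSome_iff_exists.1 h
    obtain ⟨m, hm, -, hm', hmg⟩ := T.walk_eq_some hl
    exact T.flagMap.interiorPoint_of_period hm' hm hmg
  · intro h
    -- The minimal period is at most the number `24 n` of flags, which is the number of steps
    -- granted to the walk.
    have hper : 0 < Function.minimalPeriod T.flagMap.rot p :=
      Function.minimalPeriod_pos_of_mem_periodicPts
        (Function.Injective.mem_periodicPts T.flagMap.rot.injective p)
    refine T.walk_isSome hper (Function.minimalPeriod_le_card.trans card_flag.le) ?_ fun i => ?_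
    · rw [← Equiv.Perm.iterate_eq_pow]
      exact Function.iterate_minimalPeriod
    · refine h _ ?_
      rw [← zpow_natCast]
      exact T.flagMap.mk_rot_zpow i p

end Triangulation

/-- The quadrilateral type that meets the exit face of a flag in an arc around its lower end. -/
def flagQuad (x : Flag n) : QuadCoord n := (x.1, quadType (x.2 0) (x.2 2))

/-- The contribution of a flag to the matching equation of its edge. -/
def flagForm {K : Type} [Field K] (q : QuadCoord n → K) (x : Flag n) : K :=
  q (flagQuad (x.1, x.2 * Equiv.swap 2 3)) - q (flagQuad x)

namespace Triangulation

theorem flagForm_s (q : QuadCoord n → ℝ) (x : Flag n) :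
    flagForm q (T.flagMap.s x) = -flagForm q x := by
  simp [flagForm, flagMap_s, mul_assoc]

theorem edgeForm_eq_sum {K : Type} [Field K] {p : Flag n} (hp : T.InteriorEdge p) :
    ∃ m > 0, (T.flagMap.rot ^ m) p = p ∧ ∀ q : QuadCoord n → K,
      T.edgeForm p q = ∑ i ∈ Finset.range m, flagForm q ((T.flagMap.rot ^ i) p) := by
  obtain ⟨l, hl⟩ := Option.isSome_iff_exists.1 hp
  obtain ⟨m, hm, h, hm', -⟩ := T.walk_eq_some hl
  refine ⟨m, hm, hm', fun q => ?_⟩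
  rw [edgeForm, hl, Option.getD_some, h, List.map_map]
  rfl

theorem edgeForm_eq_zero_iff {p : Flag n} (hp : T.InteriorEdge p) (q : QuadCoord n → ℝ) :
    T.edgeForm p q = 0 ↔ T.flagMap.orbitSum (flagForm q) p = 0 := by
  obtain ⟨m, hm, hm', h⟩ := T.edgeForm_eq_sum (K := ℝ) hp
  have h1 := T.flagMap.orbitSum_period (flagForm q) hm'
  rw [← h q] at h1
  have h2 : (m : ℝ) ≠ 0 := by exact_mod_cast hm.ne'
  have h3 : (Fintype.card (Subgroup.zpowers T.flagMap.rot) : ℝ) ≠ 0 := by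
    exact_mod_cast Fintype.card_ne_zero
  constructor
  · intro h0
    rw [h0, mul_zero] at h1
    exact (mul_eq_zero.1 h1).resolve_left h2
  · intro h0
    rw [h0, mul_zero] at h1
    exact (mul_eq_zero.1 h1.symm).resolve_left h3

/-- A solution of the quadrilateral matching equations is closed on the vertex links. -/
theorem sum_quad_eq_zero {q : QuadCoord n → ℝ} (hq : T.QuadMatching q) {ψ : Flag n → ℝ}
    (hψ : ψ ∈ T.flagMap.pointFun) :
    ∑ x, (q (flagQuad x) - q (flagQuad (T.flagMap.g x))) * ψ x = 0 := by
  have h1 := T.flagMap.sum_mul_eq_zero (ω := flagForm q) hψ fun x hx => by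
    have := (T.interiorEdge_iff x).2 hx
    exact (T.edgeForm_eq_zero_iff this q).1 (hq x this)
  -- Antisymmetry of `ψ` under `s` and under `g` reduces the pairing with `flagForm` and the pairing
  -- with the jumps to multiples of the same sum.
  have h2 : ∑ x, ψ x * q (flagQuad (T.flagMap.s x)) = -∑ x, ψ x * q (flagQuad x) := by
    rw [← Equiv.sum_comp T.flagMap.s fun x => ψ x * q (flagQuad x), ← Finset.sum_neg_distrib]
    exact Finset.sum_congr rfl fun x _ => by rw [(hψ x).1]; ring
  have h3 : ∑ x, ψ x * q (flagQuad (T.flagMap.g x)) = -∑ x, ψ x * q (flagQuad x) := by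
    rw [← Equiv.sum_comp T.flagMap.g fun x => ψ x * q (flagQuad x), ← Finset.sum_neg_distrib]
    exact Finset.sum_congr rfl fun x _ => by rw [(hψ x).2]; ring
  have h4 : ∑ x, ψ x * flagForm q x =
      ∑ x, ψ x * q (flagQuad (T.flagMap.s x)) - ∑ x, ψ x * q (flagQuad x) := by
    rw [← Finset.sum_sub_distrib]
    exact Finset.sum_congr rfl fun x _ => mul_sub _ _ _
  have h5 : ∑ x, (q (flagQuad x) - q (flagQuad (T.flagMap.g x))) * ψ x =
      ∑ x, ψ x * q (flagQuad x) - ∑ x, ψ x * q (flagQuad (T.flagMap.g x)) := by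
    rw [← Finset.sum_sub_distrib]
    exact Finset.sum_congr rfl fun x _ => by ring
  rw [h5, h3]
  rw [h4, h2] at h1
  linarith

end Triangulation

end Flags

end NormalSurface

namespace NormalSurface

/-! ### Identification classes as orbits of flags, and the matching equations -/

section FlagClasses

theorem perm_of_zero : ∀ τ : Equiv.Perm (Fin 4), τ 0 = 0 → τ = 1 ∨ τ = Equiv.swap 2 3 ∨
    τ = Equiv.swap 1 3 ∨ τ = Equiv.swap 2 3 * Equiv.swap 1 3 ∨
    τ = Equiv.swap 1 3 * Equiv.swap 2 3 ∨
    τ = Equiv.swap 2 3 * Equiv.swap 1 3 * Equiv.swap 2 3 := by decide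

theorem perm_of_zero_two : ∀ τ : Equiv.Perm (Fin 4), τ 0 = 0 → τ 2 = 2 →
    τ = 1 ∨ τ = Equiv.swap 1 3 := by decide

theorem perm_of_zero_one : ∀ τ : Equiv.Perm (Fin 4), τ 0 = 0 → τ 1 = 1 →
    τ = 1 ∨ τ = Equiv.swap 2 3 := by decide

theorem exists_perm_zero_two : ∀ v f : Fin 4, v ≠ f →
    ∃ τ : Equiv.Perm (Fin 4), τ 0 = v ∧ τ 2 = f := by decide

theorem exists_perm_zero_one : ∀ v f : Fin 4, v ≠ f →
    ∃ τ : Equiv.Perm (Fin 4), τ 0 = v ∧ τ 1 = f := by decide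

theorem perm_three_eq : ∀ τ : Equiv.Perm (Fin 4), ∀ f, f ≠ τ 0 → f ≠ τ 1 → τ 2 ≠ f → τ 3 = f := by
  decide

theorem perm_inv_apply {α : Type} (σ : Equiv.Perm α) (x : α) : σ⁻¹ (σ x) = x :=
  σ.symm_apply_apply x

theorem eqvGen_pred {α : Type} {r : α → α → Prop} (hr : ∀ a b, r a b → r b a) {p : α → Prop}
    (h : ∀ a b, r a b → p a → p b) {a b : α} (hab : Relation.EqvGen r a b) : p a ↔ p b := by
  induction hab with
  | rel a b hab => exact ⟨h a b hab, h b a (hr a b hab)⟩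
  | refl a => rfl
  | symm a b _ ih => exact ih.symm
  | trans a b c _ _ ih ih' => exact ih.trans ih'

variable {n : ℕ} (T : Triangulation n)

/-- The corner at the lower end of a flag. -/
def flagCorner (x : Flag n) : Corner n := (x.1, x.2 0)

/-- The directed edge of a flag. -/
def flagEdge (x : Flag n) : DirEdge n := (x.1, x.2 0, x.2 1)

/-- The arc of a flag, in its exit face. -/
def flagArc (x : Flag n) : Arc n := (x.1, x.2 0, x.2 2)

namespace Triangulation

theorem flagCorner_s (x : Flag n) : flagCorner (T.flagMap.s x) = flagCorner x := by
  simp [flagCorner, flagMap_s, show (Equiv.swap 2 3 : Equiv.Perm (Fin 4)) 0 = 0 by decide]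

theorem flagCorner_r (x : Flag n) : flagCorner (T.flagMap.r x) = flagCorner x := by
  simp [flagCorner, flagMap_r, show (Equiv.swap 1 3 : Equiv.Perm (Fin 4)) 0 = 0 by decide]

theorem flagEdge_s (x : Flag n) : flagEdge (T.flagMap.s x) = flagEdge x := by
  simp [flagEdge, flagMap_s, show (Equiv.swap 2 3 : Equiv.Perm (Fin 4)) 0 = 0 by decide,
    show (Equiv.swap 2 3 : Equiv.Perm (Fin 4)) 1 = 1 by decide]

theorem flagArc_r (x : Flag n) : flagArc (T.flagMap.r x) = flagArc x := by
  simp [flagArc, flagMap_r, show (Equiv.swap 1 3 : Equiv.Perm (Fin 4)) 0 = 0 by decide,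
    show (Equiv.swap 1 3 : Equiv.Perm (Fin 4)) 2 = 2 by decide]

theorem flagQuad_r (x : Flag n) : flagQuad (T.flagMap.r x) = flagQuad x :=
  congrArg (fun a : Arc n => (a.1, quadType a.2.1 a.2.2)) (T.flagArc_r x)

theorem flagMap_g_of_some {x : Flag n} {j : Fin n} {σ : Equiv.Perm (Fin 4)}
    (h : T.glue x.1 (x.2 2) = some (j, σ)) : T.flagMap.g x = (j, σ * x.2) := T.glueFlag_of_some h

theorem flag_eq_of_mul {x y : Flag n} (h : x.1 = y.1) {τ : Equiv.Perm (Fin 4)}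
    (hτ : x.2⁻¹ * y.2 = τ) : y = (x.1, x.2 * τ) := by
  rw [← hτ, mul_inv_cancel_left, h]

/-- The transpositions `(2 3)` and `(1 3)` generate the permutations that fix 0, so the six flags at
a corner form one orbit. -/
theorem pred_of_flagCorner {p : Flag n → Prop} (hs : ∀ x, p x → p (T.flagMap.s x))
    (hr : ∀ x, p x → p (T.flagMap.r x)) {x y : Flag n} (h : flagCorner x = flagCorner y)
    (hx : p x) : p y := by
  have h1 : x.1 = y.1 := congrArg (fun d : Corner n => d.1) h
  have h2 : x.2 0 = y.2 0 := congrArg (fun d : Corner n => d.2) h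
  have h3 := perm_of_zero (x.2⁻¹ * y.2) (by
    rw [Equiv.Perm.mul_apply, ← h2, ← Equiv.Perm.mul_apply, inv_mul_cancel, Equiv.Perm.one_apply])
  rcases h3 with h3 | h3 | h3 | h3 | h3 | h3 <;> rw [flag_eq_of_mul h1 h3]
  · rwa [mul_one]
  · exact hs _ hx
  · exact hr _ hx
  · exact hr _ (hs _ hx)
  · exact hs _ (hr _ hx)
  · exact hs _ (hr _ (hs _ hx))

theorem eq_or_eq_of_flagEdge {x y : Flag n} (h : flagEdge x = flagEdge y) :
    y = x ∨ y = T.flagMap.s x := by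
  have h1 : x.1 = y.1 := congrArg (fun d : DirEdge n => d.1) h
  have h2 : x.2 0 = y.2 0 := congrArg (fun e => e.2.1) h
  have h2' : x.2 1 = y.2 1 := congrArg (fun e => e.2.2) h
  have h3 := perm_of_zero_one (x.2⁻¹ * y.2) (by
    rw [Equiv.Perm.mul_apply, ← h2, ← Equiv.Perm.mul_apply, inv_mul_cancel, Equiv.Perm.one_apply])
    (by rw [Equiv.Perm.mul_apply, ← h2', ← Equiv.Perm.mul_apply, inv_mul_cancel,
      Equiv.Perm.one_apply])
  rcases h3 with h3 | h3
  · left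
    rw [flag_eq_of_mul h1 h3, mul_one]
  · exact Or.inr (flag_eq_of_mul h1 h3)

theorem eq_or_eq_of_flagArc {x y : Flag n} (h : flagArc x = flagArc y) :
    y = x ∨ y = T.flagMap.r x := by
  have h1 : x.1 = y.1 := congrArg (fun d : Arc n => d.1) h
  have h2 : x.2 0 = y.2 0 := congrArg (fun e => e.2.1) h
  have h2' : x.2 2 = y.2 2 := congrArg (fun e => e.2.2) h
  have h3 := perm_of_zero_two (x.2⁻¹ * y.2) (by
    rw [Equiv.Perm.mul_apply, ← h2, ← Equiv.Perm.mul_apply, inv_mul_cancel, Equiv.Perm.one_apply])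
    (by rw [Equiv.Perm.mul_apply, ← h2', ← Equiv.Perm.mul_apply, inv_mul_cancel,
      Equiv.Perm.one_apply])
  rcases h3 with h3 | h3
  · left
    rw [flag_eq_of_mul h1 h3, mul_one]
  · exact Or.inr (flag_eq_of_mul h1 h3)

theorem cornerStep_symm (d e : Corner n) (h : T.CornerStep d e) : T.CornerStep e d := by
  obtain ⟨f, σ, hf, hg, he⟩ := h
  refine ⟨σ f, σ⁻¹, fun h => hf (σ.injective (h.trans he)), T.glue_symm _ _ _ _ hg, ?_⟩
  rw [he, perm_inv_apply]

theorem dirEdgeStep_symm (d e : DirEdge n) (h : T.DirEdgeStep d e) : T.DirEdgeStep e d := by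
  obtain ⟨f, σ, hf, hf', hg, he⟩ := h
  refine ⟨σ f, σ⁻¹, fun h => hf (σ.injective (h.trans (by rw [he]))),
    fun h => hf' (σ.injective (h.trans (by rw [he]))), T.glue_symm _ _ _ _ hg, ?_⟩
  rw [he, perm_inv_apply, perm_inv_apply]

theorem arcStep_symm (d e : Arc n) (h : T.ArcStep d e) : T.ArcStep e d := by
  obtain ⟨σ, hg, he⟩ := h
  refine ⟨σ⁻¹, by rw [he]; exact T.glue_symm _ _ _ _ hg, ?_⟩
  rw [he, perm_inv_apply, perm_inv_apply]

theorem pred_of_sameVertex {p : Flag n → Prop} (hs : ∀ x, p x → p (T.flagMap.s x))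
    (hr : ∀ x, p x → p (T.flagMap.r x)) (hg : ∀ x, p x → p (T.flagMap.g x)) {x y : Flag n}
    (h : T.SameVertex (flagCorner x) (flagCorner y)) (hx : p x) : p y := by
  refine (eqvGen_pred T.cornerStep_symm (p := fun d => ∀ y, flagCorner y = d → p y) ?_ h).1
    (fun z hz => T.pred_of_flagCorner hs hr hz.symm hx) y rfl
  intro d e hde hd z hz
  obtain ⟨f, σ, hf, hgl, he⟩ := hde
  obtain ⟨τ, hτ0, hτ2⟩ := exists_perm_zero_two d.2 f (Ne.symm hf)
  have h1 := hg _ (hd (d.1, τ) (by rw [flagCorner, hτ0]))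
  rw [T.flagMap_g_of_some (x := (d.1, τ)) (by rw [hτ2]; exact hgl)] at h1
  refine T.pred_of_flagCorner hs hr ?_ h1
  rw [hz, flagCorner, Equiv.Perm.mul_apply, hτ0, ← he]

theorem pred_of_sameDirEdge {p : Flag n → Prop} (hs : ∀ x, p x → p (T.flagMap.s x))
    (hg : ∀ x, p x → p (T.flagMap.g x)) {x y : Flag n}
    (h : T.SameDirEdge (flagEdge x) (flagEdge y)) (hx : p x) : p y := by
  have hs' : ∀ {x y : Flag n}, flagEdge x = flagEdge y → p x → p y := fun {x y} h hx => by
    rcases T.eq_or_eq_of_flagEdge h with rfl | rfl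
    exacts [hx, hs _ hx]
  refine (eqvGen_pred T.dirEdgeStep_symm (p := fun d => ∀ y, flagEdge y = d → p y) ?_ h).1
    (fun z hz => hs' hz.symm hx) y rfl
  intro d e hde hd z hz
  obtain ⟨f, σ, hf, hf', hgl, he⟩ := T.dirEdgeStep_symm d e hde
  have key : ∀ z : Flag n, flagEdge z = e → z.2 2 = f → p z := by
    intro z hz hz2
    have h0 : e.2.1 = z.2 0 := by rw [← hz]; rfl
    have h1 : e.2.2 = z.2 1 := by rw [← hz]; rfl
    have h2 : e.1 = z.1 := by rw [← hz]; rfl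
    rw [← T.flagMap.g_g z]
    refine hg _ (hd _ ?_)
    rw [T.flagMap_g_of_some (x := z) (by rw [hz2, ← h2]; exact hgl)]
    exact Prod.ext rfl (by rw [he, h0, h1]; rfl)
  by_cases hz2 : z.2 2 = f
  · exact key z hz hz2
  · have hz3 : z.2 3 = f := perm_three_eq z.2 f (by rw [← hz] at hf; exact hf)
      (by rw [← hz] at hf'; exact hf') hz2
    rw [← T.flagMap.s_s z]
    refine hs _ (key _ (by rw [flagEdge_s, hz]) ?_)
    rw [flagMap_s, Equiv.Perm.mul_apply, Equiv.swap_apply_left, hz3]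

theorem pred_of_sameArc {p : Flag n → Prop} (hr : ∀ x, p x → p (T.flagMap.r x))
    (hg : ∀ x, p x → p (T.flagMap.g x)) {x y : Flag n}
    (h : Relation.EqvGen T.ArcStep (flagArc x) (flagArc y)) (hx : p x) : p y := by
  refine (eqvGen_pred T.arcStep_symm (p := fun d => ∀ y, flagArc y = d → p y) ?_ h).1
    (fun z hz => ?_) y rfl
  · intro d e hde hd z hz
    obtain ⟨σ, hgl, he⟩ := T.arcStep_symm d e hde
    subst hz
    rw [← T.flagMap.g_g z]
    refine hg _ (hd _ ?_)
    rw [T.flagMap_g_of_some (x := z) hgl]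
    exact Prod.ext rfl (by rw [he]; rfl)
  · rcases T.eq_or_eq_of_flagArc hz.symm with rfl | rfl
    exacts [hx, hr _ hx]

theorem flagEdge_g (x : Flag n) :
    T.flagMap.g x = x ∨ T.DirEdgeStep (flagEdge x) (flagEdge (T.flagMap.g x)) := by
  rcases h : T.glue x.1 (x.2 2) with - | ⟨j, σ⟩
  · exact Or.inl (T.glueFlag_of_none h)
  · rw [T.flagMap_g_of_some h]
    exact Or.inr ⟨x.2 2, σ, x.2.injective.ne (by decide), x.2.injective.ne (by decide), h, rfl⟩

theorem flagCorner_g (x : Flag n) : T.SameVertex (flagCorner x) (flagCorner (T.flagMap.g x)) := by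
  rcases h : T.glue x.1 (x.2 2) with - | ⟨j, σ⟩
  · rw [show T.flagMap.g x = x from T.glueFlag_of_none h]
    exact Relation.EqvGen.refl _
  · rw [T.flagMap_g_of_some h]
    exact Relation.EqvGen.rel _ _ ⟨x.2 2, σ, x.2.injective.ne (by decide), h, rfl⟩

/-! ### The quadrilateral matching equations -/

theorem quadType_perm : ∀ π : Equiv.Perm (Fin 4), quadType (π 1) (π 2) = quadType (π 0) (π 3) ∧
    quadType (π 1) (π 3) = quadType (π 0) (π 2) := by decide

/-- Exchanging the ends of the edge of a flag. -/
def flip : Equiv.Perm (Flag n) := flagMul (Equiv.swap 0 1) (Equiv.swap_mul_self 0 1)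

theorem flip_apply (x : Flag n) : flip x = (x.1, x.2 * Equiv.swap 0 1) := rfl

theorem flip_s (x : Flag n) : flip (T.flagMap.s x) = T.flagMap.s (flip x) := by
  rw [flip_apply, flip_apply, flagMap_s, flagMap_s, mul_assoc, mul_assoc,
    show (Equiv.swap 2 3 * Equiv.swap 0 1 : Equiv.Perm (Fin 4)) =
      Equiv.swap 0 1 * Equiv.swap 2 3 by decide]

theorem flip_g (x : Flag n) : flip (T.flagMap.g x) = T.flagMap.g (flip x) := by
  have h0 : (flip x).2 2 = x.2 2 := by
    rw [flip_apply, Equiv.Perm.mul_apply,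
      show (Equiv.swap 0 1 : Equiv.Perm (Fin 4)) 2 = 2 by decide]
  rcases h : T.glue x.1 (x.2 2) with - | ⟨j, σ⟩
  · rw [show T.flagMap.g x = x from T.glueFlag_of_none h,
      show T.flagMap.g (flip x) = flip x from T.glueFlag_of_none (by rw [h0]; exact h)]
  · rw [T.flagMap_g_of_some h, T.flagMap_g_of_some (x := flip x) (by rw [h0]; exact h)]
    rfl

/-- Exchanging the upper and lower ends of the edge exchanges the rising and the falling types. -/
theorem flagForm_flip (q : QuadCoord n → ℝ) (x : Flag n) :
    flagForm q (flip x) = -flagForm q x := by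
  simp only [flagForm, flagQuad, flip_apply, Equiv.Perm.mul_apply, Equiv.swap_apply_left,
    show (Equiv.swap 0 1 : Equiv.Perm (Fin 4)) 2 = 2 by decide,
    show (Equiv.swap 2 3 : Equiv.Perm (Fin 4)) 0 = 0 by decide,
    show (Equiv.swap 0 1 : Equiv.Perm (Fin 4)) 3 = 3 by decide, quadType_perm]
  ring

theorem orbitSum_flip (q : QuadCoord n → ℝ) (x : Flag n) :
    T.flagMap.orbitSum (flagForm q) (flip x) = -T.flagMap.orbitSum (flagForm q) x := by
  refine T.flagMap.orbitSum_commute flip (Equiv.ext fun x => ?_) (flagForm_flip q) x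
  rw [Equiv.Perm.mul_apply, Equiv.Perm.mul_apply, FlagMap.rot_apply, FlagMap.rot_apply, flip_s,
    flip_g]

/-- The matching equation of an edge depends on the edge only. -/
theorem edgeForm_eq_zero_of_sameEdge {p p' : Flag n} (h : T.SameEdge p p')
    (hp : T.InteriorEdge p) (hp' : T.InteriorEdge p') {q : QuadCoord n → ℝ}
    (h0 : T.edgeForm p q = 0) : T.edgeForm p' q = 0 := by
  rw [T.edgeForm_eq_zero_iff hp']
  rw [T.edgeForm_eq_zero_iff hp] at h0
  have key : ∀ y, T.SameDirEdge (flagEdge p) (flagEdge y) →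
      T.flagMap.orbitSum (flagForm q) y = 0 := fun y hy =>
    T.pred_of_sameDirEdge (p := fun y => T.flagMap.orbitSum (flagForm q) y = 0)
      (fun x hx => by rw [T.flagMap.orbitSum_s (T.flagForm_s q), hx, neg_zero])
      (fun x hx => by rw [T.flagMap.orbitSum_g (T.flagForm_s q), hx, neg_zero]) hy h0
  rcases h with h | h
  · exact key p' h
  · have := key (flip p') (by
      simpa [flagEdge, flip_apply] using h)
    rw [T.orbitSum_flip] at this
    linarith

theorem quadMatching_iff {edges : List (Flag n)} (hedges : T.IsInteriorEdgeList edges)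
    (q : QuadCoord n → ℝ) : T.QuadMatching q ↔ ∀ p ∈ edges, T.edgeForm p q = 0 := by
  refine ⟨fun h p hp => h p (hedges.interior p hp), fun h p hp => ?_⟩
  obtain ⟨p', hp', hs⟩ := hedges.complete p hp
  refine T.edgeForm_eq_zero_of_sameEdge ?_ (hedges.interior p' hp') hp (h p' hp')
  rcases hs with hs | hs
  · exact Or.inl (Relation.EqvGen.symm _ _ hs)
  · right
    have hf : ∀ d e : DirEdge n, T.SameDirEdge d e →
        T.SameDirEdge (d.1, d.2.2, d.2.1) (e.1, e.2.2, e.2.1) := by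
      intro d e hde
      induction hde with
      | rel d e hde =>
        obtain ⟨f, σ, hf, hf', hg, he⟩ := hde
        exact Relation.EqvGen.rel _ _ ⟨f, σ, hf', hf, hg, by simp [he]⟩
      | refl d => exact Relation.EqvGen.refl _
      | symm d e _ ih => exact Relation.EqvGen.symm _ _ ih
      | trans d e f _ _ ih ih' => exact Relation.EqvGen.trans _ _ _ ih ih'
    exact Relation.EqvGen.symm _ _ (hf _ _ hs)

/-- The sum of the two coordinates that meet the exit face in the arc of the flag. -/
def arcSum (x : StdCoord n → ℝ) (y : Flag n) : ℝ :=
  x (y.1, Sum.inl (y.2 0)) + x (y.1, Sum.inr (quadType (y.2 0) (y.2 2)))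

theorem arcSum_g {x : StdCoord n → ℝ} (hx : T.StdMatching x) (y : Flag n) :
    arcSum x (T.flagMap.g y) = arcSum x y := by
  rcases h : T.glue y.1 (y.2 2) with - | ⟨j, σ⟩
  · rw [show T.flagMap.g y = y from T.glueFlag_of_none h]
  · rw [T.flagMap_g_of_some h]
    exact (hx _ _ _ _ h (y.2 0) (y.2.injective.ne (by decide))).symm

/-- The quadrilateral part of a solution of the standard matching equations solves the
quadrilateral matching equations. -/
theorem StdMatching.quadMatching {T : Triangulation n} {x : StdCoord n → ℝ}
    (hx : T.StdMatching x) : T.QuadMatching (quadProj x) := by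
  intro p hp
  rw [T.edgeForm_eq_zero_iff hp]
  -- The flags `y` and `s y` have the same corner, so the triangular coordinates cancel. By
  -- invariance of `arcSum` under `g`, this is a difference along the rotation, and its sum over the
  -- group telescopes.
  have h1 : ∀ y, flagForm (quadProj x) y = arcSum x (T.flagMap.s y) - arcSum x y := by
    intro y
    have h2 := congrArg Prod.snd (T.flagCorner_s y)
    simp only [flagCorner, flagMap_s] at h2
    simp only [arcSum, flagForm, quadProj, flagQuad, flagMap_s, h2]
    ring
  have h2 : ∀ y, arcSum x (T.flagMap.s y) = arcSum x (T.flagMap.rot⁻¹ y) := by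
    intro y
    obtain ⟨z, rfl⟩ := T.flagMap.rot.surjective y
    rw [perm_inv_apply, FlagMap.rot_apply, T.flagMap.s_s, T.arcSum_g hx]
  unfold FlagMap.orbitSum
  simp only [h1, Finset.sum_sub_distrib, h2]
  rw [sub_eq_zero]
  exact Equiv.sum_comp (Equiv.mulLeft
    (⟨T.flagMap.rot⁻¹, inv_mem (Subgroup.mem_zpowers T.flagMap.rot)⟩ :
      Subgroup.zpowers T.flagMap.rot)) fun h => arcSum x ((h : Equiv.Perm (Flag n)) p)

end Triangulation

end FlagClasses

end NormalSurface

/-! ### Vertex links and the existence of triangular coordinates -/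

namespace NormalSurface

/-- The restriction of a flag map to an invariant set of flags. -/
def FlagMap.restrict {X : Type} (S : FlagMap X) (p : X → Prop) (hs : ∀ x, p (S.s x) ↔ p x)
    (hr : ∀ x, p (S.r x) ↔ p x) (hg : ∀ x, p (S.g x) ↔ p x) : FlagMap {x // p x} where
  s := S.s.subtypePerm hs
  r := S.r.subtypePerm hr
  g := S.g.subtypePerm hg
  s_s x := Subtype.ext (S.s_s x)
  r_r x := Subtype.ext (S.r_r x)
  g_g x := Subtype.ext (S.g_g x)
  s_ne x h := S.s_ne x (congrArg Subtype.val h)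
  r_g x := Subtype.ext (S.r_g x)

section Link

variable {n : ℕ} (T : Triangulation n)

namespace Triangulation

/-- The flags of the link of the vertex containing the corner `c`. -/
abbrev LinkFlag (c : Corner n) : Type := {x : Flag n // T.SameVertex c (flagCorner x)}

/-- The link of the vertex containing the corner `c`. -/
def linkMap (c : Corner n) : FlagMap (T.LinkFlag c) :=
  T.flagMap.restrict (fun x => T.SameVertex c (flagCorner x))
    (fun x => by rw [flagCorner_s]) (fun x => by rw [flagCorner_r]) fun x =>
      ⟨fun h => Relation.EqvGen.trans _ _ _ h (Relation.EqvGen.symm _ _ (T.flagCorner_g x)),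
        fun h => Relation.EqvGen.trans _ _ _ h (T.flagCorner_g x)⟩

theorem linkMap_s (c : Corner n) (x : T.LinkFlag c) :
    ((T.linkMap c).s x : Flag n) = T.flagMap.s x := rfl

theorem linkMap_r (c : Corner n) (x : T.LinkFlag c) :
    ((T.linkMap c).r x : Flag n) = T.flagMap.r x := rfl

theorem linkMap_g (c : Corner n) (x : T.LinkFlag c) :
    ((T.linkMap c).g x : Flag n) = T.flagMap.g x := rfl

/-- A property of link flags, extended to all flags. -/
theorem linkPred_step {c : Corner n} {p : T.LinkFlag c → Prop} {f : Equiv.Perm (T.LinkFlag c)}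
    {f' : Equiv.Perm (Flag n)} (hf : ∀ x, (f x : Flag n) = f' x) (h : ∀ x, p x → p (f x))
    (x : Flag n) (hx : ∃ h, p ⟨x, h⟩) : ∃ h, p ⟨f' x, h⟩ := by
  obtain ⟨hc, hp⟩ := hx
  have h1 := h _ hp
  have h2 := hf ⟨x, hc⟩
  have h3 : T.SameVertex c (flagCorner (f' x)) := h2 ▸ (f ⟨x, hc⟩).2
  refine ⟨h3, ?_⟩
  rwa [show f ⟨x, hc⟩ = ⟨f' x, h3⟩ from Subtype.ext h2] at h1

theorem linkMap_connected (c : Corner n) : (T.linkMap c).Connected := by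
  intro p hs hr hg x y hx
  obtain ⟨_, h⟩ := T.pred_of_sameVertex (p := fun x => ∃ h, p ⟨x, h⟩)
    (T.linkPred_step (T.linkMap_s c) hs) (T.linkPred_step (T.linkMap_r c) hr)
    (T.linkPred_step (T.linkMap_g c) hg)
    (Relation.EqvGen.trans _ _ _ (Relation.EqvGen.symm _ _ x.2) y.2) ⟨x.2, hx⟩
  exact h

theorem eq_of_flagCorner {c : Corner n} {t : T.LinkFlag c → ℝ}
    (ht : t ∈ (T.linkMap c).triangleFun) {x y : T.LinkFlag c}
    (h : flagCorner (x : Flag n) = flagCorner (y : Flag n)) : t y = t x := by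
  obtain ⟨_, h⟩ := T.pred_of_flagCorner (p := fun z => ∃ h, t ⟨z, h⟩ = t x)
    (T.linkPred_step (p := fun z => t z = t x) (T.linkMap_s c) fun z hz => by rw [(ht z).1, hz])
    (T.linkPred_step (p := fun z => t z = t x) (T.linkMap_r c) fun z hz => by rw [(ht z).2, hz])
    h ⟨x.2, rfl⟩
  exact h

/-- Only inequalities are needed, in the directions that bound the Euler characteristic of the flag
map from below. For triangles and points it suffices that every class contains a flag. -/
theorem ncard_corner_le (c : Corner n) : Set.ncard {d | T.SameVertex c d} ≤
    Nat.card (Orb (T.linkMap c).s (T.linkMap c).r) := by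
  let f : Orb (T.linkMap c).s (T.linkMap c).r → Corner n :=
    Quot.lift (fun x => flagCorner (x : Flag n)) (by
      rintro x y (rfl | rfl)
      · exact (T.flagCorner_s x).symm
      · exact (T.flagCorner_r x).symm)
  refine (Set.ncard_le_ncard (t := Set.range f) ?_).trans ?_
  · intro d hd
    obtain ⟨τ, hτ, -⟩ := exists_perm_zero_two d.2 (d.2 + 1) (by simp)
    have h : flagCorner ((d.1, τ) : Flag n) = d := by rw [flagCorner, hτ]
    exact ⟨Orb.mk _ _ ⟨(d.1, τ), by rw [h]; exact hd⟩, h⟩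
  · rw [← Nat.card_coe_set_eq]
    exact Finite.card_range_le f

theorem numClasses_dirEdge_le (c : Corner n) :
    numClasses T.DirEdgeStep {d | d.2.1 ≠ d.2.2 ∧ T.SameVertex c (d.1, d.2.1)} ≤
      Nat.card (Orb (T.linkMap c).s (T.linkMap c).g) := by
  let f : Orb (T.linkMap c).s (T.linkMap c).g → Set (DirEdge n) :=
    Quot.lift (fun x => {b | T.SameDirEdge (flagEdge (x : Flag n)) b}) (by
      rintro x y (rfl | rfl)
      · simp only [linkMap_s, flagEdge_s]
      · rcases T.flagEdge_g x with h | h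
        · simp only [linkMap_g, h]
        · ext b
          simp only [linkMap_g, Set.mem_ofPred_eq]
          exact ⟨fun hb => Relation.EqvGen.trans _ _ _
            (Relation.EqvGen.symm _ _ (Relation.EqvGen.rel _ _ h)) hb,
            fun hb => Relation.EqvGen.trans _ _ _ (Relation.EqvGen.rel _ _ h) hb⟩)
  refine (Set.ncard_le_ncard (t := Set.range f) ?_).trans ?_
  · rintro _ ⟨d, ⟨hd, hc⟩, rfl⟩
    obtain ⟨τ, hτ, hτ'⟩ := exists_perm_zero_one _ _ hd
    have h : flagEdge ((d.1, τ) : Flag n) = d := by rw [flagEdge, hτ, hτ']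
    refine ⟨Orb.mk _ _ ⟨(d.1, τ), by rw [flagCorner, hτ]; exact hc⟩, ?_⟩
    show {b | T.SameDirEdge (flagEdge ((d.1, τ) : Flag n)) b} = _
    rw [h]
    rfl
  · rw [← Nat.card_coe_set_eq]
    exact Finite.card_range_le f

theorem flagArc_g (x : Flag n) :
    T.flagMap.g x = x ∨ T.ArcStep (flagArc x) (flagArc (T.flagMap.g x)) := by
  rcases h : T.glue x.1 (x.2 2) with - | ⟨j, σ⟩
  · exact Or.inl (T.glueFlag_of_none h)
  · rw [T.flagMap_g_of_some h]
    exact Or.inr ⟨σ, h, rfl⟩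

/-- Here the bound goes the other way: identified arcs must have their flags in the same orbit. -/
theorem card_arc_le (c : Corner n) : Nat.card (Orb (T.linkMap c).r (T.linkMap c).g) ≤
    numClasses T.ArcStep {a | a.2.1 ≠ a.2.2 ∧ T.SameVertex c (a.1, a.2.1)} := by
  have hg : ∀ x : Flag n, Relation.EqvGen T.ArcStep (flagArc x) (flagArc (T.flagMap.g x)) := by
    intro x
    rcases T.flagArc_g x with h | h
    · rw [h]; exact Relation.EqvGen.refl _
    · exact Relation.EqvGen.rel _ _ h
  let f : Orb (T.linkMap c).r (T.linkMap c).g → {S : Set (Arc n) |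
      ∃ a ∈ {a : Arc n | a.2.1 ≠ a.2.2 ∧ T.SameVertex c (a.1, a.2.1)},
        S = {b | Relation.EqvGen T.ArcStep a b}} :=
    Quot.lift (fun x => ⟨{b | Relation.EqvGen T.ArcStep (flagArc (x : Flag n)) b},
      flagArc (x : Flag n), ⟨(x : Flag n).2.injective.ne (by decide), x.2⟩, rfl⟩) (by
      rintro x y (rfl | rfl)
      · simp only [linkMap_r, flagArc_r]
      · refine Subtype.ext (Set.ext fun b => ?_)
        simp only [linkMap_g, Set.mem_ofPred_eq]
        exact ⟨fun hb => Relation.EqvGen.trans _ _ _ (Relation.EqvGen.symm _ _ (hg x)) hb,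
            fun hb => Relation.EqvGen.trans _ _ _ (hg x) hb⟩)
  have hf : Function.Injective f := by
    intro q q' h
    obtain ⟨x, rfl⟩ := Quot.exists_rep q
    obtain ⟨y, rfl⟩ := Quot.exists_rep q'
    have h1 : {b | Relation.EqvGen T.ArcStep (flagArc (x : Flag n)) b} =
      {b | Relation.EqvGen T.ArcStep (flagArc (y : Flag n)) b} := congrArg Subtype.val h
    have h2 : flagArc (y : Flag n) ∈ {b | Relation.EqvGen T.ArcStep (flagArc (x : Flag n)) b} := by
      rw [h1]; exact Relation.EqvGen.refl _
    obtain ⟨_, h3⟩ := T.pred_of_sameArc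
      (p := fun z => ∃ h, Orb.mk (T.linkMap c).r (T.linkMap c).g ⟨z, h⟩ = Orb.mk _ _ x)
      (T.linkPred_step (p := fun z => Orb.mk _ _ z = Orb.mk _ _ x) (T.linkMap_r c)
        fun z hz => by rw [Orb.mk_left, hz])
      (T.linkPred_step (p := fun z => Orb.mk _ _ z = Orb.mk _ _ x) (T.linkMap_g c)
        fun z hz => by rw [Orb.mk_right, hz]) h2 ⟨x.2, rfl⟩
    exact h3.symm
  rw [numClasses, ← Nat.card_coe_set_eq]
  exact Nat.card_le_card_of_injective f hf

/-- Around each vertex, a solution of the quadrilateral matching equations extends to a solution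
of the standard matching equations. -/
theorem exists_triangle_coords (hT : T.IsCompactManifold) (c : Corner n) {q : QuadCoord n → ℝ}
    (hq : T.QuadMatching q) : ∃ t : Corner n → ℝ, ∀ i f j σ v, T.SameVertex c (i, v) →
      T.glue i f = some (j, σ) → v ≠ f →
      t (i, v) + q (i, quadType v f) = t (j, σ v) + q (j, quadType (σ v) (σ f)) := by
  classical
  have hne : Nonempty (T.LinkFlag c) := by
    obtain ⟨τ, hτ, -⟩ := exists_perm_zero_two c.2 (c.2 + 1) (by simp)
    exact ⟨(c.1, τ), by rw [flagCorner, hτ]; exact Relation.EqvGen.refl _⟩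
  have hχ := hT.link_sphere_or_disc c
  unfold linkEulerChar at hχ
  have h1 := T.ncard_corner_le c
  have h2 := T.numClasses_dirEdge_le c
  have h3 := T.card_arc_le c
  have hχ' : Nat.card (Orb (T.linkMap c).r (T.linkMap c).g) + 2 ≤
      Nat.card (Orb (T.linkMap c).s (T.linkMap c).g) +
        Nat.card (Orb (T.linkMap c).s (T.linkMap c).r) ∨
      (∃ x, (T.linkMap c).g x = x) ∧ Nat.card (Orb (T.linkMap c).r (T.linkMap c).g) + 1 ≤
        Nat.card (Orb (T.linkMap c).s (T.linkMap c).g) +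
          Nat.card (Orb (T.linkMap c).s (T.linkMap c).r) := by
    rcases hχ with ⟨-, hχ⟩ | ⟨⟨d, f, hd, hf, hg⟩, hχ⟩
    · left
      omega
    · right
      constructor
      · obtain ⟨τ, hτ, hτ'⟩ := exists_perm_zero_two d.2 f (Ne.symm hf)
        refine ⟨⟨(d.1, τ), by rw [flagCorner, hτ]; exact hd⟩, Subtype.ext ?_⟩
        exact T.glueFlag_of_none (x := (d.1, τ)) (by rw [hτ']; exact hg)
      · omega
  -- The matching equations prescribe `b` as the jump of the triangular coordinate across each arc.
  let b : T.LinkFlag c → ℝ := fun x => q (flagQuad (x : Flag n)) - q (flagQuad (T.flagMap.g x))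
  have hb : b ∈ (T.linkMap c).arcFun := by
    intro x
    constructor
    · simp only [b, linkMap_r, flagQuad_r, ← T.flagMap.r_g]
    · simp only [b, linkMap_g, T.flagMap.g_g]
      ring
  have hcl : ∀ ψ ∈ (T.linkMap c).pointFun, ∑ x, b x * ψ x = 0 := by
    intro ψ hψ
    -- Closedness is known on the union of all links, so `ψ` is extended by zero to the other links.
    let ψ' : Flag n → ℝ := fun x => if h : T.SameVertex c (flagCorner x) then ψ ⟨x, h⟩ else 0
    have hmem : ψ' ∈ T.flagMap.pointFun := by
      intro x
      by_cases h : T.SameVertex c (flagCorner x)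
      · have hs := ((T.linkMap c).s ⟨x, h⟩).2
        have hg := ((T.linkMap c).g ⟨x, h⟩).2
        rw [linkMap_s] at hs
        rw [linkMap_g] at hg
        simp only [ψ', dif_pos h, dif_pos hs, dif_pos hg]
        exact hψ ⟨x, h⟩
      · have hs : ¬ T.SameVertex c (flagCorner (T.flagMap.s x)) := by rwa [flagCorner_s]
        have hg : ¬ T.SameVertex c (flagCorner (T.flagMap.g x)) := fun hg =>
          h (Relation.EqvGen.trans _ _ _ hg (Relation.EqvGen.symm _ _ (T.flagCorner_g x)))
        simp only [ψ', dif_neg h, dif_neg hs, dif_neg hg, neg_zero, and_self]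
    have h4 := T.sum_quad_eq_zero hq hmem
    rw [← Fintype.sum_subtype_add_sum_subtype (fun x => T.SameVertex c (flagCorner x))] at h4
    have h5 : ∑ x : {x // ¬ T.SameVertex c (flagCorner x)},
        (q (flagQuad (x : Flag n)) - q (flagQuad (T.flagMap.g x))) * ψ' x = 0 :=
      Finset.sum_eq_zero fun x _ => by simp only [ψ', dif_neg x.2, mul_zero]
    rw [h5, add_zero] at h4
    rw [← h4]
    exact Finset.sum_congr rfl fun x _ => by simp only [ψ', dif_pos x.2, b]
  obtain ⟨t, ht, htb⟩ := (T.linkMap c).exists_coboundary (T.linkMap_connected c) hχ' hb hcl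
  let t' : Corner n → ℝ := fun d =>
    if h : ∃ x : T.LinkFlag c, flagCorner (x : Flag n) = d then t h.choose else 0
  have ht' : ∀ x : T.LinkFlag c, t' (flagCorner (x : Flag n)) = t x := by
    intro x
    have h : ∃ y : T.LinkFlag c, flagCorner (y : Flag n) = flagCorner (x : Flag n) := ⟨x, rfl⟩
    simp only [t', dif_pos h]
    exact T.eq_of_flagCorner ht h.choose_spec.symm
  refine ⟨t', fun i f j σ v hv hgl hvf => ?_⟩
  obtain ⟨τ, hτ, hτ'⟩ := exists_perm_zero_two v f hvf
  have hx : T.SameVertex c (flagCorner ((i, τ) : Flag n)) := by rw [flagCorner, hτ]; exact hv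
  have hgx : T.flagMap.g (i, τ) = (j, σ * τ) :=
    T.flagMap_g_of_some (x := (i, τ)) (by rw [hτ']; exact hgl)
  have h6 := htb ⟨(i, τ), hx⟩
  rw [← ht', ← ht', linkMap_g] at h6
  simp only [b, hgx, flagQuad, flagCorner, Equiv.Perm.mul_apply, hτ, hτ'] at h6
  linarith

end Triangulation

end Link

end NormalSurface

namespace NormalSurface

/-! ### Correctness of the depth-first search -/

namespace Triangulation

variable {n : ℕ} (T : Triangulation n)

/-- Each matching equation involves corners of one class only, so the solutions on the separate
links can be put together, using one representative per class. -/
theorem exists_triangle_coords_all (hT : T.IsCompactManifold) {q : QuadCoord n → ℝ}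
    (hq : T.QuadMatching q) : ∃ t : Corner n → ℝ, ∀ i f j σ v, T.glue i f = some (j, σ) → v ≠ f →
      t (i, v) + q (i, quadType v f) = t (j, σ v) + q (j, quadType (σ v) (σ f)) := by
  choose t ht using fun c => T.exists_triangle_coords hT c hq
  let S : Setoid (Corner n) := Relation.EqvGen.setoid T.CornerStep
  let rep : Corner n → Corner n := fun d => (Quotient.mk S d).out
  refine ⟨fun d => t (rep d) d, fun i f j σ v h hv => ?_⟩
  have h1 : T.SameVertex (i, v) (j, σ v) := Relation.EqvGen.rel _ _ ⟨f, σ, hv.symm, h, rfl⟩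
  have h2 : rep (i, v) = rep (j, σ v) := congrArg Quotient.out (Quotient.sound (s := S) h1)
  have h3 : T.SameVertex (rep (i, v)) (i, v) := Quotient.exact (s := S) (Quotient.out_eq _)
  simp only [← h2]
  exact ht _ i f j σ v h3 h hv

/-- The search state `s'` arises from `s` by visiting corners in the vertex class of `c`, at which
it agrees with `t`, and it contains all neighbours of the newly visited corners. -/
structure SearchStep (t : Corner n → ℝ) (c : Corner n) (s s' : Corner n → Option ℚ) : Prop where
  keep : ∀ d, s d ≠ none → s' d = s d
  new : ∀ d r, s d = none → s' d = some r → T.SameVertex c d ∧ (r : ℝ) = t d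
  closed : ∀ d e, s d = none → s' d ≠ none → T.CornerStep d e → s' e ≠ none

variable {T} {t : Corner n → ℝ} {c : Corner n}

theorem SearchStep.refl (s : Corner n → Option ℚ) : T.SearchStep t c s s :=
  ⟨fun _ _ => rfl, fun _ r h h' => (Option.some_ne_none r (h'.symm.trans h)).elim,
    fun _ _ h h' => (h' h).elim⟩

theorem SearchStep.trans {s s' s'' : Corner n → Option ℚ} (h : T.SearchStep t c s s')
    (h' : T.SearchStep t c s' s'') : T.SearchStep t c s s'' := by
  refine ⟨fun d hd => ?_, fun d r hd hr => ?_, fun d e hd hd' he => ?_⟩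
  · rw [h'.keep d (by rwa [h.keep d hd]), h.keep d hd]
  · by_cases hs : s' d = none
    · exact h'.new d r hs hr
    · exact h.new d r hd (h'.keep d hs ▸ hr)
  · by_cases hs : s' d = none
    · exact h'.closed d e hs hd' he
    · have h1 := h.closed d e hd hs he
      rwa [h'.keep e h1]

open Classical in
/-- The number of corners that have not been visited. -/
noncomputable def unvisited (s : Corner n → Option ℚ) : ℕ :=
  (Finset.univ.filter fun d => s d = none).card

theorem SearchStep.unvisited_le {s s' : Corner n → Option ℚ} (h : T.SearchStep t c s s') :
    unvisited s' ≤ unvisited s := by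
  refine Finset.card_le_card fun d hd => ?_
  simp only [Finset.mem_filter, Finset.mem_univ, true_and] at hd ⊢
  by_contra h1
  exact h1 (h.keep d h1 ▸ hd)

theorem unvisited_update {s : Corner n → Option ℚ} {d : Corner n} (hd : s d = none) (a : ℚ) :
    unvisited (Function.update s d (some a)) + 1 ≤ unvisited s := by
  refine Nat.succ_le_of_lt (Finset.card_lt_card ⟨fun e he => ?_, fun h => ?_⟩)
  · simp only [Finset.mem_filter, Finset.mem_univ, true_and] at he ⊢
    by_cases hed : e = d
    · rwa [hed]
    · rwa [Function.update_of_ne hed] at he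
  · have := h (Finset.mem_filter.2 ⟨Finset.mem_univ d, hd⟩)
    simp at this

/-- Every assigned value is forced by a matching equation from one that already agrees with `t`, so
the existence of `t` makes the order of the search irrelevant. Each call marks a further corner, so
fuel for all unvisited corners suffices. -/
theorem searchStep_dfs {q : QuadCoord n → ℚ}
    (ht : ∀ i f j σ v, T.glue i f = some (j, σ) → v ≠ f →
      t (i, v) + q (i, quadType v f) = t (j, σ v) + q (j, quadType (σ v) (σ f))) :
    ∀ (fuel : ℕ) (d : Corner n) (a : ℚ) (s : Corner n → Option ℚ), s d = none →
      unvisited s ≤ fuel → T.SameVertex c d → (a : ℝ) = t d →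
      T.SearchStep t c s (T.dfs q fuel d a s) ∧ T.dfs q fuel d a s d ≠ none := by
  intro fuel
  induction fuel with
  | zero =>
    intro d a s hd hs
    have := unvisited_update hd a
    omega
  | succ fuel ih =>
    intro d a s hd hs hcd ha
    set s₁ := Function.update s d (some a) with hs₁
    have hs₁' : unvisited s₁ ≤ fuel := by
      have : unvisited s₁ + 1 ≤ unvisited s := unvisited_update hd a
      omega
    let g : (Corner n → Option ℚ) → Fin 4 → Corner n → Option ℚ := fun s f =>
      if f = d.2 then s else
        match T.glue d.1 f with
        | none => s
        | some (j, σ) =>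
          match s (j, σ d.2) with
          | some _ => s
          | none => T.dfs q fuel (j, σ d.2)
              (a + q (d.1, quadType d.2 f) - q (j, quadType (σ d.2) (σ f))) s
    have hg : ∀ s₂ f, T.SearchStep t c s₁ s₂ → T.SearchStep t c s₂ (g s₂ f) ∧
        (f ≠ d.2 → ∀ j σ, T.glue d.1 f = some (j, σ) → g s₂ f (j, σ d.2) ≠ none) := by
      intro s₂ f h₂
      by_cases hf : f = d.2
      · simp only [g, if_pos hf]
        exact ⟨.refl _, fun h => (h hf).elim⟩
      simp only [g, if_neg hf]
      rcases hgl : T.glue d.1 f with _ | ⟨j, σ⟩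
      · exact ⟨.refl _, fun _ j σ h => by simp at h⟩
      · simp only [Option.some.injEq, Prod.mk.injEq, and_imp]
        rcases hv : s₂ (j, σ d.2) with _ | r
        · obtain ⟨h3, h4⟩ := ih (j, σ d.2)
            (a + q (d.1, quadType d.2 f) - q (j, quadType (σ d.2) (σ f))) s₂ hv
            (h₂.unvisited_le.trans hs₁')
            (Relation.EqvGen.trans _ _ _ hcd (Relation.EqvGen.rel _ _ ⟨f, σ, hf, hgl, rfl⟩)) (by
              have := ht d.1 f j σ d.2 hgl (Ne.symm hf)
              push_cast
              rw [ha]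
              linarith)
          refine ⟨h3, ?_⟩
          rintro _ _ _ rfl rfl
          exact h4
        · refine ⟨.refl _, ?_⟩
          rintro _ _ _ rfl rfl
          simp [hv]
    have hfold : ∀ (l : List (Fin 4)) s₂, T.SearchStep t c s₁ s₂ →
        T.SearchStep t c s₂ (l.foldl g s₂) ∧ ∀ f ∈ l, f ≠ d.2 → ∀ j σ,
          T.glue d.1 f = some (j, σ) → l.foldl g s₂ (j, σ d.2) ≠ none := by
      intro l
      induction l with
      | nil => exact fun s₂ _ => ⟨.refl _, by simp⟩
      | cons f l ihl =>
        intro s₂ h₂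
        obtain ⟨h3, h4⟩ := hg s₂ f h₂
        obtain ⟨h5, h6⟩ := ihl (g s₂ f) (h₂.trans h3)
        refine ⟨h3.trans h5, fun f' hf' hne j σ hgl => ?_⟩
        rcases List.mem_cons.1 hf' with rfl | hf'
        · have := h4 hne j σ hgl
          rwa [List.foldl_cons, h5.keep _ this]
        · exact h6 f' hf' hne j σ hgl
    obtain ⟨h1, h2⟩ := hfold (List.finRange 4) s₁ (.refl _)
    have heq : T.dfs q (fuel + 1) d a s = (List.finRange 4).foldl g s₁ := by
      rw [Triangulation.dfs]
      refine congrArg (fun g => List.foldl g s₁ (List.finRange 4))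
        (funext fun s => funext fun f => ?_)
      simp only [g]
      rcases T.glue d.1 f with _ | ⟨j, σ⟩
      · rfl
      · dsimp only
        rcases s (j, σ d.2) with _ | r <;> rfl
    rw [heq]
    have hsd : s₁ d = some a := Function.update_self ..
    have hne : ∀ e, e ≠ d → s₁ e = s e := fun e he => Function.update_of_ne he ..
    have hd' : (List.finRange 4).foldl g s₁ d = some a := by rw [h1.keep d (by simp [hsd]), hsd]
    refine ⟨⟨fun e he => ?_, fun e r he hr => ?_, fun e e' he he' hst => ?_⟩, by simp [hd']⟩
    · have hed : e ≠ d := by rintro rfl; exact he hd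
      rw [h1.keep e (by rwa [hne e hed]), hne e hed]
    · by_cases hed : e = d
      · subst hed
        rw [hd'] at hr
        obtain rfl := Option.some.inj hr
        exact ⟨hcd, ha⟩
      · exact h1.new e r (by rwa [hne e hed]) hr
    -- Neighbours of `d` are reached by the loop over its faces, those of other new corners within
    -- the recursive calls.
    · by_cases hed : e = d
      · subst hed
        obtain ⟨f, σ, hf, hgl, h5⟩ := hst
        have := h2 f (List.mem_finRange f) hf _ σ hgl
        rwa [← h5] at this
      · exact h1.closed e e' (by rwa [hne e hed]) he' hst

/-- The depth-first searches started from the first corners of the lists in `verts`. -/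
def searchAll {K : Type} [Field K] (T : Triangulation n) (q : QuadCoord n → K)
    (verts : List (List (Corner n))) (s : Corner n → Option K) : Corner n → Option K :=
  verts.foldl (fun s V => match V with
    | [] => s
    | c :: _ => T.dfs q (4 * n) c 0 s) s

/-- Starting from 0 replaces `t` by its difference from the value at the first corner, which solves
the same equations. Closedness under neighbours makes the search exhaust the class, and disjoint
classes do not interfere. -/
theorem searchAll_spec {q : QuadCoord n → ℚ}
    (ht : ∀ i f j σ v, T.glue i f = some (j, σ) → v ≠ f →
      t (i, v) + q (i, quadType v f) = t (j, σ v) + q (j, quadType (σ v) (σ f))) :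
    ∀ (verts : List (List (Corner n))) (s : Corner n → Option ℚ),
      (∀ V ∈ verts, ∃ c, ∀ d, d ∈ V ↔ T.SameVertex c d) → verts.Pairwise List.Disjoint →
      (∀ V ∈ verts, ∀ d ∈ V, s d = none) →
      (∀ d, s d ≠ none → searchAll T q verts s d = s d) ∧
      ∀ V ∈ verts, ∃ a : ℝ, ∀ d ∈ V, ∃ r, searchAll T q verts s d = some r ∧ (r : ℝ) = t d - a := by
  intro verts
  induction verts with
  | nil => exact fun s _ _ _ => ⟨fun _ _ => rfl, by simp⟩
  | cons V verts ih =>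
    intro s hcl hdis hs
    obtain ⟨c, hc⟩ := hcl V List.mem_cons_self
    obtain ⟨h, V', rfl⟩ : ∃ h V', V = h :: V' :=
      List.exists_cons_of_ne_nil (List.ne_nil_of_mem ((hc c).2 (Relation.EqvGen.refl c)))
    have hh : T.SameVertex c h := (hc h).1 List.mem_cons_self
    obtain ⟨h1, h2⟩ := searchStep_dfs (c := c) (t := fun d => t d - t h) (q := q)
      (fun i f j σ v hgl hv => by linarith [ht i f j σ v hgl hv]) (4 * n) h 0 s
      (hs _ List.mem_cons_self h List.mem_cons_self) (by
        refine (Finset.card_filter_le _ _).trans ?_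
        simp [Finset.card_univ, mul_comm]) hh (by simp)
    set s' := T.dfs q (4 * n) h 0 s
    obtain ⟨hd1, hd2⟩ := List.pairwise_cons.1 hdis
    obtain ⟨h3, h4⟩ := ih s' (fun W hW => hcl W (List.mem_cons_of_mem _ hW)) hd2
      (fun W hW d hd => by
        rcases hv : s' d with _ | r
        · rfl
        · have := h1.new d r (hs W (List.mem_cons_of_mem _ hW) d hd) hv
          exact (hd1 W hW ((hc d).2 this.1) hd).elim)
    have he : searchAll T q ((h :: V') :: verts) s = searchAll T q verts s' := rfl
    rw [he]
    refine ⟨fun d hd => by rw [h3 d (by rwa [h1.keep d hd]), h1.keep d hd], fun W hW => ?_⟩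
    rcases List.mem_cons.1 hW with rfl | hW
    · have hvis : ∀ d, T.SameVertex h d → s' d ≠ none ∧ T.SameVertex c d := by
        intro d hd
        refine (eqvGen_pred T.cornerStep_symm (p := fun d => s' d ≠ none ∧ T.SameVertex c d)
          ?_ hd).1 ⟨h2, hh⟩
        rintro d e hde ⟨hd1, hd2⟩
        exact ⟨h1.closed d e (hs _ List.mem_cons_self d ((hc d).2 hd2)) hd1 hde,
          Relation.EqvGen.trans _ _ _ hd2 (Relation.EqvGen.rel _ _ hde)⟩
      refine ⟨t h, fun d hd => ?_⟩
      have hdc := (hc d).1 hd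
      have h5 := (hvis d (Relation.EqvGen.trans _ _ _ (Relation.EqvGen.symm _ _ hh) hdc)).1
      obtain ⟨r, hr⟩ := Option.ne_none_iff_exists'.1 h5
      exact ⟨r, by rw [h3 d h5, hr], (h1.new d r (hs _ List.mem_cons_self d hd) hr).2⟩
    · exact h4 W hW

end Triangulation

end NormalSurface

namespace NormalSurface

/-! ### Agreement of rational and real computation -/

section Casts

variable {ι : Type}

/-- The real vector with the given rational coordinates. -/
def toReal (y : ι → ℚ) : ι → ℝ := fun i => (y i : ℝ)

theorem toReal_injective : Function.Injective (toReal : (ι → ℚ) → ι → ℝ) := fun _ _ h =>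
  funext fun i => Rat.cast_injective (congrFun h i)

theorem mem_realVectors {L : List (ι → ℚ)} {x : ι → ℝ} :
    x ∈ realVectors L ↔ x ∈ L.map toReal := by
  simp only [realVectors, Set.mem_ofPred_eq, List.mem_map, toReal, funext_iff, eq_comm]

theorem toReal_eq_zero (y : ι → ℚ) (i : ι) : toReal y i = 0 ↔ y i = 0 := by
  simp [toReal]

/-- The tests made in the enumeration and in the processing of vertices compare numbers or vectors,
and the injective, order-preserving embedding of the rationals does not change their outcome. So
these computations commute with it. -/
theorem passesAdjacencyTest_toReal (C : Finset ι) (L : List (ι → ℚ)) (u w : ι → ℚ) :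
    PassesAdjacencyTest C (L.map toReal) (toReal u) (toReal w) ↔ PassesAdjacencyTest C L u w := by
  simp only [PassesAdjacencyTest, List.mem_map, forall_exists_index, and_imp,
    forall_apply_eq_imp_iff₂, toReal_eq_zero, ne_eq, toReal_injective.eq_iff]

theorem toReal_projImage [Fintype ι] (x : ι → ℚ) : toReal (projImage x) = projImage (toReal x) := by
  funext i
  simp [toReal, projImage]

theorem map_filter_toReal {p : (ι → ℚ) → Prop} [DecidablePred p] {p' : (ι → ℝ) → Prop}
    [DecidablePred p'] (h : ∀ u, p' (toReal u) ↔ p u) (L : List (ι → ℚ)) :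
    (L.filter fun u => p u).map toReal = (L.map toReal).filter fun u => p' u := by
  rw [List.filter_map]
  simp only [Function.comp_def, h]

theorem map_newVectors [Fintype ι] {compat : (ι → ℚ) → (ι → ℚ) → Prop}
    [∀ u w, Decidable (compat u w)] {compat' : (ι → ℝ) → (ι → ℝ) → Prop}
    [∀ u w, Decidable (compat' u w)] (hc : ∀ u w, compat' (toReal u) (toReal w) ↔ compat u w)
    {h : (ι → ℚ) → ℚ} {h' : (ι → ℝ) → ℝ} (hh : ∀ u, h' (toReal u) = h u) (C : Finset ι)
    (L : List (ι → ℚ)) :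
    (newVectors compat C h L).map toReal = newVectors compat' C h' (L.map toReal) := by
  simp only [newVectors, List.map_flatMap, List.filter_map, List.flatMap_map, List.map_map,
    Function.comp_def, hh, hc, passesAdjacencyTest_toReal, Rat.cast_pos, Rat.cast_lt_zero]
  congr 1
  funext u
  congr 1
  funext w i
  simp [toReal]

variable {n : ℕ}

theorem togetherQuad_toReal (u w : QuadCoord n → ℚ) :
    TogetherQuad (toReal u) (toReal w) ↔ TogetherQuad u w := by
  simp only [TogetherQuad, toReal_eq_zero]

theorem quadProj_toReal (x : StdCoord n → ℚ) : quadProj (toReal x) = toReal (quadProj x) := rfl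

theorem edgeForm_toReal (T : Triangulation n) (p : Flag n) (x : QuadCoord n → ℚ) :
    T.edgeForm p (toReal x) = ((T.edgeForm p x : ℚ) : ℝ) := by
  simp only [Triangulation.edgeForm, toReal]
  generalize (T.edgeCycle p).getD [] = l
  induction l with
  | nil => simp
  | cons a l ih => simp [ih]

theorem toReal_vertexLink (V : List (Corner n)) :
    toReal (vertexLink V : StdCoord n → ℚ) = vertexLink V := by
  funext c
  rcases c with ⟨i, v | k⟩
  · simp only [toReal, vertexLink]
    split_ifs <;> simp
  · simp [toReal, vertexLink]

theorem minAround_spec {K : Type} [Field K] [LinearOrder K] {V : List (Corner n)} (hV : V ≠ [])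
    (x : StdCoord n → K) : (∀ c ∈ V, minAround V x ≤ x (c.1, Sum.inl c.2)) ∧
      ∃ c ∈ V, x (c.1, Sum.inl c.2) = minAround V x := by
  rcases h : (V.map fun c => x (c.1, Sum.inl c.2)).min? with _ | a
  · simp [hV] at h
  · have h1 : minAround V x = a := by simp [minAround, h]
    rw [h1]
    obtain ⟨h2, h3⟩ := List.min?_eq_some_iff.1 h
    refine ⟨fun c hc => h3 _ (List.mem_map_of_mem hc), ?_⟩
    simpa using h2

theorem minAround_toReal (V : List (Corner n)) (x : StdCoord n → ℚ) :
    minAround V (toReal x) = ((minAround V x : ℚ) : ℝ) := by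
  by_cases hV : V = []
  · simp [hV, minAround]
  · obtain ⟨h1, c, hc, h2⟩ := minAround_spec hV x
    obtain ⟨h3, d, hd, h4⟩ := minAround_spec hV (toReal x)
    apply le_antisymm
    · rw [← h2]
      exact h3 c hc
    · rw [← h4]
      exact Rat.cast_le.2 (h1 d hd)

theorem toReal_partialCanonical (V : List (Corner n)) (x : StdCoord n → ℚ) :
    toReal (partialCanonical V x) = partialCanonical V (toReal x) := by
  funext c
  have := congrFun (toReal_vertexLink V) c
  simp only [toReal] at this
  simp only [partialCanonical, minAround_toReal]
  simp [toReal, ← this]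

theorem map_processPosition (CL : Finset (StdCoord n) × List (StdCoord n → ℚ)) (p : StdCoord n) :
    Prod.map id (List.map toReal) (processPosition CL p) =
      processPosition (Prod.map id (List.map toReal) CL) p := by
  simp only [processPosition, Prod.map, id, List.map_append]
  rw [map_filter_toReal (p' := fun x => x p = 0) fun u => toReal_eq_zero u p,
    map_filter_toReal (p' := fun x => 0 < x p) fun u => Rat.cast_pos,
    map_newVectors (compat := fun u w => TogetherQuad (quadProj u) (quadProj w))
      (compat' := fun u w => TogetherQuad (quadProj u) (quadProj w)) (h := fun x => x p)
      (h' := fun x => x p) (fun u w => togetherQuad_toReal (quadProj u) (quadProj w)) fun u => rfl]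

theorem map_processVertex (CL : Finset (StdCoord n) × List (StdCoord n → ℚ))
    (V : List (Corner n)) : Prod.map id (List.map toReal) (processVertex CL V) =
      processVertex (Prod.map id (List.map toReal) CL) V := by
  have h : ∀ (ps : List (StdCoord n)) CL, Prod.map id (List.map toReal)
      (ps.foldl processPosition CL : Finset (StdCoord n) × List (StdCoord n → ℚ)) =
        ps.foldl processPosition (Prod.map id (List.map toReal) CL) := by
    intro ps
    induction ps with
    | nil => exact fun CL => rfl
    | cons p ps ih => exact fun CL => by rw [List.foldl_cons, ih, map_processPosition]; rfl
  have h0 : Prod.map id (List.map toReal) (CL.1, CL.2.map (partialCanonical V) ++ [-vertexLink V]) =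
      (CL.1, (CL.2.map toReal).map (partialCanonical V) ++ [-vertexLink V]) := by
    have h2 : toReal (-vertexLink V : StdCoord n → ℚ) = -vertexLink V := by
      rw [← toReal_vertexLink]
      funext c
      simp [toReal]
    simp [Function.comp_def, toReal_partialCanonical, h2]
  have h1 := h (V.map fun c => ((c.1, Sum.inl c.2) : StdCoord n))
    (CL.1, CL.2.map (partialCanonical V) ++ [-vertexLink V])
  rw [h0] at h1
  simp only [processVertex, Prod.map, id]
  rw [← h1]
  simp [toReal_vertexLink]

theorem map_foldl_processVertex (verts : List (List (Corner n)))
    (CL : Finset (StdCoord n) × List (StdCoord n → ℚ)) :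
    Prod.map id (List.map toReal) (verts.foldl processVertex CL) =
      verts.foldl processVertex (Prod.map id (List.map toReal) CL) := by
  induction verts generalizing CL with
  | nil => rfl
  | cons V verts ih => rw [List.foldl_cons, ih, map_processVertex]; rfl

theorem map_directEnumeration (T : Triangulation n) (edges : List (Flag n)) :
    (T.directEnumeration edges : List (QuadCoord n → ℚ)).map toReal =
      T.directEnumeration edges := by
  simp only [Triangulation.directEnumeration]
  have h0 : (((List.finRange n).product (List.finRange 3)).map fun c =>
      (Pi.single c 1 : QuadCoord n → ℚ)).map toReal =
      ((List.finRange n).product (List.finRange 3)).map fun c => Pi.single c 1 := by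
    rw [List.map_map]
    refine List.map_congr_left fun c _ => funext fun d => ?_
    by_cases h : d = c
    · subst h
      simp [toReal]
    · simp [toReal, h]
  rw [← h0]
  generalize ((List.finRange n).product (List.finRange 3)).map
    (fun c => (Pi.single c 1 : QuadCoord n → ℚ)) = L
  induction edges generalizing L with
  | nil => rfl
  | cons p edges ih =>
    rw [List.foldl_cons, ih, List.foldl_cons, List.map_append,
      map_newVectors togetherQuad_toReal (edgeForm_toReal T p),
      map_filter_toReal (p' := fun x => T.edgeForm p x = 0) fun u => by
        rw [edgeForm_toReal, Rat.cast_eq_zero]]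

end Casts

end NormalSurface

namespace NormalSurface

/-! ### Extreme rays and vertices of the polytope -/

section Polytope

variable {ι : Type} [Fintype ι]

theorem IsExtremal.sum_pos {M : Submodule ℝ (ι → ℝ)} {x : ι → ℝ}
    (hx : IsExtremal M Finset.univ x) : 0 < ∑ i, x i := by
  obtain ⟨i, hi, h⟩ := hx.ne_zero
  exact Finset.sum_pos' hx.nonneg ⟨i, hi, lt_of_le_of_ne (hx.nonneg i hi) (Ne.symm h)⟩

/-- If `y` is supported in a vertex `x`, subtracting a multiple of `x` gives `z` with coordinate sum
0, and `x ± ε z` remain in the polytope for small `ε`, so `z = 0`. Conversely, the endpoints of an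
open segment of non-negative vectors through `x` are supported in `x`, hence multiples of `x`, and
the coordinate sum fixes the factor. -/
theorem mem_extremePoints_iff_isExtremal (M : Submodule ℝ (ι → ℝ)) (x : ι → ℝ) :
    x ∈ Set.extremePoints ℝ {x : ι → ℝ | (∀ i, 0 ≤ x i) ∧ ∑ i, x i = 1 ∧ x ∈ M} ↔
      IsExtremal M Finset.univ x ∧ ∑ i, x i = 1 := by
  constructor
  · rintro ⟨⟨hn, hs, hM⟩, hx⟩
    refine ⟨⟨hM, fun i _ => hn i, ?_, fun y hy hyx => ?_⟩, hs⟩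
    · by_contra h
      push Not at h
      rw [Finset.sum_eq_zero h] at hs
      exact zero_ne_one hs
    · set z := y - (∑ i, y i) • x with hz
      have hzM : z ∈ M := M.sub_mem hy (M.smul_mem _ hM)
      have hzs : ∑ i, z i = 0 := by
        simp [hz, Finset.sum_sub_distrib, ← Finset.mul_sum, hs]
      have hz0 : ∀ i, x i = 0 → z i = 0 := fun i h => by
        simp [hz, hyx i (Finset.mem_univ i) h, h]
      have hev : ∀ᶠ ε : ℝ in nhdsWithin 0 (Set.Ioi 0), ∀ i, |ε * z i| ≤ x i := by
        refine Filter.eventually_all.2 fun i => ?_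
        by_cases h : x i = 0
        · simp [h, hz0 i h]
        · have hc : Filter.Tendsto (fun ε : ℝ => |ε * z i|)
              (nhdsWithin 0 (Set.Ioi 0)) (nhds 0) := by
            have : Continuous fun ε : ℝ => |ε * z i| := by fun_prop
            simpa using (this.tendsto 0).mono_left nhdsWithin_le_nhds
          exact (hc.eventually_lt_const (lt_of_le_of_ne (hn i) (Ne.symm h))).mono fun _ h => h.le
      obtain ⟨ε, hε, hε0⟩ := (hev.and self_mem_nhdsWithin).exists
      have hε0 : 0 < ε := hε0
      have h1 := hx (x₁ := x + ε • z) ⟨fun i => by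
          have := (abs_le.1 (hε i)).1
          simp only [Pi.add_apply, Pi.smul_apply, smul_eq_mul]; linarith, by
          simp [Finset.sum_add_distrib, ← Finset.mul_sum, hs, hzs],
          M.add_mem hM (M.smul_mem _ hzM)⟩ (x₂ := x - ε • z) ⟨fun i => by
          have := (abs_le.1 (hε i)).2
          simp only [Pi.sub_apply, Pi.smul_apply, smul_eq_mul]; linarith, by
          simp [Finset.sum_sub_distrib, ← Finset.mul_sum, hs, hzs],
          M.sub_mem hM (M.smul_mem _ hzM)⟩ ⟨1 / 2, 1 / 2, by norm_num, by norm_num, by norm_num, by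
            funext i
            simp only [Pi.add_apply, Pi.sub_apply, Pi.smul_apply, smul_eq_mul]
            ring⟩
      refine ⟨∑ i, y i, fun i _ => ?_⟩
      have h2 := congrFun h1 i
      simp only [Pi.add_apply, Pi.smul_apply, smul_eq_mul, add_eq_left, mul_eq_zero, hε0.ne',
        false_or] at h2
      simp only [hz, Pi.sub_apply, Pi.smul_apply, smul_eq_mul] at h2
      linarith
  · rintro ⟨hx, hs⟩
    refine ⟨⟨fun i => hx.nonneg i (Finset.mem_univ i), hs, hx.mem⟩, ?_⟩
    rintro y ⟨hyn, hys, hyM⟩ z ⟨hzn, -, -⟩ ⟨a, b, ha, hb, -, rfl⟩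
    obtain ⟨c, hc⟩ := hx.minimal y hyM fun i _ h => by
      simp only [Pi.add_apply, Pi.smul_apply, smul_eq_mul] at h
      have h1 := mul_nonneg ha.le (hyn i)
      have h2 := mul_nonneg hb.le (hzn i)
      exact (mul_eq_zero.1 (by linarith : a * y i = 0)).resolve_left ha.ne'
    have hc1 : c = 1 := by
      rw [Finset.sum_congr rfl hc, ← Finset.mul_sum, hs, mul_one] at hys
      exact hys
    funext i
    rw [hc i (Finset.mem_univ i), hc1, one_mul]

theorem PosProp.eq_of_sum_eq {x y : ι → ℝ} (h : PosProp Finset.univ x y)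
    (hs : ∑ i, x i = ∑ i, y i) (hy : ∑ i, y i ≠ 0) : x = y := by
  obtain ⟨a, _, h⟩ := h
  rw [Finset.sum_congr rfl h, ← Finset.mul_sum] at hs
  have ha : a = 1 := by
    have : (a - 1) * ∑ i, y i = 0 := by linarith
    linarith [(mul_eq_zero.1 this).resolve_right hy]
  funext i
  rw [h i (Finset.mem_univ i), ha, one_mul]

theorem sum_projImage {x : ι → ℝ} (hx : ∑ i, x i ≠ 0) : ∑ i, projImage x i = 1 := by
  simp [projImage, ← Finset.mul_sum, hx]

theorem posProp_projImage {x : ι → ℝ} (hx : 0 < ∑ i, x i) (C : Finset ι) :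
    PosProp C (projImage x) x := ⟨_, inv_pos.2 hx, fun i _ => by simp [projImage]⟩

variable {compat : (ι → ℝ) → (ι → ℝ) → Prop} {M : Submodule ℝ (ι → ℝ)} {L : List (ι → ℝ)}

/-- A list of representatives with coordinate sum `1` is the list of all admissible vertices of
the polytope. -/
theorem Represents.mem_iff (hL : Represents compat Finset.univ (IsExtremal M Finset.univ) L)
    (hs : ∀ x ∈ L, ∑ i, x i = 1) (x : ι → ℝ) : x ∈ L ↔
      x ∈ Set.extremePoints ℝ {x : ι → ℝ | (∀ i, 0 ≤ x i) ∧ ∑ i, x i = 1 ∧ x ∈ M} ∧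
        compat x x := by
  rw [mem_extremePoints_iff_isExtremal]
  constructor
  · exact fun hx => ⟨⟨(hL.sound x hx).1, hs x hx⟩, (hL.sound x hx).2⟩
  · rintro ⟨⟨hx, hx1⟩, hc⟩
    obtain ⟨z, hz, hzx⟩ := hL.complete x hx hc
    rwa [← hzx.eq_of_sum_eq ((hs z hz).trans hx1.symm) (by rw [hx1]; exact one_ne_zero)]

theorem Represents.projImage (hc : IsSupportCompat Finset.univ compat)
    (hL : Represents compat Finset.univ (IsExtremal M Finset.univ) L) :
    Represents compat Finset.univ (IsExtremal M Finset.univ) (L.map projImage) ∧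
      ∀ x ∈ L.map NormalSurface.projImage, ∑ i, x i = 1 := by
  have hp : ∀ x ∈ L, PosProp Finset.univ (NormalSurface.projImage x) x := fun x hx =>
    posProp_projImage (hL.sound x hx).1.sum_pos _
  have hinj : ∀ x ∈ L, ∀ y ∈ L, PosProp Finset.univ (NormalSurface.projImage x)
      (NormalSurface.projImage y) → x = y := fun x hx y hy h =>
    hL.irredundant.2 x hx y hy (((hp x hx).symm.trans h).trans (hp y hy))
  refine ⟨⟨⟨(List.nodup_map_iff_inj_on hL.irredundant.1).2 fun x hx y hy h =>
    hinj x hx y hy (h ▸ PosProp.refl _ _), ?_⟩, ?_, ?_⟩, ?_⟩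
  · intro x' hx' y' hy' h
    obtain ⟨x, hx, rfl⟩ := List.mem_map.1 hx'
    obtain ⟨y, hy, rfl⟩ := List.mem_map.1 hy'
    rw [hinj x hx y hy h]
  · intro x' hx'
    obtain ⟨x, hx, rfl⟩ := List.mem_map.1 hx'
    obtain ⟨h1, h2⟩ := hL.sound x hx
    exact ⟨h1.of_posProp (hp x hx).symm (M.smul_mem _ h1.mem), hc.self h2 fun i hi h _ =>
      (hp x hx).symm.eq_zero hi h⟩
  · intro x hx hcx
    obtain ⟨z, hz, hzx⟩ := hL.complete x hx hcx
    exact ⟨_, List.mem_map_of_mem hz, (hp z hz).trans hzx⟩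
  · intro x' hx'
    obtain ⟨x, hx, rfl⟩ := List.mem_map.1 hx'
    exact sum_projImage (hL.sound x hx).1.sum_pos.ne'

end Polytope

end NormalSurface

/-! ### The two solution spaces and the canonical extension -/

namespace NormalSurface

variable {n : ℕ} (T : Triangulation n)

/-- The solutions of the standard matching equations. -/
def Triangulation.stdSpace : Submodule ℝ (StdCoord n → ℝ) where
  carrier := {x | T.StdMatching x}
  zero_mem' := fun i f j σ h v hv => by simp
  add_mem' := fun {x y} hx hy i f j σ h v hv => by
    have h1 := hx i f j σ h v hv
    have h2 := hy i f j σ h v hv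
    simp only [Pi.add_apply]
    linarith
  smul_mem' := fun a x hx i f j σ h v hv => by
    have h1 := hx i f j σ h v hv
    simp only [Pi.smul_apply, smul_eq_mul]
    rw [← mul_add, ← mul_add, h1]

/-- The left-hand side of the matching equation of an edge, as a linear form. -/
noncomputable def Triangulation.edgeLinear (p : Flag n) : (QuadCoord n → ℝ) →ₗ[ℝ] ℝ where
  toFun := T.edgeForm p
  map_add' x y := by
    simp only [Triangulation.edgeForm]
    generalize (T.edgeCycle p).getD [] = l
    induction l with
    | nil => simp
    | cons a l ih =>
      simp only [List.map_cons, List.sum_cons, ih]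
      simp only [Pi.add_apply]
      ring
  map_smul' a x := by
    simp only [Triangulation.edgeForm, RingHom.id_apply]
    generalize (T.edgeCycle p).getD [] = l
    induction l with
    | nil => simp
    | cons a l ih =>
      simp only [List.map_cons, List.sum_cons, ih]
      simp only [Pi.smul_apply, smul_eq_mul]
      ring

/-- The solutions of the quadrilateral matching equations. -/
noncomputable def Triangulation.quadSpace : Submodule ℝ (QuadCoord n → ℝ) :=
  ⨅ p, ⨅ _ : T.InteriorEdge p, LinearMap.ker (T.edgeLinear p)

theorem Triangulation.mem_quadSpace {x : QuadCoord n → ℝ} :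
    x ∈ T.quadSpace ↔ T.QuadMatching x := by
  simp [Triangulation.quadSpace, Submodule.mem_iInf, Triangulation.QuadMatching,
    Triangulation.edgeLinear]

theorem quadConstraints_iff (x : QuadCoord n → ℝ) : QuadConstraints x ↔ TogetherQuad x x := by
  simp only [QuadConstraints, TogetherQuad, and_self]

theorem isSupportCompat_quad :
    IsSupportCompat Finset.univ (TogetherQuad : (QuadCoord n → ℝ) → (QuadCoord n → ℝ) → Prop) := by
  refine ⟨fun {u w u' w'} h hu hw i k l hkl => ?_⟩
  rcases h i k l hkl with ⟨h1, h2⟩ | ⟨h1, h2⟩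
  · exact Or.inl ⟨hu _ (Finset.mem_univ _) h1 h2, hw _ (Finset.mem_univ _) h1 h2⟩
  · exact Or.inr ⟨hu _ (Finset.mem_univ _) h1 h2, hw _ (Finset.mem_univ _) h1 h2⟩

/-- The set of all quadrilateral positions. -/
def quadPositions (n : ℕ) : Finset (StdCoord n) := Finset.univ.filter fun c => c.2.isRight

theorem forall_quadPositions {P : StdCoord n → Prop} :
    (∀ i ∈ quadPositions n, P i) ↔ ∀ c : QuadCoord n, P (c.1, Sum.inr c.2) := by
  constructor
  · exact fun h c => h _ (by simp [quadPositions])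
  · rintro h ⟨i, v | k⟩ hi
    · simp [quadPositions] at hi
    · exact h (i, k)

theorem exists_quadPositions {P : StdCoord n → Prop} :
    (∃ i ∈ quadPositions n, P i) ↔ ∃ c : QuadCoord n, P (c.1, Sum.inr c.2) := by
  have := forall_quadPositions (n := n) (P := fun i => ¬ P i)
  simpa only [← not_exists, ← not_and, not_iff_not, exists_prop] using not_congr this

theorem isSupportCompat_std : IsSupportCompat (quadPositions n)
    (fun u w : StdCoord n → ℝ => TogetherQuad (quadProj u) (quadProj w)) :=
  ⟨fun h hu hw => isSupportCompat_quad.of_supp h (fun c _ => forall_quadPositions.1 hu c)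
    fun c _ => forall_quadPositions.1 hw c⟩

theorem posProp_quadPositions {x y : StdCoord n → ℝ} : PosProp (quadPositions n) x y ↔
    PosProp Finset.univ (quadProj x) (quadProj y) := by
  simp only [PosProp, forall_quadPositions, Finset.mem_univ, true_implies, quadProj]

section VertexLinks

variable {T}

theorem vertexLink_mem {V : List (Corner n)} {c : Corner n} (hV : ∀ d, d ∈ V ↔ T.SameVertex c d) :
    (vertexLink V : StdCoord n → ℝ) ∈ T.stdSpace := by
  intro i f j σ h v hv
  have h1 : T.SameVertex (i, v) (j, σ v) := Relation.EqvGen.rel _ _ ⟨f, σ, hv.symm, h, rfl⟩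
  have h2 : (i, v) ∈ V ↔ (j, σ v) ∈ V := by
    rw [hV, hV]
    exact ⟨fun h => Relation.EqvGen.trans _ _ _ h h1,
      fun h => Relation.EqvGen.trans _ _ _ h (Relation.EqvGen.symm _ _ h1)⟩
  simp [vertexLink, h2]

/-- The triangular positions around a vertex. -/
def trianglePositions (V : List (Corner n)) : List (StdCoord n) := V.map fun c => (c.1, Sum.inl c.2)

theorem forall_trianglePositions {V : List (Corner n)} {P : StdCoord n → Prop} :
    (∀ i ∈ (trianglePositions V).toFinset, P i) ↔ ∀ c ∈ V, P (c.1, Sum.inl c.2) := by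
  simp only [trianglePositions, List.mem_toFinset, List.forall_mem_map]

/-- Without quadrilaterals the standard matching equations equate the triangular coordinates of
identified corners, so these are constant on the class. The link vanishes on `C` because its
positions have not been processed yet. -/
theorem isLinkVector {V : List (Corner n)} {c : Corner n} (hV : ∀ d, d ∈ V ↔ T.SameVertex c d)
    {C : Finset (StdCoord n)} (hC : quadPositions n ⊆ C)
    (hd : ∀ d ∈ V, ((d.1, Sum.inl d.2) : StdCoord n) ∉ C) :
    IsLinkVector T.stdSpace C (trianglePositions V).toFinset (vertexLink V) := by
  refine ⟨vertexLink_mem hV, ?_, forall_trianglePositions.2 fun d hd => if_pos hd, ?_⟩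
  · rintro ⟨i, v | k⟩ hi
    · exact if_neg fun h => hd (i, v) h hi
    · rfl
  · intro x hx hxC
    refine ⟨x (c.1, Sum.inl c.2), forall_trianglePositions.2 fun d hd => ?_⟩
    have hq := forall_quadPositions.1 fun i hi => hxC i (hC hi)
    refine (eqvGen_pred T.cornerStep_symm
      (p := fun d => x (d.1, Sum.inl d.2) = x (c.1, Sum.inl c.2)) ?_ ((hV d).1 hd)).1 rfl
    rintro ⟨i, v⟩ ⟨j, w⟩ ⟨f, σ, hf, hg, rfl⟩ h
    have := hx i f j σ hg v (Ne.symm hf)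
    rw [hq (i, quadType v f), hq (j, quadType (σ v) (σ f)), add_zero, add_zero] at this
    exact this.symm.trans h

theorem partialCanonical_mem {V : List (Corner n)} {c : Corner n}
    (hV : ∀ d, d ∈ V ↔ T.SameVertex c d) {x : StdCoord n → ℝ} (hx : x ∈ T.stdSpace) :
    partialCanonical V x ∈ T.stdSpace :=
  T.stdSpace.sub_mem hx (T.stdSpace.smul_mem _ (vertexLink_mem hV))

theorem quadProj_partialCanonical {K : Type} [Field K] [LinearOrder K] (V : List (Corner n))
    (x : StdCoord n → K) : quadProj (partialCanonical V x) = quadProj x := by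
  funext c
  simp [quadProj, partialCanonical, vertexLink]

end VertexLinks

/-- The canonical extension solves the standard matching equations. -/
theorem canonicalExtension_spec (hT : T.IsCompactManifold) {verts : List (List (Corner n))}
    (hverts : T.IsVertexList verts) {q : QuadCoord n → ℚ} (hq : T.QuadMatching (toReal q)) :
    T.StdMatching (toReal (T.canonicalExtension verts q)) ∧
      quadProj (T.canonicalExtension verts q) = q := by
  obtain ⟨t, ht⟩ := T.exists_triangle_coords_all hT hq
  obtain ⟨-, hs⟩ := Triangulation.searchAll_spec (q := q) ht verts (fun _ => none)
    hverts.isClass hverts.once fun _ _ _ _ => rfl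
  have key : ∀ (l : List (List (Corner n))), (∀ V ∈ l, ∃ c, ∀ d, d ∈ V ↔ T.SameVertex c d) →
      ∀ x : StdCoord n → ℚ, T.StdMatching (toReal x) → quadProj x = q →
        T.StdMatching (toReal (l.foldl (fun x V => partialCanonical V x) x)) ∧
          quadProj (l.foldl (fun x V => partialCanonical V x) x) = q := by
    intro l hl
    induction l with
    | nil => exact fun x h1 h2 => ⟨h1, h2⟩
    | cons V l ih =>
      intro x h1 h2
      obtain ⟨c, hc⟩ := hl V List.mem_cons_self
      refine ih (fun W hW => hl W (List.mem_cons_of_mem _ hW)) _ ?_ ?_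
      · rw [toReal_partialCanonical]
        exact partialCanonical_mem hc h1
      · rw [quadProj_partialCanonical, h2]
  refine key verts hverts.isClass _ ?_ rfl
  intro i f j σ hg v hv
  obtain ⟨V, hV, hm⟩ := hverts.complete (i, v)
  obtain ⟨c, hc⟩ := hverts.isClass V hV
  have hm' : (j, σ v) ∈ V := (hc _).2 (Relation.EqvGen.trans _ _ _ ((hc _).1 hm)
    (Relation.EqvGen.rel _ _ ⟨f, σ, hv.symm, hg, rfl⟩))
  -- Both corners of the equation lie in one class, so the search is off by the same constant `a` at
  -- both, and it cancels.
  obtain ⟨a, ha⟩ := hs V hV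
  obtain ⟨r, hr, hr'⟩ := ha _ hm
  obtain ⟨r', hs', hs''⟩ := ha _ hm'
  have h1 := ht i f j σ v hg hv
  have e1 : (((Triangulation.searchAll T q verts fun _ => none) (i, v)).getD 0 : ℚ) = r := by
    rw [hr]; rfl
  have e2 : (((Triangulation.searchAll T q verts fun _ => none) (j, σ v)).getD 0 : ℚ) = r' := by
    rw [hs']; rfl
  change (((Triangulation.searchAll T q verts fun _ => none) (i, v)).getD 0 : ℚ) +
    (q (i, quadType v f) : ℝ) = (((Triangulation.searchAll T q verts fun _ => none)
      (j, σ v)).getD 0 : ℚ) + (q (j, quadType (σ v) (σ f)) : ℝ)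
  rw [e1, e2, hr', hs'']
  simp only [toReal] at h1
  linarith

theorem exists_quadProj_eq (hT : T.IsCompactManifold) {q : QuadCoord n → ℝ}
    (hq : T.QuadMatching q) : ∃ x ∈ T.stdSpace, quadProj x = q := by
  obtain ⟨t, ht⟩ := T.exists_triangle_coords_all hT hq
  exact ⟨fun c => Sum.elim (fun v => t (c.1, v)) (fun k => q (c.1, k)) c.2,
    fun i f j σ hg v hv => ht i f j σ v hg hv, rfl⟩

/-- Supports and proportionality at quadrilateral positions concern the projection only, and the
projection maps `T.stdSpace` onto `T.quadSpace`. -/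
theorem isExtremal_quadProj_iff (hT : T.IsCompactManifold) {x : StdCoord n → ℝ} :
    IsExtremal T.stdSpace (quadPositions n) x ↔
      x ∈ T.stdSpace ∧ IsExtremal T.quadSpace Finset.univ (quadProj x) := by
  constructor
  · intro hx
    refine ⟨hx.mem, ⟨T.mem_quadSpace.2 hx.mem.quadMatching,
      fun c _ => forall_quadPositions.1 hx.nonneg c, ?_, fun y hy hyx => ?_⟩⟩
    · obtain ⟨c, hc⟩ := exists_quadPositions.1 hx.ne_zero
      exact ⟨c, Finset.mem_univ c, hc⟩
    · obtain ⟨z, hz, rfl⟩ := exists_quadProj_eq T hT (T.mem_quadSpace.1 hy)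
      obtain ⟨a, ha⟩ := hx.minimal z hz
        (forall_quadPositions.2 fun c h => hyx c (Finset.mem_univ c) h)
      exact ⟨a, fun c _ => forall_quadPositions.1 ha c⟩
  · rintro ⟨hM, hx⟩
    refine ⟨hM, forall_quadPositions.2 fun c => hx.nonneg c (Finset.mem_univ c), ?_,
      fun y hy hyx => ?_⟩
    · obtain ⟨c, -, hc⟩ := hx.ne_zero
      exact exists_quadPositions.2 ⟨c, hc⟩
    · obtain ⟨a, ha⟩ := hx.minimal (quadProj y)
        (T.mem_quadSpace.2 (Triangulation.StdMatching.quadMatching hy))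
        fun c _ h => forall_quadPositions.1 hyx c h
      exact ⟨a, forall_quadPositions.2 fun c => ha c (Finset.mem_univ c)⟩

end NormalSurface

namespace NormalSurface

variable {n : ℕ} (T : Triangulation n)

/-! ### Correctness of the direct enumeration -/

section DirectEnumeration

theorem isExtremal_top_single (c : QuadCoord n) :
    IsExtremal (⊤ : Submodule ℝ (QuadCoord n → ℝ)) Finset.univ (Pi.single c 1) := by
  refine ⟨Submodule.mem_top, fun d _ => ?_, ⟨c, Finset.mem_univ c, by simp⟩, fun y _ hy => ?_⟩
  · by_cases h : d = c
    · subst h; simp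
    · simp [h]
  · refine ⟨y c, fun d hd => ?_⟩
    by_cases h : d = c
    · subst h; simp
    · rw [hy d hd (by simp [h])]; simp [h]

theorem represents_single : Represents TogetherQuad Finset.univ
    (IsExtremal (⊤ : Submodule ℝ (QuadCoord n → ℝ)) Finset.univ)
    (((List.finRange n).product (List.finRange 3)).map fun c => Pi.single c 1) := by
  have hinj : ∀ c d : QuadCoord n, PosProp Finset.univ (Pi.single c 1 : QuadCoord n → ℝ)
      (Pi.single d 1) → c = d := by
    intro c d h
    by_contra hne
    have h1 := h.eq_zero (Finset.mem_univ d) (by simp [Ne.symm hne])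
    simp at h1
  refine ⟨⟨List.Nodup.map (fun c d h => hinj c d (by rw [h]; exact PosProp.refl _ _))
    ((List.nodup_finRange n).product (List.nodup_finRange 3)), ?_⟩, ?_, ?_⟩
  · intro x hx y hy h
    obtain ⟨c, -, rfl⟩ := List.mem_map.1 hx
    obtain ⟨d, -, rfl⟩ := List.mem_map.1 hy
    rw [hinj c d h]
  · intro x hx
    obtain ⟨c, -, rfl⟩ := List.mem_map.1 hx
    refine ⟨isExtremal_top_single c, fun i k l hkl => ?_⟩
    by_cases h : (i, k) = c
    · exact Or.inr (by
        have : (i, l) ≠ c := fun h' => hkl (congrArg Prod.snd (h.trans h'.symm))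
        simp [this])
    · exact Or.inl (by simp [h])
  -- The unit vector at any position of the support of `x` is supported in `x`, and with no
  -- equations imposed it competes with `x`; so `x` is a multiple of it.
  · intro x hx _
    obtain ⟨c, hc, h⟩ := hx.ne_zero
    refine ⟨Pi.single c 1, List.mem_map.2 ⟨c, List.mem_product.2
      ⟨List.mem_finRange _, List.mem_finRange _⟩, rfl⟩, ?_⟩
    have h1 := isExtremal_top_single c
    refine hx.posProp h1.mem h1.nonneg h1.ne_zero fun d _ hd => ?_
    have : d ≠ c := fun h' => h (h' ▸ hd)
    simp [this]

/-- Coordinate sum 1 is carried along, since `h u • w - h w • u` has sum `h u - h w`, the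
denominator of a crossing. So the first step needs no normalisation at the end. -/
theorem exists_represents_foldl (edges : List (Flag n)) {M : Submodule ℝ (QuadCoord n → ℝ)}
    {L : List (QuadCoord n → ℝ)}
    (hL : Represents TogetherQuad Finset.univ (IsExtremal M Finset.univ) L)
    (hs : ∀ x ∈ L, ∑ c, x c = 1) : ∃ M' : Submodule ℝ (QuadCoord n → ℝ),
      (∀ x, x ∈ M' ↔ x ∈ M ∧ ∀ p ∈ edges, T.edgeForm p x = 0) ∧
      Represents TogetherQuad Finset.univ (IsExtremal M' Finset.univ)
        (edges.foldl (fun L p => (L.filter fun x => T.edgeForm p x = 0) ++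
          newVectors TogetherQuad Finset.univ (T.edgeForm p) L) L) ∧
      ∀ x ∈ edges.foldl (fun L p => (L.filter fun x => T.edgeForm p x = 0) ++
          newVectors TogetherQuad Finset.univ (T.edgeForm p) L) L, ∑ c, x c = 1 := by
  induction edges generalizing M L with
  | nil => exact ⟨M, by simp, hL, hs⟩
  | cons p edges ih =>
    obtain ⟨M', h1, h2⟩ := ih (hL.hyperplane isSupportCompat_quad (T.edgeLinear p)) (by
      intro x hx
      rcases List.mem_append.1 hx with hx | hx
      · exact hs x (List.mem_filter.1 hx).1
      · obtain ⟨u, w, hp, rfl⟩ := mem_newVectors.1 hx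
        have hd : T.edgeLinear p u - T.edgeLinear p w ≠ 0 := by linarith [hp.pos, hp.neg]
        simp only [crossing_apply, ← Finset.mul_sum, Finset.sum_sub_distrib, hs u hp.left_mem,
          hs w hp.right_mem, mul_one]
        exact inv_mul_cancel₀ hd)
    refine ⟨M', fun x => ?_, h2⟩
    rw [h1, Submodule.mem_inf, LinearMap.mem_ker, List.forall_mem_cons, and_assoc]
    rfl

/-- The direct enumeration, carried out over the reals, represents the admissible extremal
solutions of the quadrilateral matching equations. -/
theorem represents_directEnumeration {edges : List (Flag n)}
    (hedges : T.IsInteriorEdgeList edges) :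
    Represents TogetherQuad Finset.univ (IsExtremal T.quadSpace Finset.univ)
      (T.directEnumeration edges) ∧
      ∀ x ∈ (T.directEnumeration edges : List (QuadCoord n → ℝ)), ∑ c, x c = 1 := by
  obtain ⟨M, h1, h2, h3⟩ := exists_represents_foldl T edges represents_single (by
    intro x hx
    obtain ⟨c, -, rfl⟩ := List.mem_map.1 hx
    simp)
  have : M = T.quadSpace := by
    ext x
    rw [h1, T.mem_quadSpace, T.quadMatching_iff hedges]
    simp
  exact ⟨this ▸ h2, h3⟩

end DirectEnumeration

/-! ### Correctness of the conversion -/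

section Conversion

variable {T}

theorem processVertex_eq (CL : Finset (StdCoord n) × List (StdCoord n → ℝ)) (V : List (Corner n)) :
    processVertex CL V = (CL.1 ∪ (trianglePositions V).toFinset,
      (positionFold (fun u w => TogetherQuad (quadProj u) (quadProj w)) (trianglePositions V)
        (CL.1, (CL.2.map fun x => x - minAround V x • vertexLink V) ++ [-vertexLink V])).2 ++
          [vertexLink V]) :=
  Prod.ext (positionFold_fst (fun u w => TogetherQuad (quadProj u) (quadProj w)) _
    (CL.1, (CL.2.map fun x => x - minAround V x • vertexLink V) ++ [-vertexLink V])) rfl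

theorem represents_processVertex {C : Finset (StdCoord n)} {L : List (StdCoord n → ℝ)}
    (hC : quadPositions n ⊆ C)
    (hL : Represents (fun u w => TogetherQuad (quadProj u) (quadProj w)) C
      (IsExtremal T.stdSpace C) L) {V : List (Corner n)} {c : Corner n}
    (hV : ∀ d, d ∈ V ↔ T.SameVertex c d) (hd : ∀ d ∈ V, ((d.1, Sum.inl d.2) : StdCoord n) ∉ C) :
    Represents (fun u w => TogetherQuad (quadProj u) (quadProj w)) (processVertex (C, L) V).1
      (IsExtremal T.stdSpace (processVertex (C, L) V).1) (processVertex (C, L) V).2 := by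
  have hne : V ≠ [] := List.ne_nil_of_mem ((hV c).2 (Relation.EqvGen.refl c))
  rw [processVertex_eq]
  refine hL.vertex (isLinkVector hV hC hd) (by simpa [trianglePositions] using hne)
    (isSupportCompat_std.mono hC) (fun i k l _ => Or.inl ⟨rfl, rfl⟩) (minAround V) fun x => ?_
  obtain ⟨h1, d, hd, h2⟩ := minAround_spec hne x
  exact ⟨forall_trianglePositions.2 h1, _, by
    rw [List.mem_toFinset]; exact List.mem_map_of_mem hd, h2⟩

/-- Disjointness of the classes keeps the positions around later vertices out of the processed set,
as each vertex step requires. -/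
theorem represents_foldl_processVertex (verts : List (List (Corner n)))
    (hcl : ∀ V ∈ verts, ∃ c, ∀ d, d ∈ V ↔ T.SameVertex c d) (hdis : verts.Pairwise List.Disjoint)
    {C : Finset (StdCoord n)} {L : List (StdCoord n → ℝ)} (hC : quadPositions n ⊆ C)
    (hL : Represents (fun u w => TogetherQuad (quadProj u) (quadProj w)) C
      (IsExtremal T.stdSpace C) L)
    (hd : ∀ V ∈ verts, ∀ d ∈ V, ((d.1, Sum.inl d.2) : StdCoord n) ∉ C) :
    ∃ D, (∀ i, i ∈ D ↔ i ∈ C ∨ ∃ V ∈ verts, i ∈ trianglePositions V) ∧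
      Represents (fun u w => TogetherQuad (quadProj u) (quadProj w)) D
        (IsExtremal T.stdSpace D) (verts.foldl processVertex (C, L)).2 := by
  induction verts generalizing C L with
  | nil => exact ⟨C, by simp, hL⟩
  | cons V verts ih =>
    obtain ⟨c, hc⟩ := hcl V List.mem_cons_self
    obtain ⟨hd1, hd2⟩ := List.pairwise_cons.1 hdis
    have hfst : (processVertex (C, L) V).1 = C ∪ (trianglePositions V).toFinset := by
      rw [processVertex_eq]
    obtain ⟨D, h1, h2⟩ := ih (fun W hW => hcl W (List.mem_cons_of_mem _ hW)) hd2
      (hC.trans (by rw [hfst]; exact Finset.subset_union_left))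
      (represents_processVertex hC hL hc (hd V List.mem_cons_self)) fun W hW d hdW h => by
        rw [hfst, Finset.mem_union] at h
        rcases h with h | h
        · exact hd W (List.mem_cons_of_mem _ hW) d hdW h
        · rw [List.mem_toFinset] at h
          obtain ⟨e, he, hed⟩ := List.mem_map.1 h
          simp only [Prod.mk.injEq, Sum.inl.injEq] at hed
          exact hd1 W hW he (Prod.ext hed.1 hed.2 ▸ hdW)
    refine ⟨D, fun i => ?_, h2⟩
    rw [h1, hfst, Finset.mem_union, List.mem_toFinset]
    simp only [List.mem_cons, exists_eq_or_imp, or_assoc]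

/-- The canonical extensions represent the admissible vectors of the standard solution space that
are extremal with respect to the quadrilateral positions. -/
theorem represents_canonicalExtension (hT : T.IsCompactManifold) {verts : List (List (Corner n))}
    (hverts : T.IsVertexList verts) {Q : List (QuadCoord n → ℚ)}
    (hQ : Represents TogetherQuad Finset.univ (IsExtremal T.quadSpace Finset.univ)
      (Q.map toReal)) :
    Represents (fun u w => TogetherQuad (quadProj u) (quadProj w)) (quadPositions n)
      (IsExtremal T.stdSpace (quadPositions n))
      ((Q.map (T.canonicalExtension verts)).map toReal) := by
  have hspec : ∀ q ∈ Q, toReal (T.canonicalExtension verts q) ∈ T.stdSpace ∧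
      quadProj (toReal (T.canonicalExtension verts q)) = toReal q := fun q hq => by
    have h := canonicalExtension_spec T hT hverts
      (T.mem_quadSpace.1 (hQ.sound _ (List.mem_map_of_mem hq)).1.mem)
    exact ⟨h.1, by rw [quadProj_toReal, h.2]⟩
  rw [List.map_map]
  have hinj : ∀ q ∈ Q, ∀ q' ∈ Q, PosProp (quadPositions n)
      (toReal (T.canonicalExtension verts q)) (toReal (T.canonicalExtension verts q')) →
        q = q' := by
    intro q hq q' hq' h
    rw [posProp_quadPositions, (hspec q hq).2, (hspec q' hq').2] at h
    exact toReal_injective (hQ.irredundant.2 _ (List.mem_map_of_mem hq) _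
      (List.mem_map_of_mem hq') h)
  refine ⟨⟨(List.nodup_map_iff_inj_on hQ.irredundant.1.of_map).2 fun q hq q' hq' h =>
    hinj q hq q' hq' (by
      simp only [Function.comp_apply] at h
      rw [h]
      exact PosProp.refl _ _), ?_⟩, ?_, ?_⟩
  · intro x hx y hy h
    obtain ⟨q, hq, rfl⟩ := List.mem_map.1 hx
    obtain ⟨q', hq', rfl⟩ := List.mem_map.1 hy
    rw [hinj q hq q' hq' h]
  · intro x hx
    obtain ⟨q, hq, rfl⟩ := List.mem_map.1 hx
    obtain ⟨h1, h2⟩ := hspec q hq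
    rw [Function.comp_apply, isExtremal_quadProj_iff T hT, h2]
    obtain ⟨h3, h4⟩ := hQ.sound _ (List.mem_map_of_mem hq)
    exact ⟨⟨h1, h3⟩, h4⟩
  · intro x hx hc
    rw [isExtremal_quadProj_iff T hT] at hx
    obtain ⟨z, hz, hzx⟩ := hQ.complete _ hx.2 hc
    obtain ⟨q, hq, rfl⟩ := List.mem_map.1 hz
    refine ⟨_, List.mem_map_of_mem hq, ?_⟩
    rw [Function.comp_apply, posProp_quadPositions, (hspec q hq).2]
    exact hzx

/-- The conversion turns representatives of the admissible extremal solutions of the quadrilateral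
matching equations into representatives of the admissible extremal solutions of the standard
matching equations. -/
theorem represents_quadToStd (hT : T.IsCompactManifold) {verts : List (List (Corner n))}
    (hverts : T.IsVertexList verts) {Q : List (QuadCoord n → ℚ)}
    (hQ : Represents TogetherQuad Finset.univ (IsExtremal T.quadSpace Finset.univ)
      (Q.map toReal)) :
    Represents (fun u w => TogetherQuad (quadProj u) (quadProj w)) Finset.univ
      (IsExtremal T.stdSpace Finset.univ) ((T.quadToStd verts Q).map toReal) ∧
      ∀ x ∈ (T.quadToStd verts Q).map toReal, ∑ c, x c = 1 := by
  obtain ⟨D, h1, h2⟩ := represents_foldl_processVertex verts hverts.isClass hverts.once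
    (Finset.Subset.refl _) (represents_canonicalExtension hT hverts hQ)
    fun V _ d _ h => by simp [quadPositions] at h
  have hD : D = Finset.univ := by
    refine Finset.eq_univ_of_forall fun i => (h1 i).2 ?_
    rcases i with ⟨i, v | k⟩
    · obtain ⟨V, hV, hm⟩ := hverts.complete (i, v)
      exact Or.inr ⟨V, hV, List.mem_map.2 ⟨(i, v), hm, rfl⟩⟩
    · exact Or.inl (by simp [quadPositions])
  subst hD
  have h3 := h2.projImage (isSupportCompat_std.mono (Finset.subset_univ _))
  have h4 : (T.quadToStd verts Q).map toReal = (verts.foldl processVertex (quadPositions n,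
      (Q.map (T.canonicalExtension verts)).map toReal)).2.map projImage := by
    have h5 := congrArg Prod.snd (map_foldl_processVertex verts
      (quadPositions n, Q.map (T.canonicalExtension verts)))
    change List.map toReal _ = (verts.foldl processVertex (quadPositions n,
      (Q.map (T.canonicalExtension verts)).map toReal)).2 at h5
    rw [← h5]
    simp only [Triangulation.quadToStd, List.map_map, Function.comp_def, toReal_projImage,
      quadPositions]
  rw [h4]
  exact h3

end Conversion

end NormalSurface

theorem mainTheorem2 (n : ℕ) (T : NormalSurface.Triangulation n) (hT : T.IsCompactManifold)
    (verts : List (List (NormalSurface.Corner n))) (hverts : T.IsVertexList verts)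
    (edges : List (NormalSurface.Flag n)) (hedges : T.IsInteriorEdgeList edges) :
    ((T.directEnumeration edges : List (NormalSurface.QuadCoord n → ℚ)).Nodup ∧
      NormalSurface.realVectors (T.directEnumeration edges) = T.quadSolutionSet) ∧
    ((T.enumStd verts edges : List (NormalSurface.StdCoord n → ℚ)).Nodup ∧
      NormalSurface.realVectors (T.enumStd verts edges) = T.stdSolutionSet) := by
  obtain ⟨h1, h2⟩ := NormalSurface.represents_directEnumeration T hedges
  rw [← NormalSurface.map_directEnumeration] at h1 h2
  obtain ⟨h3, h4⟩ := NormalSurface.represents_quadToStd hT hverts h1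
  refine ⟨⟨h1.irredundant.1.of_map, ?_⟩, h3.irredundant.1.of_map, ?_⟩
  · ext x
    rw [NormalSurface.mem_realVectors, h1.mem_iff h2, ← NormalSurface.quadConstraints_iff]
    simp only [T.mem_quadSpace]
    rfl
  · ext x
    rw [NormalSurface.mem_realVectors, NormalSurface.Triangulation.enumStd, h3.mem_iff h4,
      ← NormalSurface.quadConstraints_iff]
    rfl
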